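/- **Setting.** Let $d\in\mathbb C$, $|d|=1$, $d^n\ne 1$ for all $n\neq 0$. For $i=1,2$ let $R_i$ be a tracial von Neumann algebra generated by unitaries $u_i,v_i$ with $u_iv_i=d\,v_iu_i$ (so $R_i$ is the hyperfinite $\mathrm{II}_1$ factor), let $M=R_1*R_2$ be the free product with respect to the traces, and let $A=\{u_1+u_1^{-1}+u_2+u_2^{-1}\}''\subset M$. Elements of $M$ are regarded as vectors of $L^2M$, $L^2A$ is the closure of $A$ in $L^2M$, and $P\ominus K$ denotes $P\cap K^\perp$. A *completely reduced word* is $u_{i_1}^{k_1}v_{i_1}^{l_1}\cdots u_{i_n}^{k_n}v_{i_n}^{l_n}$ with $n\ge 0$, $i_1\ne i_2\ne\cdots\ne i_n$ and $(k_t,l_t)\neq(0,0)$; its length is $\sum_t(|k_t|+|l_t|)$. For $l\ge 0$ let $\tilde W_l^0,\tilde W_l^1,\tilde W_l^2$ be the sets of completely reduced words of length $l$ for which no, exactly one, at least two of the $l_t$ are non-zero, and let $W_l^j=\operatorname{span}\tilde W_l^j$ and $W_l=W_l^0\oplus W_l^1\oplus W_l^2$. Let $q_l$ be the orthogonal projection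 of $L^2M$ onto $W_l$, let $\chi_l=\sum_{w\in\tilde W_l^0}w$, and let $S_l^j=\operatorname{span}\{q_l(\chi_1w),q_l(w\chi_1): w\in W_k^j,\ k\le l-1\}$. For $\xi\in W_l$ and $r,s\ge 0$ put $\xi_{r,s}=q_{l+r+s}(\chi_r\xi\chi_s)$. For $l\in\mathbb Z\setminus\{0,\pm1\}$, with $m=l-\operatorname{sgn}(l)$, put $$\gamma^i_l=\frac{2}{d^{-m}-d^{m}}\,(v_i^mu_i-v_i^mu_i^{-1})-(u_{3-i}+u_{3-i}^{-1})v_i^m,$$ $$\bar\gamma^i_l=\frac{2}{d^{m}-d^{-m}}\,(d^mv_i^mu_i-d^{-m}v_i^mu_i^{-1})-v_i^m(u_{3-i}+u_{3-i}^{-1}).$$ For $l\ge1$ let * $W_l^{1,\alpha}=\operatorname{span}\{u_i^{\pm1}v_j^{\pm(l-1)},\,v_j^{\pm(l-1)}u_i^{\pm1}: i,j=1,2\}$, * $W_l^{1,\beta}=W_l^1\ominus(W_l^{1,\alpha}\oplus\mathbb Cv_1^{\pm l}\oplus\mathbb Cv_2^{\pm l})$, * $W_l^{1,\alpha,1}=\operatorname{span}\{\gamma^i_{\pm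 l},\bar\gamma^i_{\pm l}: i=1,2\}$ and $W_l^{1,\alpha,2}=\operatorname{span}\{(u_{3-i}-u_{3-i}^{-1})v_i^{\pm(l-1)},\,v_i^{\pm(l-1)}(u_{3-i}-u_{3-i}^{-1}): i=1,2\}$ if $l\ge 2$, and $W_1^{1,\alpha,1}=W_1^{1,\alpha,2}=0$. (In the first and last item all combinations of signs are allowed.) Let $$L=\overline{\operatorname{span}}\{A\,W_l^{1,\alpha,1}A,\ A\,v_i^{\pm l}A : i=1,2,\ l\ge1\}\subset L^2M .$$ Let $(\xi_m)_{m\in\mathbb N}$ be any sequence obtained by choosing an orthonormal basis of each of the finite-dimensional spaces $W_l^0\ominus S_l^0$, $W_l^2\ominus S_l^2$, $W_l^{1,\alpha,2}\ominus S_l^1$, $W_l^{1,\beta}\ominus S_l^1$ $(l\ge 1)$ and enumerating the union of these bases. For $i\in\{1,2\}$, $l\in\mathbb Z\setminus\{0\}$, $k\in\mathbb Z$ and $r,s\ge0$ let $$\xi^{i,l,k}_{r,s}=\frac{1}{3^{\frac{r+s}{2}-1}}\Bigl(\sum_{w}w\Bigr)v_i^l\,u_i^k\Bigl(\sum_{w'}w'\Bigr),$$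 where $w$ runs over the words of $\tilde W^0_r$ that end with $u_{3-i}^{\pm1}$ and $w'$ over the words of $\tilde W_s^0$ that begin with $u_{3-i}^{\pm1}$ (only the empty word if $r=0$, resp. $s=0$). **Corollary 3.12.** 1. Such sequences $(\xi_m)$ exist, and for each of them the normalised vectors $(\xi_m)_{r,s}/\|(\xi_m)_{r,s}\|$, $m\in\mathbb N$, $r,s\ge 0$, form a Riesz basis of $L^2M\ominus(L^2A\oplus L)$: their closed span is this space, and there are constants $0<c\le C$ such that $c\sum|a_{m,r,s}|^2\le\bigl\|\sum a_{m,r,s}(\xi_m)_{r,s}/\|(\xi_m)_{r,s}\|\bigr\|^2\le C\sum|a_{m,r,s}|^2$ for all finitely supported complex families $(a_{m,r,s})$. 2. The vectors $\xi^{i,l,k}_{r,s}$ are non-zero and pairwise orthogonal, and $L\subset\bigoplus_{i,l,k,r,s}\mathbb C\,\xi^{i,l,k}_{r,s}$ (closed orthogonal direct sum). 3. $L^2A\perp L$ and $L\oplus\bigl(L^2M\ominus(L^2A\oplus L)\bigr)=L^2M\ominus L^2A$ (orthogonal direct sum). -/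

import Mathlib

open scoped InnerProductSpace

noncomputable section

namespace RotFree

/-! ### Completely reduced words -/

/-- A syllable `(i, k, l)` stands for `u_i ^ k * v_i ^ l`. The two indices are `0, 1 : Fin 2`,
and the index different from `i` is `1 - i`. -/
abbrev Syllable : Type := Fin 2 × ℤ × ℤ

/-- Completely reduced words: consecutive syllables have different indices `i`, and no syllable
is trivial. The empty list is the trivial word. -/
def IsReducedWord (w : List Syllable) : Prop :=
  w.IsChain (fun s t => s.1 ≠ t.1) ∧ ∀ s ∈ w, s.2 ≠ (0, 0)

/-- Word length: the number of letters `u_i^{±1}`, `v_i^{±1}`. -/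
def wordLength (w : List Syllable) : ℕ :=
  (w.map fun s => s.2.1.natAbs + s.2.2.natAbs).sum

/-- The number of syllables `u_i ^ k * v_i ^ l` with `l ≠ 0`. -/
def vCount (w : List Syllable) : ℕ :=
  w.countP fun s => s.2.2 ≠ 0

theorem finite_reducedWords (l : ℕ) :
    {w : List Syllable | IsReducedWord w ∧ wordLength w = l}.Finite := by
  let D : Type := Fin 2 × (Finset.Icc (-(l : ℤ)) l) × (Finset.Icc (-(l : ℤ)) l)
  let e : D → Syllable := fun s => (s.1, s.2.1.1, s.2.2.1)
  refine ((List.finite_length_le D l).image (List.map e)).subset ?_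
  rintro w ⟨⟨-, hne⟩, hw⟩
  have key : ∀ w : List Syllable, (∀ s ∈ w, s.2 ≠ (0, 0)) → wordLength w ≤ l →
      ∃ w' : List D, w'.length ≤ wordLength w ∧ w'.map e = w := by
    intro w
    induction w with
    | nil => intro _ _; exact ⟨[], by simp, rfl⟩
    | cons s w ih =>
      intro h1 h2
      have hs : s.2 ≠ (0, 0) := h1 s (by simp)
      have hlen : wordLength (s :: w) = s.2.1.natAbs + s.2.2.natAbs + wordLength w := by
        simp [wordLength]
      obtain ⟨w', hw1, hw2⟩ := ih (fun t ht => h1 t (by simp [ht])) (by omega)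
      obtain ⟨i, a, b⟩ := s
      have hpos : 1 ≤ a.natAbs + b.natAbs := by
        by_contra hcon
        apply hs
        simp only [Prod.mk.injEq]
        omega
      simp only at hlen
      refine ⟨(i, ⟨a, ?_⟩, ⟨b, ?_⟩) :: w', ?_, ?_⟩
      · rw [Finset.mem_Icc]; omega
      · rw [Finset.mem_Icc]; omega
      · simp only [List.length_cons]; omega
      · simp [hw2, e]
  obtain ⟨w', h1, h2⟩ := key w hne hw.le
  exact ⟨w', by simpa [hw] using h1, h2⟩

/-- The completely reduced words of length `l`. -/
def words (l : ℕ) : Finset (List Syllable) := (finite_reducedWords l).toFinset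

/-- `wordsOfType j l` is, for `j = 0, 1, 2`, the set of completely reduced words of length `l`
with no, exactly one, at least two syllables containing a power of a `v_i`, respectively. -/
def wordsOfType (j l : ℕ) : Finset (List Syllable) :=
  (words l).filter fun w => min (vCount w) 2 = j

/-! ### Von Neumann algebras, the trace vector and the free product -/

variable {H : Type*} [NormedAddCommGroup H] [InnerProductSpace ℂ H] [CompleteSpace H]

/-- The von Neumann algebra generated by `S`: the double commutant of `S ∪ S*`. -/
def generatedVN (S : Set (H →L[ℂ] H)) : VonNeumannAlgebra H where
  toStarSubalgebra := StarSubalgebra.centralizer ℂ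
    (StarSubalgebra.centralizer ℂ S : Set (H →L[ℂ] H))
  centralizer_centralizer' := by
    change Set.centralizer (Set.centralizer
      (StarSubalgebra.centralizer ℂ (StarSubalgebra.centralizer ℂ S : Set (H →L[ℂ] H)) :
        Set (H →L[ℂ] H))) = (StarSubalgebra.centralizer ℂ
          (StarSubalgebra.centralizer ℂ S : Set (H →L[ℂ] H)) : Set (H →L[ℂ] H))
    rw [StarSubalgebra.coe_centralizer_centralizer, Set.centralizer_centralizer_centralizer]

/-- `H` is the GNS space `L²(M, τ)` of a faithful normal tracial state `τ` on `M`, and `Ω` is the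
canonical cyclic vector: `Ω` is a cyclic unit vector and `τ x = ⟪Ω, x Ω⟫` is a trace on `M`.
(Faithfulness of `τ` follows from cyclicity and the trace property.) -/
structure IsTracialGNS (M : VonNeumannAlgebra H) (Ω : H) : Prop where
  norm_eq_one : ‖Ω‖ = 1
  trace : ∀ x ∈ M, ∀ y ∈ M, ⟪Ω, (x * y) Ω⟫_ℂ = ⟪Ω, (y * x) Ω⟫_ℂ
  cyclic : Dense {ξ : H | ∃ x ∈ M, x Ω = ξ}

/-- Free independence of two von Neumann algebras with respect to `τ x = ⟪Ω, x Ω⟫`: every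
alternating product of elements of trace zero has trace zero. -/
def IsFree (R : Fin 2 → VonNeumannAlgebra H) (Ω : H) : Prop :=
  ∀ a : List (Fin 2 × (H →L[ℂ] H)), a ≠ [] → a.IsChain (fun s t => s.1 ≠ t.1) →
    (∀ s ∈ a, s.2 ∈ R s.1 ∧ ⟪Ω, s.2 Ω⟫_ℂ = 0) →
      ⟪Ω, (a.map Prod.snd).prod Ω⟫_ℂ = 0

/-- `H` is `L²(R₀ * R₁)`, where `R₀ * R₁` is the tracial free product of `R₀` and `R₁`, realised
as the von Neumann algebra on `H` generated by `R₀` and `R₁`, with trace vector `Ω`. -/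
structure IsFreeProduct (R : Fin 2 → VonNeumannAlgebra H) (Ω : H) : Prop where
  gns : IsTracialGNS (generatedVN (⋃ i, (R i : Set (H →L[ℂ] H)))) Ω
  free : IsFree R Ω

/-- The von Neumann algebras `R_i` generated by `u_i` and `v_i`. -/
def factorR (u v : Fin 2 → unitary (H →L[ℂ] H)) (i : Fin 2) : VonNeumannAlgebra H :=
  generatedVN {(u i : H →L[ℂ] H), (v i : H →L[ℂ] H)}

/-! ### The subspaces spanned by words

An operator `x` is regarded as the vector `x Ω`. Subspaces of `L²` that consist of
linear combinations of words are kept as spaces of operators, so that products make sense. -/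

/-- The integer powers of `u_i`, as operators. -/
def uPow (u : Fin 2 → unitary (H →L[ℂ] H)) (i : Fin 2) (k : ℤ) : H →L[ℂ] H :=
  ((u i ^ k : unitary (H →L[ℂ] H)) : H →L[ℂ] H)

/-- The operator represented by a word. -/
def wordOp (u v : Fin 2 → unitary (H →L[ℂ] H)) (w : List Syllable) : H →L[ℂ] H :=
  (w.map fun s => uPow u s.1 s.2.1 * uPow v s.1 s.2.2).prod

/-- `W_l^j`, `j = 0, 1, 2`. -/
def W (u v : Fin 2 → unitary (H →L[ℂ] H)) (j l : ℕ) : Submodule ℂ (H →L[ℂ] H) :=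
  Submodule.span ℂ (wordOp u v '' (wordsOfType j l : Set (List Syllable)))

/-- The map `x ↦ x Ω`. -/
def toL2 (Ω : H) : (H →L[ℂ] H) →ₗ[ℂ] H where
  toFun x := x Ω
  map_add' _ _ := rfl
  map_smul' _ _ := rfl

/-- The subspace `W_l = W_l^0 ⊕ W_l^1 ⊕ W_l^2` of `L²`. -/
def WL2 (u v : Fin 2 → unitary (H →L[ℂ] H)) (Ω : H) (l : ℕ) : Submodule ℂ H :=
  Submodule.span ℂ ((fun w => wordOp u v w Ω) '' (words l : Set (List Syllable)))

instance (u v : Fin 2 → unitary (H →L[ℂ] H)) (Ω : H) (l : ℕ) :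
    FiniteDimensional ℂ (WL2 u v Ω l) :=
  FiniteDimensional.span_of_finite ℂ ((words l).finite_toSet.image _)

/-- The orthogonal projection `q_l` onto `W_l`. -/
def q (u v : Fin 2 → unitary (H →L[ℂ] H)) (Ω : H) (l : ℕ) : H →L[ℂ] H :=
  (WL2 u v Ω l).starProjection

/-- `χ_l`, the sum of all words of length `l` in the letters `u_i^{±1}`. -/
def chi (u v : Fin 2 → unitary (H →L[ℂ] H)) (l : ℕ) : H →L[ℂ] H :=
  ∑ w ∈ wordsOfType 0 l, wordOp u v w

/-- `S_l^j`, the span of the vectors `q_l (χ₁ w)` and `q_l (w χ₁)` with `w ∈ W_k^j`, `k < l`. -/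
def S (u v : Fin 2 → unitary (H →L[ℂ] H)) (Ω : H) (j l : ℕ) : Submodule ℂ H :=
  Submodule.span ℂ {ξ : H | ∃ k < l, ∃ w ∈ W u v j k,
    ξ = q u v Ω l ((chi u v 1 * w) Ω) ∨ ξ = q u v Ω l ((w * chi u v 1) Ω)}

/-- `P ⊖ K`: the elements of `P` that, as vectors of `L²`, are orthogonal to `K`. -/
def ominus (Ω : H) (P : Submodule ℂ (H →L[ℂ] H)) (K : Submodule ℂ H) :
    Submodule ℂ (H →L[ℂ] H) :=
  P ⊓ Kᗮ.comap (toL2 Ω)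

/-- `u_i + u_i⁻¹`. -/
def uPlus (u : Fin 2 → unitary (H →L[ℂ] H)) (i : Fin 2) : H →L[ℂ] H :=
  uPow u i 1 + uPow u i (-1)

/-- `u_i - u_i⁻¹`. -/
def uMinus (u : Fin 2 → unitary (H →L[ℂ] H)) (i : Fin 2) : H →L[ℂ] H :=
  uPow u i 1 - uPow u i (-1)

/-- `γ^i_l`; used for `l ≠ 0, 1, -1` only. -/
def gam (d : ℂ) (u v : Fin 2 → unitary (H →L[ℂ] H)) (i : Fin 2) (l : ℤ) : H →L[ℂ] H :=
  (2 / (d ^ (-(l - l.sign)) - d ^ (l - l.sign))) •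
      (uPow v i (l - l.sign) * uPow u i 1 - uPow v i (l - l.sign) * uPow u i (-1))
    - uPlus u (1 - i) * uPow v i (l - l.sign)

/-- `γ̄^i_l`; used for `l ≠ 0, 1, -1` only. -/
def gamBar (d : ℂ) (u v : Fin 2 → unitary (H →L[ℂ] H)) (i : Fin 2) (l : ℤ) : H →L[ℂ] H :=
  (2 / (d ^ (l - l.sign) - d ^ (-(l - l.sign)))) •
      (d ^ (l - l.sign) • (uPow v i (l - l.sign) * uPow u i 1)
        - d ^ (-(l - l.sign)) • (uPow v i (l - l.sign) * uPow u i (-1)))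
    - uPow v i (l - l.sign) * uPlus u (1 - i)

/-- `W_l^{1,α}`, the span of `u_i^{±1} v_j^{±(l-1)}` and `v_j^{±(l-1)} u_i^{±1}`, for `l ≥ 1`. -/
def Walpha (u v : Fin 2 → unitary (H →L[ℂ] H)) (l : ℕ) : Submodule ℂ (H →L[ℂ] H) :=
  Submodule.span ℂ {x | ∃ i j : Fin 2, ∃ s t : ℤ, |s| = 1 ∧ |t| = (l : ℤ) - 1 ∧
    (x = uPow u i s * uPow v j t ∨ x = uPow v j t * uPow u i s)}

/-- The span of `v_1^{±l}` and `v_2^{±l}`. -/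
def Wv (v : Fin 2 → unitary (H →L[ℂ] H)) (l : ℕ) : Submodule ℂ (H →L[ℂ] H) :=
  Submodule.span ℂ {x | ∃ i : Fin 2, ∃ t : ℤ, |t| = (l : ℤ) ∧ x = uPow v i t}

/-- `W_l^{1,β} = W_l^1 ⊖ (W_l^{1,α} ⊕ ℂ v_1^{±l} ⊕ ℂ v_2^{±l})`. -/
def Wbeta (u v : Fin 2 → unitary (H →L[ℂ] H)) (Ω : H) (l : ℕ) : Submodule ℂ (H →L[ℂ] H) :=
  ominus Ω (W u v 1 l) ((Walpha u v l ⊔ Wv v l).map (toL2 Ω))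

/-- `W_l^{1,α,1}`, spanned by `γ^i_{±l}` and `γ̄^i_{±l}` if `l ≥ 2`, and `0` if `l = 1`. -/
def Walpha1 (d : ℂ) (u v : Fin 2 → unitary (H →L[ℂ] H)) (l : ℕ) :
    Submodule ℂ (H →L[ℂ] H) :=
  Submodule.span ℂ {x | 2 ≤ l ∧ ∃ i : Fin 2, ∃ t : ℤ, |t| = (l : ℤ) ∧
    (x = gam d u v i t ∨ x = gamBar d u v i t)}

/-- `W_l^{1,α,2}`, spanned by `(u_{i'} - u_{i'}⁻¹) v_i^{±(l-1)}` and
`v_i^{±(l-1)} (u_{i'} - u_{i'}⁻¹)`, `i' ≠ i`, if `l ≥ 2`, and `0` if `l = 1`. -/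
def Walpha2 (u v : Fin 2 → unitary (H →L[ℂ] H)) (l : ℕ) : Submodule ℂ (H →L[ℂ] H) :=
  Submodule.span ℂ {x | 2 ≤ l ∧ ∃ i : Fin 2, ∃ t : ℤ, |t| = (l : ℤ) - 1 ∧
    (x = uMinus u (1 - i) * uPow v i t ∨ x = uPow v i t * uMinus u (1 - i))}

/-! ### The vectors `(ξ_m)_{r,s}` -/

/-- The four kinds `0`, `2`, `(1,α,2)`, `(1,β)` of subspaces the vectors `ξ_m` are taken from. -/
inductive Kind : Type
  | zero
  | two
  | alphaTwo
  | beta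

/-- `W_l^κ ⊖ S_l^j`, where `j = 0, 2, 1, 1` for `κ = 0, 2, (1,α,2), (1,β)`. -/
def N (u v : Fin 2 → unitary (H →L[ℂ] H)) (Ω : H) (κ : Kind) (l : ℕ) :
    Submodule ℂ (H →L[ℂ] H) :=
  match κ with
  | Kind.zero => ominus Ω (W u v 0 l) (S u v Ω 0 l)
  | Kind.two => ominus Ω (W u v 2 l) (S u v Ω 2 l)
  | Kind.alphaTwo => ominus Ω (Walpha2 u v l) (S u v Ω 1 l)
  | Kind.beta => ominus Ω (Wbeta u v Ω l) (S u v Ω 1 l)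

/-- `ξ_0, ξ_1, …` is an enumeration of the union of orthonormal bases of the spaces
`W_l^κ ⊖ S_l^j`, over all `l ≥ 1` and all four kinds `κ`; the vector `ξ_m` belongs to the space
with `l = len m` and `κ = kind m`. -/
structure IsBasisSequence (u v : Fin 2 → unitary (H →L[ℂ] H)) (Ω : H)
    (ξ : ℕ → (H →L[ℂ] H)) (len : ℕ → ℕ) (kind : ℕ → Kind) : Prop where
  len_pos : ∀ m, 1 ≤ len m
  mem : ∀ m, ξ m ∈ N u v Ω (kind m) (len m)
  orthonormal : Orthonormal ℂ fun m => ξ m Ω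
  span : ∀ l, 1 ≤ l → ∀ κ,
    N u v Ω κ l ≤ Submodule.span ℂ {x | ∃ m, kind m = κ ∧ len m = l ∧ x = ξ m}

/-- `x_{r,s} = q_{l+r+s} (χ_r x χ_s)` for `x ∈ W_l`. -/
def shift (u v : Fin 2 → unitary (H →L[ℂ] H)) (Ω : H) (l : ℕ) (x : H →L[ℂ] H) (r s : ℕ) : H :=
  q u v Ω (l + r + s) ((chi u v r * x * chi u v s) Ω)

/-- `f` is a Riesz basis of the closed subspace `K`. -/
def IsRieszBasis {ι : Type*} (f : ι → H) (K : Submodule ℂ H) : Prop :=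
  (Submodule.span ℂ (Set.range f)).topologicalClosure = K ∧
  ∃ c C : ℝ, 0 < c ∧ ∀ a : ι →₀ ℂ,
    c * ∑ j ∈ a.support, ‖a j‖ ^ 2 ≤ ‖∑ j ∈ a.support, a j • f j‖ ^ 2 ∧
    ‖∑ j ∈ a.support, a j • f j‖ ^ 2 ≤ C * ∑ j ∈ a.support, ‖a j‖ ^ 2

/-! ### The subspaces `L²A` and `L`, and the vectors `ξ^{i,l,k}_{r,s}` -/

/-- `A`, the von Neumann algebra generated by `u_1 + u_1⁻¹ + u_2 + u_2⁻¹`. -/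
def algA (u : Fin 2 → unitary (H →L[ℂ] H)) : VonNeumannAlgebra H :=
  generatedVN {uPlus u 0 + uPlus u 1}

/-- `L²A`, the closure of `A Ω`. -/
def L2A (u : Fin 2 → unitary (H →L[ℂ] H)) (Ω : H) : Submodule ℂ H :=
  (Submodule.span ℂ {ξ : H | ∃ a ∈ algA u, ξ = a Ω}).topologicalClosure

/-- `L`, the closed span of `A W_l^{1,α,1} A` and `A v_i^{±l} A`, `l ≥ 1`. -/
def L (d : ℂ) (u v : Fin 2 → unitary (H →L[ℂ] H)) (Ω : H) : Submodule ℂ H :=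
  (Submodule.span ℂ {ξ : H | ∃ a ∈ algA u, ∃ b ∈ algA u, ∃ x : H →L[ℂ] H,
    ((∃ l : ℕ, 1 ≤ l ∧ x ∈ Walpha1 d u v l) ∨ ∃ i : Fin 2, ∃ l : ℤ, l ≠ 0 ∧ x = uPow v i l) ∧
    ξ = (a * x * b) Ω}).topologicalClosure

/-- The sum of the words of length `r` in the letters `u_1^{±1}, u_2^{±1}` which end with
`u_i^{±1}` (the empty word if `r = 0`). -/
def sumEnding (u v : Fin 2 → unitary (H →L[ℂ] H)) (i : Fin 2) (r : ℕ) : H →L[ℂ] H :=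
  ∑ w ∈ (wordsOfType 0 r).filter (fun w => ∀ s ∈ w.getLast?, s.1 = i), wordOp u v w

/-- The sum of the words of length `s` in the letters `u_1^{±1}, u_2^{±1}` which begin with
`u_i^{±1}` (the empty word if `s = 0`). -/
def sumBeginning (u v : Fin 2 → unitary (H →L[ℂ] H)) (i : Fin 2) (s : ℕ) : H →L[ℂ] H :=
  ∑ w ∈ (wordsOfType 0 s).filter (fun w => ∀ t ∈ w.head?, t.1 = i), wordOp u v w

/-- `ξ^{i,l,k}_{r,s}`. -/
def xi (u v : Fin 2 → unitary (H →L[ℂ] H)) (Ω : H) (i : Fin 2) (l k : ℤ) (r s : ℕ) : H :=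
  ((1 / (3 : ℝ) ^ (((r : ℝ) + s) / 2 - 1) : ℝ) : ℂ) •
    (sumEnding u v (1 - i) r * uPow v i l * uPow u i k * sumBeginning u v (1 - i) s) Ω

/-- The index set of the vectors `ξ^{i,l,k}_{r,s}`: tuples `(i, l, k, r, s)` with `l ≠ 0`. -/
abbrev XiIndex : Type := Fin 2 × {l : ℤ // l ≠ 0} × ℤ × ℕ × ℕ

/-- The family of the vectors `ξ^{i,l,k}_{r,s}`. -/
def xiFamily (u v : Fin 2 → unitary (H →L[ℂ] H)) (Ω : H) (p : XiIndex) : H :=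
  xi u v Ω p.1 p.2.1.1 p.2.2.1 p.2.2.2.1 p.2.2.2.2

end RotFree

end

/-! Words give an orthonormal basis of L²M. Conjugation by u_i or v_i multiplies a non-trivial
syllable by a power of d different from 1, so its trace is zero, and freeness then separates
distinct words (`orthonormal_words`, `dense_span_words`). The problem thus becomes combinatorial. Of
the four letters u_1^{±1}, u_2^{±1} at most one shortens a given word from the left, and likewise
from the right, so left and right multiplication by χ₁ are weighted adjacency operators of two
forests of 4-regular trees. Each splits as `up + dn` into a lengthening part and its adjoint, and
`dn ∘ up = 3 + root`, where `root` projects onto the words that no letter shortens (`dn_up`). Hence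
`up ^ r` distorts norms by 3^(r/2) up to a bounded factor.

In this language ξ_{r,s} is `up ^ r` from the left and `up ^ s` from the right applied to ξ
(`shift_toOp`), and a vector of W_l^j is orthogonal to S_l^j iff both `dn` kill it
(`mem_S_orthogonal_iff`). Left and right operators interfere only on a few short words; on all
others, the generic ones, `dn` of one side commutes with `up` of the other. So shifts of generic
kernel vectors by different (r, s) are orthogonal (`inner_shift`), and for fixed (r, s) the shift is
bounded above and below. This yields the Riesz bounds for all ξ_m except combinations of single
letters. For those, shortening on one side after lengthening on the other is an isometry `flip`, and
the Gram matrix of the shifts of total degree n has entries 3^(n-|r-r'|) ⟪x, flip^|r-r'| y⟫.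
Subtracting from each shift one third of the flipped previous one orthogonalises the system
(`norm_sum_letterShift_succ`), and the bounds follow by induction (`letter_bounds`).

Completeness is an induction on word length (`sup_eq_top`). A homogeneous vector is a sum of
lengthened vectors and a vector killed by both `dn` (`exists_decomposition`). This settles all words
except the powers v_i^m, which belong to L, and the words with one letter besides v_i^m. The six
words u_i^{±1} v_i^m, u_{1-i}^{±1} v_i^m, v_i^m u_{1-i}^{±1} are recovered from χ₁ v_i^m, v_i^m χ₁,
γ, γ̄ and two antisymmetric vectors, by a linear system whose determinant is non-zero
(`vec_mem_of_generators`). The span of all shifts is invariant under multiplication by χ₁ on both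
sides and orthogonal to 1, v_i^m, γ and γ̄; these multiplications being self-adjoint, it is
orthogonal to L²A and L (`orthogonal_L2A_sup_L`).

For the containment of L in the lines, each word x u_i^k v_i^l y with x, y in the letters u gets the
colour (i, l, k, |x|, |y|). The sum over a colour class is a non-zero multiple of ξ^{i,l,k}_{r,s}.
The span of these sums is invariant under both multiplications, because the colours and phases of
the neighbours of a word depend only on its colour (`sum_color_lmul`), and it contains the
generators of L. Finally L²A ⟂ L, since multiplication by letters u preserves the number of
syllables containing v: it is 0 on L²A and 1 on L. -/

noncomputable section

namespace RotFree

/-! ### Letters acting on reduced words -/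

/-- The letter `(i, ε)` stands for `u_i ^ ε`, `ε = ±1`. -/
abbrev Letter : Type := Fin 2 × ℤˣ

/-- The inverse letter. -/
def letterInv (c : Letter) : Letter := (c.1, -c.2)

@[simp] theorem letterInv_fst (c : Letter) : (letterInv c).1 = c.1 := rfl
@[simp] theorem letterInv_snd (c : Letter) : (letterInv c).2 = -c.2 := rfl
@[simp] theorem letterInv_letterInv (c : Letter) : letterInv (letterInv c) = c := by
  simp [letterInv]

theorem unit_cases (e : ℤˣ) : (e : ℤ) = 1 ∨ (e : ℤ) = -1 := by
  rcases Int.units_eq_one_or e with h | h <;> simp [h]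

/-- Left multiplication of a word by a letter, on lists of syllables. -/
def lmul (c : Letter) : List Syllable → List Syllable
  | [] => [(c.1, (c.2 : ℤ), 0)]
  | (i, k, l) :: t =>
    -- The power of u_i stands first in a syllable, so no phase arises on the left.
    if i = c.1 then (if k + c.2 = 0 ∧ l = 0 then t else (i, k + c.2, l) :: t)
    else (c.1, (c.2 : ℤ), 0) :: (i, k, l) :: t

theorem lmul_cons (c : Letter) (i : Fin 2) (k l : ℤ) (t : List Syllable) :
    lmul c ((i, k, l) :: t) = if i = c.1 then
      (if k + c.2 = 0 ∧ l = 0 then t else (i, k + c.2, l) :: t)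
    else (c.1, (c.2 : ℤ), 0) :: (i, k, l) :: t := rfl

/-- The word `u_i ^ k * v_i ^ l`, which may be trivial. -/
def syl (i : Fin 2) (k l : ℤ) : List Syllable := if k = 0 ∧ l = 0 then [] else [(i, k, l)]

theorem lmul_syl (c : Letter) (k l : ℤ) : lmul c (syl c.1 k l) = syl c.1 (k + c.2) l := by
  unfold syl
  split_ifs with h h' h'
  · rcases unit_cases c.2 with h1 | h1 <;> rw [h1] at h' <;> omega
  · simp [lmul, h.1, h.2]
  · simp [lmul_cons, h']
  · simp only [lmul_cons, if_true, if_neg h']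

@[simp] theorem reverse_syl (i : Fin 2) (k l : ℤ) : (syl i k l).reverse = syl i k l := by
  unfold syl; split_ifs <;> rfl

theorem syl_of_ne {i : Fin 2} {k l : ℤ} (h : ¬ (k = 0 ∧ l = 0)) : syl i k l = [(i, k, l)] :=
  if_neg h

/-- Right multiplication of a word by a letter, on lists of syllables and up to phases. -/
def rmul (c : Letter) (w : List Syllable) : List Syllable := (lmul c w.reverse).reverse

theorem isReducedWord_cons {s : Syllable} {t : List Syllable} :
    IsReducedWord (s :: t) ↔ (∀ x ∈ t.head?, s.1 ≠ x.1) ∧ s.2 ≠ (0, 0) ∧ IsReducedWord t := by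
  simp only [IsReducedWord, List.isChain_cons, List.forall_mem_cons]
  tauto

theorem isReducedWord_nil : IsReducedWord [] := by simp [IsReducedWord]

theorem isReducedWord_singleton {s : Syllable} : IsReducedWord [s] ↔ s.2 ≠ (0, 0) := by
  simp [IsReducedWord]

theorem IsReducedWord.reverse {w : List Syllable} (h : IsReducedWord w) :
    IsReducedWord w.reverse := by
  exact ⟨List.isChain_reverse.2 (h.1.imp fun a b hab => hab.symm),
    fun s hs => h.2 s (by simpa using hs)⟩

@[simp] theorem wordLength_nil : wordLength [] = 0 := rfl
@[simp] theorem wordLength_cons (s : Syllable) (t : List Syllable) :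
    wordLength (s :: t) = s.2.1.natAbs + s.2.2.natAbs + wordLength t := by simp [wordLength]
@[simp] theorem wordLength_append (s t : List Syllable) :
    wordLength (s ++ t) = wordLength s + wordLength t := by simp [wordLength]
@[simp] theorem wordLength_reverse (w : List Syllable) :
    wordLength w.reverse = wordLength w := by
  simp [wordLength, List.map_reverse, List.sum_reverse]

@[simp] theorem vCount_nil : vCount [] = 0 := rfl
@[simp] theorem vCount_cons (s : Syllable) (t : List Syllable) :
    vCount (s :: t) = (if s.2.2 = 0 then 0 else 1) + vCount t := by
  by_cases h : s.2.2 = 0 <;> simp [vCount, h, add_comm]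
@[simp] theorem vCount_reverse (w : List Syllable) : vCount w.reverse = vCount w := by
  simp [vCount]

theorem wordLength_syl (i : Fin 2) (k l : ℤ) :
    wordLength (syl i k l) = k.natAbs + l.natAbs := by
  unfold syl; split_ifs with h <;> simp [*]

/-- The number of letters `v_i^{±1}` in a word. -/
def vLength (w : List Syllable) : ℕ := (w.map fun s => s.2.2.natAbs).sum

@[simp] theorem vLength_nil : vLength [] = 0 := rfl
@[simp] theorem vLength_cons (s : Syllable) (t : List Syllable) :
    vLength (s :: t) = s.2.2.natAbs + vLength t := by simp [vLength]
@[simp] theorem vLength_append (s t : List Syllable) :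
    vLength (s ++ t) = vLength s + vLength t := by simp [vLength]
@[simp] theorem vLength_reverse (w : List Syllable) : vLength w.reverse = vLength w := by
  simp [vLength, List.map_reverse, List.sum_reverse]

theorem IsReducedWord.lmul {w : List Syllable} (h : IsReducedWord w) (c : Letter) :
    IsReducedWord (lmul c w) := by
  rcases w with _ | ⟨⟨i, k, l⟩, t⟩
  · rcases unit_cases c.2 with h1 | h1 <;> simp [RotFree.lmul, isReducedWord_singleton, h1]
  · obtain ⟨h1, h2, h3⟩ := isReducedWord_cons.1 h
    rw [lmul_cons]
    split_ifs with hi hk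
    · exact h3
    · exact isReducedWord_cons.2 ⟨h1, by simpa using hk, h3⟩
    · refine isReducedWord_cons.2 ⟨by simpa using fun h => hi h.symm, ?_, h⟩
      rcases unit_cases c.2 with h1 | h1 <;> simp [h1]

/-- If the first syllable cancels, the next one has the other index, so the inverse letter opens a
new syllable and restores it. -/
theorem lmul_inv {w : List Syllable} (h : IsReducedWord w) (c : Letter) :
    lmul (letterInv c) (lmul c w) = w := by
  rcases w with _ | ⟨⟨i, k, l⟩, t⟩
  · simp [lmul]
  · obtain ⟨h1, h2, h3⟩ := isReducedWord_cons.1 h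
    by_cases hi : i = c.1
    · by_cases hk : k + c.2 = 0 ∧ l = 0
      · rcases t with _ | ⟨⟨j, k', l'⟩, t⟩
        · simp [lmul, hi, hk]; omega
        · have : j ≠ c.1 := by simpa [hi, eq_comm] using h1
          simp [lmul, hi, hk, this]; omega
      · have h2' : ¬ (k = 0 ∧ l = 0) := by simpa using h2
        simp only [lmul_cons, hi, if_true, if_neg hk, letterInv_fst, letterInv_snd, Units.val_neg,
          add_neg_cancel_right, if_neg h2']
    · simp [lmul, hi]

/-- `c` is a left descent of `w` iff `w` begins with the letter `c⁻¹`. -/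
def IsLeftDescent (c : Letter) (w : List Syllable) : Prop :=
  ∃ k l t, w = (c.1, k, l) :: t ∧ k * c.2 < 0

theorem wordLength_lmul {w : List Syllable} (h : IsReducedWord w) (c : Letter) :
    (IsLeftDescent c w ∧ wordLength (lmul c w) + 1 = wordLength w) ∨
    (¬ IsLeftDescent c w ∧ wordLength (lmul c w) = wordLength w + 1) := by
  rcases w with _ | ⟨⟨i, k, l⟩, t⟩
  · right
    rcases unit_cases c.2 with h1 | h1 <;> simp [lmul, IsLeftDescent, h1]
  · by_cases hi : i = c.1
    · have hd : IsLeftDescent c ((i, k, l) :: t) ↔ k * c.2 < 0 := by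
        constructor
        · rintro ⟨k', l', t', h1, h2⟩
          simp only [List.cons.injEq, Prod.mk.injEq] at h1
          rw [h1.1.2.1]; exact h2
        · intro h1; exact ⟨k, l, t, by rw [hi], h1⟩
      rw [hd]
      rcases unit_cases c.2 with h1 | h1 <;> rw [h1]
      · by_cases hk : k + c.2 = 0 ∧ l = 0
        · simp [lmul, hi, hk]; omega
        · simp only [lmul, hi, hk, if_true, if_false, wordLength_cons]
          simp only [h1] at hk ⊢; omega
      · by_cases hk : k + c.2 = 0 ∧ l = 0
        · simp [lmul, hi, hk]; omega
        · simp only [lmul, hi, hk, if_true, if_false, wordLength_cons]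
          simp only [h1] at hk ⊢; omega
    · right
      constructor
      · rintro ⟨k', l', t', h1, h2⟩
        simp only [List.cons.injEq, Prod.mk.injEq] at h1
        exact hi h1.1.1
      · rcases unit_cases c.2 with h1 | h1 <;> simp [lmul, hi, h1] <;> ring

/-- Only the inverse of the first letter can shorten a word. This makes the graph of left
multiplications a forest. -/
theorem IsLeftDescent.unique {c c' : Letter} {w : List Syllable} (h : IsLeftDescent c w)
    (h' : IsLeftDescent c' w) : c = c' := by
  obtain ⟨k, l, t, rfl, h1⟩ := h
  obtain ⟨k', l', t', h2, h3⟩ := h'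
  simp only [List.cons.injEq, Prod.mk.injEq] at h2
  obtain ⟨⟨h2, rfl, -⟩, -⟩ := h2
  refine Prod.ext h2 ?_
  rcases Int.units_eq_one_or c.2 with h4 | h4 <;> rcases Int.units_eq_one_or c'.2 with h5 | h5 <;>
    simp [h4, h5] at * <;> omega

theorem vCount_lmul {w : List Syllable} (c : Letter) : vCount (lmul c w) = vCount w := by
  rcases w with _ | ⟨⟨i, k, l⟩, t⟩
  · simp [lmul]
  · rw [lmul_cons]; split_ifs with h1 h2 <;> simp [*]

theorem vLength_lmul {w : List Syllable} (c : Letter) : vLength (lmul c w) = vLength w := by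
  rcases w with _ | ⟨⟨i, k, l⟩, t⟩
  · simp [lmul]
  · rw [lmul_cons]; split_ifs with h1 h2 <;> simp [*]

theorem lmul_append {w : List Syllable} (hw : w ≠ []) (t : List Syllable) (c : Letter) :
    lmul c (w ++ t) = lmul c w ++ t := by
  rcases w with _ | ⟨⟨i, k, l⟩, w⟩
  · exact absurd rfl hw
  · simp only [List.cons_append, lmul]; split_ifs <;> rfl

theorem rmul_append {w : List Syllable} (hw : w ≠ []) (t : List Syllable) (c : Letter) :
    rmul c (t ++ w) = t ++ rmul c w := by
  simp [rmul, lmul_append (w := w.reverse) (by simpa using hw)]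

/-- The phase `φ` with `u_i^ε (v_i^l u_i^k ⋯) ` read from the right: `w u_c = φ • (w c)`, where
the argument is the reversed word. -/
def phaseHead (d : ℂ) (c : Letter) : List Syllable → ℂ
  | [] => 1
  | (i, _, l) :: _ => if i = c.1 then d ^ (-(l * c.2)) else 1

theorem norm_phaseHead {d : ℂ} (hd : ‖d‖ = 1) (c : Letter) (w : List Syllable) :
    ‖phaseHead d c w‖ = 1 := by
  rcases w with _ | ⟨⟨i, k, l⟩, t⟩
  · simp [phaseHead]
  · by_cases hi : i = c.1 <;> simp [phaseHead, hi, norm_zpow, hd]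

/-- The phase involves only the power of v in the first syllable, which letters u do not change; the
inverse letter has the opposite exponent. This symmetry makes multiplication by χ₁ self-adjoint. -/
theorem phaseHead_lmul {d : ℂ} (hd : ‖d‖ = 1) {w : List Syllable} (h : IsReducedWord w)
    (c : Letter) :
    phaseHead d (letterInv c) (lmul c w) = starRingEnd ℂ (phaseHead d c w) := by
  have hconj : ∀ n : ℤ, starRingEnd ℂ (d ^ n) = d ^ (-n) := by
    intro n
    rw [map_zpow₀, zpow_neg, ← inv_zpow, Complex.inv_def, Complex.normSq_eq_norm_sq, hd]
    simp
  rcases w with _ | ⟨⟨i, k, l⟩, t⟩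
  · simp [phaseHead, lmul]
  · obtain ⟨h1, h2, h3⟩ := isReducedWord_cons.1 h
    by_cases hi : i = c.1
    · by_cases hk : k + c.2 = 0 ∧ l = 0
      · rcases t with _ | ⟨⟨j, k', l'⟩, t⟩
        · simp [lmul, hi, hk, phaseHead]
        · have : j ≠ c.1 := by simpa [hi, eq_comm] using h1
          simp [lmul, hi, hk, this, phaseHead]
      · simp only [lmul, hi, hk, if_true, if_false, phaseHead, letterInv_fst, letterInv_snd,
          Units.val_neg, hconj]
        congr 1; ring
    · simp [lmul, hi, phaseHead]

theorem eq_singleton_or {w : List Syllable} (hw : w ≠ []) :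
    (∃ s, w = [s]) ∨ ∃ s m s', w = [s] ++ (m ++ [s']) := by
  rcases w with _ | ⟨s, t⟩
  · exact absurd rfl hw
  · rcases List.eq_nil_or_concat t with rfl | ⟨m, s', rfl⟩
    · exact Or.inl ⟨s, rfl⟩
    · exact Or.inr ⟨s, m, s', by simp⟩

/-- Associativity with phases ignored, so genericity plays no role. The delicate words are single
syllables, where both letters may act on the same exponent. -/
theorem lmul_rmul_comm {w : List Syllable} (h : IsReducedWord w) (c c' : Letter) :
    lmul c (rmul c' w) = rmul c' (lmul c w) := by
  by_cases hw : w = []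
  · subst hw
    by_cases hc : c.1 = c'.1
    · rcases unit_cases c.2 with h1 | h1 <;> rcases unit_cases c'.2 with h2 | h2 <;>
        simp [lmul, rmul, hc, h1, h2]
    · simp [lmul, rmul, hc, Ne.symm hc]
  rcases eq_singleton_or hw with ⟨⟨i, k, l⟩, rfl⟩ | ⟨s, m, s', rfl⟩
  · have h0 : ¬ (k = 0 ∧ l = 0) := by simpa using isReducedWord_singleton.1 h
    by_cases hi : i = c.1 <;> by_cases hi' : i = c'.1
    · have hcc : c'.1 = c.1 := by rw [← hi, ← hi']
      -- `syl` allows the trivial syllable, so cancellation needs no case of its own and both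
      -- letters simply add to k.
      rw [← syl_of_ne h0, hi]
      simp only [rmul, lmul_syl, reverse_syl]
      rw [← hcc, lmul_syl, lmul_syl, reverse_syl, hcc, lmul_syl, add_right_comm, reverse_syl]
    · have hcc : c.1 ≠ c'.1 := by rw [← hi]; exact hi'
      by_cases h1 : k + c.2 = 0 ∧ l = 0
      · simp [lmul, rmul, ← hi, h1, hi']
      · simp [lmul, rmul, ← hi, h1, hi']
    · have hcc : c'.1 ≠ c.1 := by rw [← hi']; exact hi
      by_cases h1 : k + c'.2 = 0 ∧ l = 0
      · simp [lmul, rmul, ← hi', h1, hi]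
      · simp [lmul, rmul, ← hi', h1, hi]
    · simp [lmul, rmul, hi, hi']
  · have e1 : rmul c' ([s] ++ (m ++ [s'])) = [s] ++ (m ++ rmul c' [s']) := by
      rw [rmul_append (by simp), rmul_append (by simp)]
    have e2 : lmul c ([s] ++ (m ++ [s'])) = (lmul c [s] ++ m) ++ [s'] := by
      rw [lmul_append (by simp), List.append_assoc]
    rw [e1, e2, lmul_append (by simp), rmul_append (by simp), List.append_assoc]

/-- A word is generic if it is not trivial and not of the form `u_i ^ k * v_i ^ l` with
`|k| ≤ 1`. Left and right multiplication by letters do not interfere on generic words. -/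
def IsGeneric (w : List Syllable) : Prop :=
  w ≠ [] ∧ ∀ i k l, w = [(i, k, l)] → 2 ≤ k.natAbs

theorem IsGeneric.reverse {w : List Syllable} (h : IsGeneric w) : IsGeneric w.reverse :=
  ⟨by simpa using h.1, fun i k l hw => h.2 i k l (by simpa using congrArg List.reverse hw)⟩

/-- With two or more syllables the two letters act at different places. In a single syllable both
may act on k; as |k| ≥ 2, two unit steps do not carry k past 0, and |k| changes additively. -/
theorem wordLength_rmul_lmul {w : List Syllable} (hg : IsGeneric w)
    (c c' : Letter) :
    wordLength (rmul c' (lmul c w)) + wordLength w =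
      wordLength (lmul c w) + wordLength (rmul c' w) := by
  rcases eq_singleton_or hg.1 with ⟨⟨i, k, l⟩, rfl⟩ | ⟨s, m, s', rfl⟩
  · have hk := hg.2 i k l rfl
    have h0 : ¬ (k = 0 ∧ l = 0) := by omega
    have h1 : ¬ (k + c.2 = 0 ∧ l = 0) := by rcases unit_cases c.2 with h | h <;> omega
    have h2 : ¬ (k + c'.2 = 0 ∧ l = 0) := by rcases unit_cases c'.2 with h | h <;> omega
    by_cases hi : i = c.1 <;> by_cases hi' : i = c'.1
    · have hcc : c'.1 = c.1 := by rw [← hi, ← hi']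
      rw [← syl_of_ne h0, hi]
      simp only [rmul, lmul_syl, reverse_syl]
      rw [← hcc, lmul_syl, lmul_syl, reverse_syl, reverse_syl]
      simp only [wordLength_syl]
      rcases unit_cases c.2 with h | h <;> rcases unit_cases c'.2 with h' | h' <;>
          rw [h, h'] <;> omega
    · simp [lmul, rmul, ← hi, hi', h1]; omega
    · simp [lmul, rmul, hi, ← hi', h2]; omega
    · simp [lmul, rmul, hi, hi']; omega
  · have e1 : rmul c' ([s] ++ (m ++ [s'])) = [s] ++ (m ++ rmul c' [s']) := by
      rw [rmul_append (by simp), rmul_append (by simp)]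
    have e2 : lmul c ([s] ++ (m ++ [s'])) = (lmul c [s] ++ m) ++ [s'] := by
      rw [lmul_append (by simp), List.append_assoc]
    rw [e1, e2, rmul_append (by simp)]
    simp only [wordLength_append]; omega

theorem IsGeneric.lmul {w : List Syllable} (hg : IsGeneric w) (c : Letter)
    (hc : wordLength w < wordLength (lmul c w)) : IsGeneric (lmul c w) := by
  obtain ⟨h0, h1⟩ := hg
  rcases w with _ | ⟨⟨i, k, l⟩, t⟩
  · exact absurd rfl h0
  · rw [lmul_cons] at hc ⊢
    split_ifs at hc ⊢ with hi hk
    · exact absurd hc (by simp)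
    · refine ⟨by simp, fun i' k' l' h => ?_⟩
      simp only [List.cons.injEq, Prod.mk.injEq] at h
      obtain ⟨⟨rfl, rfl, rfl⟩, rfl⟩ := h
      have := h1 i k l rfl
      simp at hc; omega
    · exact ⟨by simp, fun i' k' l' h => by simp at h⟩

theorem phaseHead_rmul {d : ℂ} {w : List Syllable} (h : IsReducedWord w) (c c' : Letter) :
    phaseHead d c' (rmul c w) = phaseHead d c' w := by
  by_cases hw : w = []
  · subst hw; simp [rmul, lmul, phaseHead]
  rcases eq_singleton_or hw with ⟨⟨i, k, l⟩, rfl⟩ | ⟨s, m, s', rfl⟩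
  · by_cases hi : i = c.1
    · by_cases hk : k + c.2 = 0 ∧ l = 0
      · simp [rmul, lmul, phaseHead, hi, hk]
      · simp [rmul, lmul, phaseHead, hi, hk]
    · simp [rmul, lmul, phaseHead, hi]
  · rw [rmul_append (by simp)]; rfl

/-! ### Abstract letter actions -/

/-- The type of completely reduced words. -/
abbrev RWord : Type := {w : List Syllable // IsReducedWord w}

theorem RWord.ext {w w' : RWord} (h : w.1 = w'.1) : w = w' := Subtype.ext h

/-- The length of a reduced word. -/
def RWord.len (w : RWord) : ℕ := wordLength w.1

/-- A one-sided action of the letters on a set with a length function, with unimodular weights. -/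
structure LetterAction {X : Type*} (len : X → ℕ) where
  act : Letter → X → X
  wt : Letter → X → ℂ
  act_inv : ∀ c x, act (letterInv c) (act c x) = x
  norm_wt : ∀ c x, ‖wt c x‖ = 1
  wt_inv : ∀ c x, wt (letterInv c) (act c x) = starRingEnd ℂ (wt c x)
  len_act : ∀ c x, len (act c x) + 1 = len x ∨ len (act c x) = len x + 1
  descent_unique : ∀ c c' x, len (act c x) < len x → len (act c' x) < len x → c = c'

/-- Two commuting actions which do not interfere on a set of generic elements. -/
structure LetterAction.Compatible {X : Type*} {len : X → ℕ} (α β : LetterAction len)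
    (G : Set X) : Prop where
  comm : ∀ c c' x, α.act c (β.act c' x) = β.act c' (α.act c x)
  wt_left : ∀ c c' x, α.wt c (β.act c' x) = α.wt c x
  wt_right : ∀ c c' x, β.wt c (α.act c' x) = β.wt c x
  -- This fails off G: u_i v_i^l is shortened by u_i^{-1} from either side, but applying it on both
  -- sides restores the original length.
  len_add : ∀ c c' x, x ∈ G → len (β.act c' (α.act c x)) + len x = len (α.act c x) + len (β.act c' x)
  up_left : ∀ c x, x ∈ G → len x < len (α.act c x) → α.act c x ∈ G
  up_right : ∀ c x, x ∈ G → len x < len (β.act c x) → β.act c x ∈ G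

theorem LetterAction.Compatible.symm {X : Type*} {len : X → ℕ} {α β : LetterAction len}
    {G : Set X} (h : α.Compatible β G) : β.Compatible α G where
  comm c c' x := (h.comm c' c x).symm
  wt_left := h.wt_right
  wt_right := h.wt_left
  len_add c c' x hx := by rw [h.comm, h.len_add _ _ x hx, add_comm]
  up_left := h.up_right
  up_right := h.up_left

/-- Left multiplication by letters. -/
def leftAction : LetterAction RWord.len where
  act c w := ⟨lmul c w.1, w.2.lmul c⟩
  wt _ _ := 1
  act_inv c w := RWord.ext (lmul_inv w.2 c)
  norm_wt _ _ := by simp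
  wt_inv _ _ := by simp
  len_act c w := (wordLength_lmul w.2 c).imp And.right And.right
  descent_unique c c' w h h' := by
    simp only [RWord.len] at h h'
    rcases wordLength_lmul w.2 c with h1 | h1
    · rcases wordLength_lmul w.2 c' with h2 | h2
      · exact h1.1.unique h2.1
      · omega
    · omega

/-- Right multiplication by letters. -/
def rightAction (d : ℂ) (hd : ‖d‖ = 1) : LetterAction RWord.len where
  act c w := ⟨rmul c w.1, (w.2.reverse.lmul c).reverse⟩
  wt c w := phaseHead d c w.1.reverse
  act_inv c w := RWord.ext (by simp [rmul, lmul_inv w.2.reverse c])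
  norm_wt c w := norm_phaseHead hd c _
  wt_inv c w := by simp [rmul, phaseHead_lmul hd w.2.reverse c]
  len_act c w := by
    simpa [RWord.len, rmul] using (wordLength_lmul w.2.reverse c).imp And.right And.right
  descent_unique c c' w h h' := by
    simp only [RWord.len, rmul, wordLength_reverse] at h h'
    rw [← wordLength_reverse w.1] at h h'
    rcases wordLength_lmul w.2.reverse c with h1 | h1
    · rcases wordLength_lmul w.2.reverse c' with h2 | h2
      · exact h1.1.unique h2.1
      · omega
    · omega

theorem compatible (d : ℂ) (hd : ‖d‖ = 1) :
    leftAction.Compatible (rightAction d hd) {w : RWord | IsGeneric w.1} where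
  comm c c' w := RWord.ext (lmul_rmul_comm w.2 c c')
  wt_left _ _ _ := rfl
  wt_right c c' w := by
    have := phaseHead_rmul (d := d) w.2.reverse c' c
    simpa [rightAction, leftAction, rmul] using this
  len_add c c' w hw := wordLength_rmul_lmul hw c c'
  up_left c w hw h := hw.lmul c h
  up_right c w hw h := by
    have h' : IsGeneric (lmul c w.1.reverse) :=
      hw.reverse.lmul c (by simpa [RWord.len, rightAction, rmul] using h)
    exact h'.reverse

/-! ### Lengthening and shortening operators -/

section Operators

variable {X E : Type*} [NormedAddCommGroup E] [InnerProductSpace ℂ E] {len : X → ℕ}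

theorem inner_eq_of_basis (b : Module.Basis X ℂ E) (T R : E →ₗ[ℂ] E)
    (h : ∀ i j, ⟪T (b i), b j⟫_ℂ = ⟪b i, R (b j)⟫_ℂ) (x y : E) : ⟪T x, y⟫_ℂ = ⟪x, R y⟫_ℂ := by
  have hx : x ∈ Submodule.span ℂ (Set.range b) := b.mem_span x
  have hy : y ∈ Submodule.span ℂ (Set.range b) := b.mem_span y
  induction hx using Submodule.span_induction with
  | mem x hx =>
    obtain ⟨i, rfl⟩ := hx
    induction hy using Submodule.span_induction with
    | mem y hy => obtain ⟨j, rfl⟩ := hy; exact h i j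
    | zero => simp
    | add y z _ _ hy hz => rw [map_add, inner_add_right, inner_add_right, hy, hz]
    | smul a y _ hy => rw [map_smul, inner_smul_right, inner_smul_right, hy]
  | zero => simp
  | add y z _ _ hy hz => rw [map_add, inner_add_left, inner_add_left, hy, hz]
  | smul a y _ hy => rw [map_smul, inner_smul_left, inner_smul_left, hy]

namespace LetterAction

variable (α β : LetterAction len) (b : Module.Basis X ℂ E)

/-- The length-increasing part of the sum of the letters. -/
def up : Module.End ℂ E := b.constr ℂ fun x =>
  ∑ c, if len x < len (α.act c x) then α.wt c x • b (α.act c x) else 0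

/-- The length-decreasing part of the sum of the letters. -/
def dn : Module.End ℂ E := b.constr ℂ fun x =>
  ∑ c, if len (α.act c x) < len x then α.wt c x • b (α.act c x) else 0

open Classical in
/-- The projection onto the words which no letter shortens. -/
def root : Module.End ℂ E := b.constr ℂ fun x =>
  if ∃ c, len (α.act c x) < len x then 0 else b x

theorem up_basis (x : X) : α.up b (b x) =
    ∑ c, if len x < len (α.act c x) then α.wt c x • b (α.act c x) else 0 := by
  simp [up]

theorem dn_basis (x : X) : α.dn b (b x) =
    ∑ c, if len (α.act c x) < len x then α.wt c x • b (α.act c x) else 0 := by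
  simp [dn]

open Classical in
theorem root_basis (x : X) : α.root b (b x) =
    if ∃ c, len (α.act c x) < len x then 0 else b x := by
  simp [root]

theorem act_eq_iff {c : Letter} {x y : X} : α.act c x = y ↔ x = α.act (letterInv c) y := by
  constructor
  · rintro rfl; rw [α.act_inv]
  · rintro rfl
    simpa using α.act_inv (letterInv c) y

/-- `letterInv` as a permutation. -/
def letterInvEquiv : Letter ≃ Letter :=
  ⟨letterInv, letterInv, letterInv_letterInv, letterInv_letterInv⟩

theorem not_lt_iff {c : Letter} {x : X} : ¬ len (α.act c x) < len x ↔ len x < len (α.act c x) := by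
  rcases α.len_act c x with h | h <;> omega

theorem len_lt_iff {c : Letter} {x : X} :
    len x < len (α.act c x) ↔ len (α.act c x) = len x + 1 := by
  rcases α.len_act c x with h | h <;> omega

theorem lt_len_iff {c : Letter} {x : X} :
    len (α.act c x) < len x ↔ len (α.act c x) + 1 = len x := by
  rcases α.len_act c x with h | h <;> omega

theorem dn_basis_of_descent {c : Letter} {x : X} (h : len (α.act c x) < len x) :
    α.dn b (b x) = α.wt c x • b (α.act c x) := by
  rw [dn_basis, Finset.sum_eq_single c]
  · rw [if_pos h]
  · intro c' _ hc'
    rw [if_neg fun h' => hc' (α.descent_unique _ _ _ h' h)]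
  · simp

theorem dn_basis_of_root {x : X} (h : ¬ ∃ c, len (α.act c x) < len x) : α.dn b (b x) = 0 := by
  rw [dn_basis]
  exact Finset.sum_eq_zero fun c _ => if_neg fun h' => h ⟨c, h'⟩

/-- A longer neighbour of x is shortened only by the inverse of the letter that produced it, so each
lengthening leads straight back to x with weight 1. There are four of them if no letter shortens x,
and three otherwise. -/
theorem dn_up (x : E) : α.dn b (α.up b x) = (3 : ℂ) • x + α.root b x := by
  classical
  have : α.dn b ∘ₗ α.up b = (3 : ℂ) • LinearMap.id + α.root b := by
    refine b.ext fun x => ?_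
    simp only [LinearMap.comp_apply, LinearMap.add_apply, LinearMap.smul_apply, LinearMap.id_apply]
    rw [up_basis, map_sum]
    have h1 : ∀ c, α.dn b (if len x < len (α.act c x) then α.wt c x • b (α.act c x) else 0) =
        if len (α.act c x) < len x then 0 else b x := by
      intro c
      by_cases h : len (α.act c x) < len x
      · have := α.not_lt_iff.not.1 (not_not.2 h)
        rw [if_neg this, if_pos h, map_zero]
      · have h' := α.not_lt_iff.1 h
        rw [if_pos h', if_neg h, map_smul,
          α.dn_basis_of_descent b (c := letterInv c) (by rwa [α.act_inv]), α.wt_inv, α.act_inv,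
          smul_smul, Complex.mul_conj, Complex.normSq_eq_norm_sq, α.norm_wt]
        simp
    rw [Finset.sum_congr rfl fun c _ => h1 c, root_basis]
    have hcard : (Finset.univ : Finset Letter).card = 4 := by decide
    split_ifs with h
    · obtain ⟨c, hc⟩ := h
      have : ∀ c', (if len (α.act c' x) < len x then 0 else b x) =
          b x - if c' = c then b x else 0 := by
        intro c'
        by_cases h : c' = c
        · subst h; simp [hc]
        · rw [if_neg fun h' => h (α.descent_unique _ _ _ h' hc), if_neg h, sub_zero]
      rw [Finset.sum_congr rfl fun c _ => this c]
      rw [Finset.sum_sub_distrib, Finset.sum_const, hcard, Finset.sum_ite_eq' Finset.univ c]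
      simp only [Finset.mem_univ, if_true, add_zero]
      module
    · push Not at h
      rw [Finset.sum_congr rfl fun c _ => if_neg (h c).not_gt, Finset.sum_const, hcard]
      module
  exact LinearMap.congr_fun this x

theorem root_up (x : E) : α.root b (α.up b x) = 0 := by
  classical
  have : α.root b ∘ₗ α.up b = 0 := by
    refine b.ext fun x => ?_
    rw [LinearMap.comp_apply, up_basis, map_sum]
    refine Finset.sum_eq_zero fun c _ => ?_
    split_ifs with h
    · rw [map_smul, root_basis, if_pos ⟨letterInv c, by rwa [α.act_inv]⟩, smul_zero]
    · simp
  exact LinearMap.congr_fun this x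

theorem dn_root (x : E) : α.dn b (α.root b x) = 0 := by
  classical
  have : α.dn b ∘ₗ α.root b = 0 := by
    refine b.ext fun x => ?_
    rw [LinearMap.comp_apply, root_basis]
    split_ifs with h
    · simp
    · exact α.dn_basis_of_root b h
  exact LinearMap.congr_fun this x

theorem root_root (x : E) : α.root b (α.root b x) = α.root b x := by
  classical
  have : α.root b ∘ₗ α.root b = α.root b := by
    refine b.ext fun x => ?_
    rw [LinearMap.comp_apply, root_basis]
    split_ifs with h
    · simp
    · rw [root_basis, if_neg h]
  exact LinearMap.congr_fun this x

theorem pow_succ_up (r : ℕ) (x : E) : (α.up b ^ (r + 1)) x = α.up b ((α.up b ^ r) x) := by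
  rw [pow_succ', Module.End.mul_apply]

theorem dn_up_succ_pow (r : ℕ) (x : E) :
    α.dn b ((α.up b ^ (r + 2)) x) = (3 : ℂ) • (α.up b ^ (r + 1)) x := by
  rw [pow_succ_up, dn_up, pow_succ_up, root_up, add_zero]

section Inner

variable {b} (hb : Orthonormal ℂ b)
include hb

/-- Inverse letters traverse the same edges backwards, with conjugate weights. -/
theorem inner_up_left (x y : E) : ⟪α.up b x, y⟫_ℂ = ⟪x, α.dn b y⟫_ℂ := by
  classical
  refine inner_eq_of_basis b _ _ (fun x y => ?_) x y
  rw [up_basis, dn_basis, sum_inner, inner_sum, ← Equiv.sum_comp letterInvEquiv]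
  refine Finset.sum_congr rfl fun c _ => ?_
  change ⟪(if len x < len (α.act (letterInv c) x) then
    α.wt (letterInv c) x • b (α.act (letterInv c) x) else 0), b y⟫_ℂ = _
  by_cases h : α.act (letterInv c) x = y
  · have h2 : x = α.act c y := by rw [α.act_eq_iff] at h; simpa using h
    subst h2
    have e : α.act (letterInv c) (α.act c y) = y := α.act_inv c y
    have hw := α.wt_inv c y
    rw [e]
    split_ifs with h1
    · rw [inner_smul_left, inner_smul_right, hw, RCLike.conj_conj]
      simp [hb.1]
    · simp
  · have h2 : x ≠ α.act c y := fun h2 => h (by rw [h2, α.act_inv])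
    split_ifs with h1 h3 h3 <;> simp [inner_smul_right, hb.2 h, hb.2 h2]

theorem inner_up_right (x y : E) : ⟪x, α.up b y⟫_ℂ = ⟪α.dn b x, y⟫_ℂ := by
  rw [← inner_conj_symm, inner_up_left α hb, inner_conj_symm]

theorem inner_root (x y : E) : ⟪α.root b x, y⟫_ℂ = ⟪x, α.root b y⟫_ℂ := by
  classical
  refine inner_eq_of_basis b _ _ (fun x y => ?_) x y
  rw [root_basis, root_basis]
  by_cases h : x = y
  · subst h; split_ifs <;> simp
  · split_ifs <;> simp [hb.2 h]

theorem norm_root_le (x : E) : ‖α.root b x‖ ≤ ‖x‖ := by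
  have h : ⟪α.root b x, α.root b x⟫_ℂ = ⟪α.root b x, x⟫_ℂ := by
    rw [inner_root α hb, root_root, ← inner_root α hb]
  have h1 : ‖α.root b x‖ ^ 2 ≤ ‖α.root b x‖ * ‖x‖ := by
    have := norm_inner_le_norm (𝕜 := ℂ) (α.root b x) x
    rw [← h, inner_self_eq_norm_sq_to_K] at this
    simpa using this
  nlinarith [norm_nonneg (α.root b x), norm_nonneg x]

theorem norm_up_sq (x : E) : ‖α.up b x‖ ^ 2 = 3 * ‖x‖ ^ 2 + ‖α.root b x‖ ^ 2 := by
  have h : ⟪α.up b x, α.up b x⟫_ℂ = 3 * ⟪x, x⟫_ℂ + ⟪α.root b x, α.root b x⟫_ℂ := by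
    rw [inner_up_left α hb, dn_up, inner_add_right, inner_smul_right, inner_root α hb, root_root]
  simp only [inner_self_eq_norm_sq_to_K] at h
  refine RCLike.ofReal_injective (K := ℂ) ?_
  simp only [RCLike.ofReal_add, RCLike.ofReal_mul, RCLike.ofReal_pow]
  simpa using h

/-- After the first step no roots are left (`root_up`), so every further step multiplies the squared
norm by exactly 3. -/
theorem norm_up_succ_pow_sq (r : ℕ) (x : E) :
    ‖(α.up b ^ (r + 1)) x‖ ^ 2 = 3 ^ r * ‖α.up b x‖ ^ 2 := by
  induction r with
  | zero => simp
  | succ r ih =>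
    rw [pow_succ_up, norm_up_sq α hb, pow_succ_up, root_up, ← pow_succ_up, ih]
    simp; ring

theorem le_norm_up_pow_sq (r : ℕ) (x : E) : 3 ^ r * ‖x‖ ^ 2 ≤ ‖(α.up b ^ r) x‖ ^ 2 := by
  rcases r with _ | r
  · simp
  · rw [norm_up_succ_pow_sq α hb, norm_up_sq α hb, pow_succ]
    have : (0 : ℝ) ≤ 3 ^ r * ‖α.root b x‖ ^ 2 := by positivity
    linarith

/-- Only the first step can exceed the factor 3, and it is at most 4; this is the origin of 4 / 3.
-/
theorem norm_up_pow_sq_le (r : ℕ) (x : E) :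
    ‖(α.up b ^ r) x‖ ^ 2 ≤ 4 / 3 * 3 ^ r * ‖x‖ ^ 2 := by
  rcases r with _ | r
  · simp; nlinarith [sq_nonneg ‖x‖]
  · rw [norm_up_succ_pow_sq α hb, norm_up_sq α hb, pow_succ]
    have h1 : ‖α.root b x‖ ^ 2 ≤ ‖x‖ ^ 2 := by
      gcongr; exact norm_root_le α hb x
    have h2 : (3 : ℝ) ^ r * ‖α.root b x‖ ^ 2 ≤ 3 ^ r * ‖x‖ ^ 2 := by gcongr
    linear_combination h2

/-- The right vector always keeps one more `up` than is removed, so by `dn_up_succ_pow` each removal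
costs exactly the factor 3, with no `root` term. -/
theorem inner_up_pow_up_pow (r t : ℕ) (x y : E) :
    ⟪(α.up b ^ r) x, (α.up b ^ (r + t + 1)) y⟫_ℂ = 3 ^ r * ⟪x, (α.up b ^ (t + 1)) y⟫_ℂ := by
  induction r with
  | zero => simp
  | succ r ih =>
    rw [pow_succ_up, inner_up_left α hb,
      show r + 1 + t + 1 = (r + t) + 2 by ring, dn_up_succ_pow, inner_smul_right, ih]
    ring

end Inner

/-- The span of the generic words. -/
def genericSpan (_ : LetterAction len) (b : Module.Basis X ℂ E) (G : Set X) : Submodule ℂ E :=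
  Submodule.span ℂ (b '' G)

variable {α β} {G : Set X}

section

variable (h : α.Compatible β G)
include h

/-- Both composites are the part of the product of the two letter sums that raises the length by 2.
Hence genericity is not needed. -/
theorem Compatible.up_up (x : E) : α.up b (β.up b x) = β.up b (α.up b x) := by
  classical
  have : α.up b ∘ₗ β.up b = β.up b ∘ₗ α.up b := by
    refine b.ext fun x => ?_
    have e1 : ∀ c, (if len x < len (β.act c x) then β.wt c x • α.up b (b (β.act c x)) else 0) =
        ∑ c', if len (α.act c' (β.act c x)) = len x + 2 then
          (β.wt c x * α.wt c' x) • b (α.act c' (β.act c x)) else 0 := by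
      intro c
      split_ifs with h1
      · rw [up_basis, Finset.smul_sum]
        refine Finset.sum_congr rfl fun c' _ => ?_
        rw [β.len_lt_iff] at h1
        simp only [h.wt_left, h1, smul_ite, smul_zero, smul_smul]
        have := α.len_act c' (β.act c x)
        congr 1
        rw [eq_iff_iff]; omega
      · symm
        refine Finset.sum_eq_zero fun c' _ => if_neg fun h2 => ?_
        have := α.len_act c' (β.act c x)
        omega
    have e2 : ∀ c, (if len x < len (α.act c x) then α.wt c x • β.up b (b (α.act c x)) else 0) =
        ∑ c', if len (β.act c' (α.act c x)) = len x + 2 then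
          (α.wt c x * β.wt c' x) • b (β.act c' (α.act c x)) else 0 := by
      intro c
      split_ifs with h1
      · rw [up_basis, Finset.smul_sum]
        refine Finset.sum_congr rfl fun c' _ => ?_
        rw [α.len_lt_iff] at h1
        simp only [h.wt_right, h1, smul_ite, smul_zero, smul_smul]
        have := β.len_act c' (α.act c x)
        congr 1
        rw [eq_iff_iff]; omega
      · symm
        refine Finset.sum_eq_zero fun c' _ => if_neg fun h2 => ?_
        have := β.len_act c' (α.act c x)
        omega
    rw [LinearMap.comp_apply, LinearMap.comp_apply, up_basis, up_basis, map_sum, map_sum]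
    simp only [apply_ite (α.up b), apply_ite (β.up b), map_smul, map_zero]
    rw [Finset.sum_congr rfl fun c _ => e1 c, Finset.sum_congr rfl fun c _ => e2 c,
      Finset.sum_comm]
    refine Finset.sum_congr rfl fun c _ => Finset.sum_congr rfl fun c' _ => ?_
    rw [h.comm, mul_comm]
  exact LinearMap.congr_fun this x

theorem Compatible.up_pow_up (s : ℕ) (x : E) :
    α.up b ((β.up b ^ s) x) = (β.up b ^ s) (α.up b x) := by
  induction s generalizing x with
  | zero => rfl
  | succ s ih => rw [pow_succ_up, h.up_up, ih, pow_succ_up]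

theorem Compatible.up_pow_up_pow (r s : ℕ) (x : E) :
    (α.up b ^ r) ((β.up b ^ s) x) = (β.up b ^ s) ((α.up b ^ r) x) := by
  induction r with
  | zero => rfl
  | succ r ih => rw [pow_succ_up, ih, h.up_pow_up, pow_succ_up]

variable {b}

omit h in
theorem eqOn_genericSpan (T R : E →ₗ[ℂ] E) (hT : ∀ x ∈ G, T (b x) = R (b x)) {x : E}
    (hx : x ∈ α.genericSpan b G) : T x = R x := by
  refine LinearMap.eqOn_span ?_ hx
  rintro _ ⟨y, hy, rfl⟩
  exact hT y hy

theorem Compatible.up_mem {x : E} (hx : x ∈ α.genericSpan b G) :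
    β.up b x ∈ α.genericSpan b G := by
  have : α.genericSpan b G ≤ (α.genericSpan b G).comap (β.up b) := by
    refine Submodule.span_le.2 ?_
    rintro _ ⟨y, hy, rfl⟩
    change β.up b (b y) ∈ α.genericSpan b G
    rw [up_basis]
    refine Submodule.sum_mem _ fun c _ => ?_
    split_ifs with h1
    · exact Submodule.smul_mem _ _ (Submodule.subset_span ⟨_, h.up_right c y hy h1, rfl⟩)
    · exact zero_mem _
  exact this hx

theorem Compatible.up_pow_mem {x : E} (hx : x ∈ α.genericSpan b G) (s : ℕ) :
    (β.up b ^ s) x ∈ α.genericSpan b G := by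
  induction s with
  | zero => exact hx
  | succ s ih => rw [pow_succ_up]; exact h.up_mem ih

omit h in
theorem root_mem {x : E} (hx : x ∈ α.genericSpan b G) :
    α.root b x ∈ α.genericSpan b G := by
  classical
  have : α.genericSpan b G ≤ (α.genericSpan b G).comap (α.root b) := by
    refine Submodule.span_le.2 ?_
    rintro _ ⟨y, hy, rfl⟩
    change α.root b (b y) ∈ α.genericSpan b G
    rw [root_basis]
    split_ifs with h1
    · exact zero_mem _
    · exact (Submodule.subset_span ⟨_, hy, rfl⟩)
  exact this hx

/-- For generic x the changes of length caused by the two letters are independent, so both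
composites select the same pairs: one letter shortening, the other lengthening. -/
theorem Compatible.dn_up_of_mem {x : E} (hx : x ∈ α.genericSpan b G) :
    α.dn b (β.up b x) = β.up b (α.dn b x) := by
  classical
  refine eqOn_genericSpan (α.dn b ∘ₗ β.up b) (β.up b ∘ₗ α.dn b) (fun x hx => ?_) hx
  have e1 : ∀ c, (if len x < len (β.act c x) then β.wt c x • α.dn b (b (β.act c x)) else 0) =
      ∑ c', if len x < len (β.act c x) ∧ len (α.act c' (β.act c x)) = len x then
        (β.wt c x * α.wt c' x) • b (α.act c' (β.act c x)) else 0 := by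
    intro c
    by_cases h1 : len x < len (β.act c x)
    · simp only [h1, true_and, if_true]
      rw [dn_basis, Finset.smul_sum]
      refine Finset.sum_congr rfl fun c' _ => ?_
      rw [β.len_lt_iff] at h1
      simp only [h.wt_left, h1, smul_ite, smul_zero, smul_smul]
      have := α.len_act c' (β.act c x)
      congr 1
      rw [eq_iff_iff]; omega
    · simp [h1]
  have e2 : ∀ c, (if len (α.act c x) < len x then α.wt c x • β.up b (b (α.act c x)) else 0) =
      ∑ c', if len (α.act c x) < len x ∧ len (β.act c' (α.act c x)) = len x then
        (α.wt c x * β.wt c' x) • b (β.act c' (α.act c x)) else 0 := by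
    intro c
    by_cases h1 : len (α.act c x) < len x
    · simp only [h1, true_and, if_true]
      rw [up_basis, Finset.smul_sum]
      refine Finset.sum_congr rfl fun c' _ => ?_
      rw [α.lt_len_iff] at h1
      simp only [h.wt_right, β.len_lt_iff, h1, smul_ite, smul_zero, smul_smul]
    · simp [h1]
  rw [LinearMap.comp_apply, LinearMap.comp_apply, up_basis, dn_basis, map_sum, map_sum]
  simp only [apply_ite (α.dn b), apply_ite (β.up b), map_smul, map_zero]
  rw [Finset.sum_congr rfl fun c _ => e1 c, Finset.sum_congr rfl fun c _ => e2 c,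
    Finset.sum_comm]
  refine Finset.sum_congr rfl fun c _ => Finset.sum_congr rfl fun c' _ => ?_
  have := h.len_add c c' x hx
  rw [h.comm, mul_comm]
  congr 1
  rw [eq_iff_iff]
  rcases α.len_act c x with h1 | h1 <;> rcases β.len_act c' x with h2 | h2 <;> omega

omit h in
theorem Compatible.descent_iff (h : α.Compatible β G) {x : X} (hx : x ∈ G) (c' : Letter) :
    (∃ c, len (α.act c (β.act c' x)) < len (β.act c' x)) ↔ ∃ c, len (α.act c x) < len x := by
  refine exists_congr fun c => ?_
  have := h.len_add c c' x hx
  rw [h.comm]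
  omega

theorem Compatible.root_up_of_mem {x : E} (hx : x ∈ α.genericSpan b G) :
    α.root b (β.up b x) = β.up b (α.root b x) := by
  classical
  refine eqOn_genericSpan (α.root b ∘ₗ β.up b) (β.up b ∘ₗ α.root b) (fun x hx => ?_) hx
  rw [LinearMap.comp_apply, LinearMap.comp_apply, root_basis, up_basis, map_sum]
  simp only [apply_ite (α.root b), apply_ite (β.up b), map_smul, map_zero, root_basis]
  simp only [h.descent_iff hx]
  split_ifs with h1
  · simp
  · rw [up_basis]

theorem Compatible.root_dn_of_mem {x : E} (hx : x ∈ α.genericSpan b G) :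
    α.root b (β.dn b x) = β.dn b (α.root b x) := by
  classical
  refine eqOn_genericSpan (α.root b ∘ₗ β.dn b) (β.dn b ∘ₗ α.root b) (fun x hx => ?_) hx
  rw [LinearMap.comp_apply, LinearMap.comp_apply, root_basis, dn_basis, map_sum]
  simp only [apply_ite (α.root b), apply_ite (β.dn b), map_smul, map_zero, root_basis]
  simp only [h.descent_iff hx]
  split_ifs with h1
  · simp
  · rw [dn_basis]

theorem Compatible.dn_up_pow_of_mem {x : E} (hx : x ∈ α.genericSpan b G) (s : ℕ) :
    α.dn b ((β.up b ^ s) x) = (β.up b ^ s) (α.dn b x) := by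
  induction s with
  | zero => rfl
  | succ s ih => rw [pow_succ_up, h.dn_up_of_mem (h.up_pow_mem hx s), ih, pow_succ_up]

theorem Compatible.root_up_pow_of_mem {x : E} (hx : x ∈ α.genericSpan b G) (s : ℕ) :
    α.root b ((β.up b ^ s) x) = (β.up b ^ s) (α.root b x) := by
  induction s with
  | zero => rfl
  | succ s ih => rw [pow_succ_up, h.root_up_of_mem (h.up_pow_mem hx s), ih, pow_succ_up]

end

variable (α β G)

/-- The combinations of generic words annihilated by both shortening operators. -/
def primitive : Submodule ℂ E :=
  α.genericSpan b G ⊓ (LinearMap.ker (α.dn b) ⊓ LinearMap.ker (β.dn b))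

variable {α β b G}

theorem mem_primitive {x : E} : x ∈ primitive α β b G ↔
    x ∈ α.genericSpan b G ∧ α.dn b x = 0 ∧ β.dn b x = 0 := Iff.rfl

theorem mem_primitive_symm {x : E} (hx : x ∈ primitive α β b G) : x ∈ primitive β α b G :=
  ⟨hx.1, hx.2.2, hx.2.1⟩

theorem Compatible.root_mem_primitive (h : α.Compatible β G) {x : E}
    (hx : x ∈ primitive α β b G) : α.root b x ∈ primitive α β b G := by
  refine ⟨root_mem hx.1, α.dn_root b x, ?_⟩
  change β.dn b (α.root b x) = 0
  rw [← h.root_dn_of_mem hx.1, (mem_primitive.1 hx).2.2, map_zero]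

/-- After cancelling `up ^ r` one left `up` remains on the right vector. Its adjoint passes through
the right lengthenings and kills x; y may be arbitrary. -/
theorem Compatible.inner_shift_left (h : α.Compatible β G) (hb : Orthonormal ℂ b) {x : E}
    (hx : x ∈ primitive α β b G) (r s t : ℕ) (y : E) :
    ⟪(α.up b ^ r) ((β.up b ^ s) x), (α.up b ^ (r + t + 1)) y⟫_ℂ = 0 := by
  rw [inner_up_pow_up_pow α hb, pow_succ_up, inner_up_right α hb, h.dn_up_pow_of_mem hx.1,
    (mem_primitive.1 hx).2.1]
  simp

/-- Different shifts of primitive vectors are orthogonal. -/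
theorem Compatible.inner_shift (h : α.Compatible β G) (hb : Orthonormal ℂ b) {x y : E}
    (hx : x ∈ primitive α β b G) (hy : y ∈ primitive α β b G) {r s r' s' : ℕ}
    (hrs : (r, s) ≠ (r', s')) :
    ⟪(α.up b ^ r) ((β.up b ^ s) x), (α.up b ^ r') ((β.up b ^ s') y)⟫_ℂ = 0 := by
  rcases lt_trichotomy r r' with h1 | rfl | h1
  · obtain ⟨t, rfl⟩ := Nat.exists_eq_add_of_lt h1
    exact h.inner_shift_left hb hx r s t _
  · rw [h.up_pow_up_pow b r s, h.up_pow_up_pow b r s']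
    rcases lt_trichotomy s s' with h2 | rfl | h2
    · obtain ⟨t, rfl⟩ := Nat.exists_eq_add_of_lt h2
      exact h.symm.inner_shift_left hb (mem_primitive_symm hx) s r t _
    · exact absurd rfl hrs
    · obtain ⟨t, rfl⟩ := Nat.exists_eq_add_of_lt h2
      rw [← inner_conj_symm, h.symm.inner_shift_left hb (mem_primitive_symm hy) s' r t, map_zero]
  · obtain ⟨t, rfl⟩ := Nat.exists_eq_add_of_lt h1
    rw [← inner_conj_symm, h.inner_shift_left hb hy r' s' t, map_zero]

variable (α β b) in
/-- The span of all shifts of the elements of a subspace. -/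
def shiftSpan (K : Submodule ℂ E) : Submodule ℂ E :=
  Submodule.span ℂ {y | ∃ r s, ∃ x ∈ K, y = (α.up b ^ r) ((β.up b ^ s) x)}

theorem shift_mem_shiftSpan {K : Submodule ℂ E} {x : E} (hx : x ∈ K) (r s : ℕ) :
    (α.up b ^ r) ((β.up b ^ s) x) ∈ shiftSpan α β b K :=
  Submodule.subset_span ⟨r, s, x, hx, rfl⟩

theorem Compatible.shiftSpan_symm (h : α.Compatible β G) (K : Submodule ℂ E) :
    shiftSpan α β b K = shiftSpan β α b K := by
  unfold shiftSpan
  congr 1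
  ext y
  constructor
  · rintro ⟨r, s, x, hx, rfl⟩
    exact ⟨s, r, x, hx, h.up_pow_up_pow b r s x⟩
  · rintro ⟨r, s, x, hx, rfl⟩
    exact ⟨s, r, x, hx, h.symm.up_pow_up_pow b r s x⟩

theorem up_mem_shiftSpan {K : Submodule ℂ E} {y : E} (hy : y ∈ shiftSpan α β b K) :
    α.up b y ∈ shiftSpan α β b K := by
  have : shiftSpan α β b K ≤ (shiftSpan α β b K).comap (α.up b) := by
    refine Submodule.span_le.2 ?_
    rintro _ ⟨r, s, x, hx, rfl⟩
    change α.up b _ ∈ shiftSpan α β b K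
    rw [← pow_succ_up]
    exact shift_mem_shiftSpan hx _ _
  exact this hy

/-- The shifts of `K` are invariant under the shortening operator if this holds for
`β ^ s x`, `α β ^ s x` with `x ∈ K`. -/
theorem dn_mem_shiftSpan {K : Submodule ℂ E}
    (h0 : ∀ x ∈ K, ∀ s, α.dn b ((β.up b ^ s) x) ∈ shiftSpan α β b K)
    (h1 : ∀ x ∈ K, ∀ s, α.root b ((β.up b ^ s) x) ∈ shiftSpan α β b K)
    {y : E} (hy : y ∈ shiftSpan α β b K) :
    α.dn b y ∈ shiftSpan α β b K := by
  have : shiftSpan α β b K ≤ (shiftSpan α β b K).comap (α.dn b) := by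
    refine Submodule.span_le.2 ?_
    rintro _ ⟨r, s, x, hx, rfl⟩
    change α.dn b _ ∈ shiftSpan α β b K
    rcases r with _ | _ | r
    · exact h0 x hx s
    · rw [zero_add, pow_one, dn_up]
      exact add_mem (Submodule.smul_mem _ _ (shift_mem_shiftSpan hx 0 s)) (h1 x hx s)
    · rw [dn_up_succ_pow]
      exact Submodule.smul_mem _ _ (shift_mem_shiftSpan hx _ _)
  exact this hy

end LetterAction

end Operators

/-! ### Generated von Neumann algebras -/

section Generated

variable {H : Type*} [NormedAddCommGroup H] [InnerProductSpace ℂ H] [CompleteSpace H]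

theorem mem_generatedVN {S : Set (H →L[ℂ] H)} {x : H →L[ℂ] H} :
    x ∈ generatedVN S ↔ ∀ y, (∀ s ∈ S, s * y = y * s ∧ star s * y = y * star s) →
      y * x = x * y := by
  change x ∈ StarSubalgebra.centralizer ℂ
    (StarSubalgebra.centralizer ℂ S : Set (H →L[ℂ] H)) ↔ _
  simp only [StarSubalgebra.mem_centralizer_iff, SetLike.mem_coe]
  constructor
  · intro h y hy; exact (h y hy).1
  · intro h y hy
    refine ⟨h y hy, h (star y) fun s hs => ⟨?_, ?_⟩⟩
    · simpa using congrArg star (hy s hs).2.symm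
    · simpa using congrArg star (hy s hs).1.symm

theorem subset_generatedVN {S : Set (H →L[ℂ] H)} {x : H →L[ℂ] H} (hx : x ∈ S) :
    x ∈ generatedVN S :=
  mem_generatedVN.2 fun _ hy => (hy x hx).1.symm

/-- The projection onto K commutes with S and its adjoints, so it lies in the commutant and commutes
with everything generated. -/
theorem generatedVN_invariant {S : Set (H →L[ℂ] H)} {K : Submodule ℂ H}
    [K.HasOrthogonalProjection] (hK : ∀ s ∈ S, ∀ ξ ∈ K, s ξ ∈ K)
    (hK' : ∀ s ∈ S, ∀ ξ ∈ K, star s ξ ∈ K) {x : H →L[ℂ] H} (hx : x ∈ generatedVN S)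
    {ξ : H} (hξ : ξ ∈ K) : x ξ ∈ K := by
  have key : ∀ T : H →L[ℂ] H, (∀ ξ ∈ K, T ξ ∈ K) → (∀ ξ ∈ K, star T ξ ∈ K) →
      T * K.starProjection = K.starProjection * T := by
    intro T h1 h2
    ext ξ
    change T (K.starProjection ξ) = K.starProjection (T ξ)
    refine (Submodule.eq_starProjection_of_mem_orthogonal' (h1 _ (K.starProjection_apply_mem ξ))
      (z := T (ξ - K.starProjection ξ)) ?_ ?_).symm
    · rw [Submodule.mem_orthogonal]
      intro η hη
      rw [← ContinuousLinearMap.adjoint_inner_left]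
      exact Submodule.inner_right_of_mem_orthogonal (h2 η hη)
        (K.sub_starProjection_mem_orthogonal ξ)
    · rw [← map_add]; simp
  have h := mem_generatedVN.1 hx K.starProjection fun s hs =>
    ⟨key s (hK s hs) (hK' s hs), key (star s) (hK' s hs) (by simpa using hK s hs)⟩
  have h1 : K.starProjection (x ξ) = x (K.starProjection ξ) := DFunLike.congr_fun h ξ
  rw [Submodule.starProjection_eq_self_iff.2 hξ] at h1
  exact Submodule.starProjection_eq_self_iff.1 h1

theorem unitary_mem_vN_zpow {M : VonNeumannAlgebra H} {a : unitary (H →L[ℂ] H)}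
    (ha : (a : H →L[ℂ] H) ∈ M) (n : ℤ) : ((a ^ n : unitary (H →L[ℂ] H)) : H →L[ℂ] H) ∈ M := by
  have hp : ∀ n : ℕ, ((a ^ n : unitary (H →L[ℂ] H)) : H →L[ℂ] H) ∈ M := fun n => by
    rw [SubmonoidClass.coe_pow]; exact pow_mem ha n
  rcases n with n | n
  · simpa using hp n
  · rw [zpow_negSucc, ← Unitary.star_eq_inv, Unitary.coe_star]
    exact star_mem (hp _)

end Generated

/-! ### Words in a free product -/

section FreeProduct

variable {H : Type*} [NormedAddCommGroup H] [InnerProductSpace ℂ H] [CompleteSpace H]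
variable {d : ℂ} (hd : ‖d‖ = 1) (hroot : ∀ n : ℕ, n ≠ 0 → d ^ n ≠ 1)
variable {u v : Fin 2 → unitary (H →L[ℂ] H)}
variable (huv : ∀ i, (u i : H →L[ℂ] H) * (v i : H →L[ℂ] H) =
      d • ((v i : H →L[ℂ] H) * (u i : H →L[ℂ] H)))
variable {Ω : H}

theorem uPow_add (u : Fin 2 → unitary (H →L[ℂ] H)) (i : Fin 2) (k l : ℤ) :
    uPow u i (k + l) = uPow u i k * uPow u i l := by
  simp [uPow, zpow_add]

@[simp] theorem uPow_zero (u : Fin 2 → unitary (H →L[ℂ] H)) (i : Fin 2) : uPow u i 0 = 1 := by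
  simp [uPow]

@[simp] theorem star_uPow (u : Fin 2 → unitary (H →L[ℂ] H)) (i : Fin 2) (k : ℤ) :
    star (uPow u i k) = uPow u i (-k) := by
  rw [uPow, ← Unitary.coe_star, Unitary.star_eq_inv, ← zpow_neg]; rfl

theorem norm_one_ne_zero {d : ℂ} (hd : ‖d‖ = 1) : d ≠ 0 := by
  rintro rfl; simp at hd

theorem conj_eq_inv {d : ℂ} (hd : ‖d‖ = 1) : starRingEnd ℂ d = d⁻¹ := by
  rw [Complex.inv_def, Complex.normSq_eq_norm_sq, hd]; simp

theorem conj_zpow {d : ℂ} (hd : ‖d‖ = 1) (n : ℤ) : starRingEnd ℂ (d ^ n) = d ^ (-n) := by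
  rw [map_zpow₀, conj_eq_inv hd, inv_zpow, zpow_neg]

include hroot in
theorem zpow_ne_one_of_root {n : ℤ} (hn : n ≠ 0) : d ^ n ≠ 1 := by
  rcases n with n | n
  · simpa using hroot n (by simpa using hn)
  · rw [zpow_negSucc]
    intro h
    exact hroot (n + 1) (by simp) (by simpa using h)

/-- The scalar `d` as a unitary operator. -/
def scalarUnitary (H : Type*) [NormedAddCommGroup H] [InnerProductSpace ℂ H] [CompleteSpace H]
    {d : ℂ} (hd : ‖d‖ = 1) : unitary (H →L[ℂ] H) :=
  ⟨d • 1, by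
    have h : star d * d = 1 := by
      change starRingEnd ℂ d * d = 1
      rw [conj_eq_inv hd, inv_mul_cancel₀ (norm_one_ne_zero hd)]
    constructor
    · rw [star_smul, star_one, smul_mul_smul_comm, h, one_mul, one_smul]
    · rw [star_smul, star_one, smul_mul_smul_comm, mul_comm, h, one_mul, one_smul]⟩

theorem coe_scalarUnitary_zpow {d : ℂ} (hd : ‖d‖ = 1) (n : ℤ) :
    ((scalarUnitary H hd ^ n : unitary (H →L[ℂ] H)) : H →L[ℂ] H) = d ^ n • 1 := by
  have hp : ∀ n : ℕ, ((scalarUnitary H hd ^ n : unitary (H →L[ℂ] H)) : H →L[ℂ] H) = d ^ n • 1 := by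
    intro n
    rw [SubmonoidClass.coe_pow]
    simp [scalarUnitary, smul_pow]
  rcases n with n | n
  · simpa using hp n
  · rw [zpow_negSucc, ← Unitary.star_eq_inv, Unitary.coe_star, hp, star_smul, star_one]
    congr 1
    change starRingEnd ℂ _ = _
    rw [← zpow_natCast, conj_zpow hd, Int.negSucc_eq]; simp

include hd huv in
theorem uPow_mul_uPow (i : Fin 2) (k l : ℤ) :
    uPow u i k * uPow v i l = d ^ (k * l) • (uPow v i l * uPow u i k) := by
  -- With d as a central unitary the relation is a semiconjugation in the group of unitaries, and
  -- integer powers of both factors can be taken.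
  set D := scalarUnitary H hd
  have hD : ∀ x : unitary (H →L[ℂ] H), Commute D x := fun x => by
    refine Subtype.ext ?_
    simp [D, scalarUnitary]
  have h1 : SemiconjBy (u i) (v i) (D * v i) := by
    refine Subtype.ext ?_
    simp [D, scalarUnitary, huv]
  have h2 := h1.zpow_right l
  rw [(hD (v i)).mul_zpow] at h2
  have h3 : SemiconjBy (v i ^ l) (D ^ l * u i) (u i) := by
    have h4 : u i * v i ^ l = D ^ l * v i ^ l * u i := h2
    have h5 : v i ^ l * (D ^ l * u i) = u i * v i ^ l := by
      rw [h4, ← mul_assoc, ((hD (v i ^ l)).zpow_left l).eq]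
    exact h5
  have h4 := h3.zpow_right k
  rw [((hD (u i)).zpow_left l).mul_zpow] at h4
  have h5 : v i ^ l * ((D ^ l) ^ k * u i ^ k) = u i ^ k * v i ^ l := h4
  have h6 := congrArg (Subtype.val) h5
  rw [← zpow_mul, mul_comm l k] at h6
  simp only [Submonoid.coe_mul] at h6
  rw [coe_scalarUnitary_zpow] at h6
  rw [uPow, uPow, ← h6]
  simp

/-- The operator represented by a syllable. -/
def sylOp (u v : Fin 2 → unitary (H →L[ℂ] H)) (s : Syllable) : H →L[ℂ] H :=
  uPow u s.1 s.2.1 * uPow v s.1 s.2.2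

@[simp] theorem wordOp_nil : wordOp u v [] = 1 := rfl
@[simp] theorem wordOp_cons (s : Syllable) (t : List Syllable) :
    wordOp u v (s :: t) = sylOp u v s * wordOp u v t := by simp [wordOp, sylOp]
@[simp] theorem wordOp_append (s t : List Syllable) :
    wordOp u v (s ++ t) = wordOp u v s * wordOp u v t := by simp [wordOp]

theorem uPow_mem_factorR (i : Fin 2) (k : ℤ) : uPow u i k ∈ factorR u v i :=
  unitary_mem_vN_zpow (subset_generatedVN (by simp)) k

theorem vPow_mem_factorR (i : Fin 2) (k : ℤ) : uPow v i k ∈ factorR u v i :=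
  unitary_mem_vN_zpow (subset_generatedVN (by simp)) k

theorem sylOp_mem_factorR (s : Syllable) : sylOp u v s ∈ factorR u v s.1 :=
  mul_mem (uPow_mem_factorR _ _) (vPow_mem_factorR _ _)

variable (hM : IsFreeProduct (factorR u v) Ω)
include hM

theorem IsFreeProduct.trace_comm {i : Fin 2} {x y : H →L[ℂ] H} (hx : x ∈ factorR u v i)
    (hy : y ∈ factorR u v i) : ⟪Ω, (x * y) Ω⟫_ℂ = ⟪Ω, (y * x) Ω⟫_ℂ :=
  hM.gns.trace x (subset_generatedVN (Set.mem_iUnion.2 ⟨i, hx⟩))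
    y (subset_generatedVN (Set.mem_iUnion.2 ⟨i, hy⟩))

include hd hroot huv

/-- If l = 0, conjugation by v_i multiplies u_i^k by d^k; otherwise conjugation by u_i multiplies
the syllable by d^(-l). The factor is not 1, while the trace is invariant under conjugation. -/
theorem trace_sylOp {s : Syllable} (hs : s.2 ≠ (0, 0)) : ⟪Ω, sylOp u v s Ω⟫_ℂ = 0 := by
  obtain ⟨i, k, l⟩ := s
  have hne : d ≠ 0 := norm_one_ne_zero hd
  have huu : uPow u i (-1) * uPow u i 1 = 1 := by rw [← uPow_add]; simp
  have hvv : uPow v i (-1) * uPow v i 1 = 1 := by rw [← uPow_add]; simp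
  have hmem : uPow u i k * uPow v i l ∈ factorR u v i := sylOp_mem_factorR (i, k, l)
  change ⟪Ω, (uPow u i k * uPow v i l) Ω⟫_ℂ = 0
  have fin : ∀ a : ℂ, a ≠ 1 → ⟪Ω, (uPow u i k * uPow v i l) Ω⟫_ℂ =
      a * ⟪Ω, (uPow u i k * uPow v i l) Ω⟫_ℂ → ⟪Ω, (uPow u i k * uPow v i l) Ω⟫_ℂ = 0 := by
    intro a ha h
    have : (1 - a) * ⟪Ω, (uPow u i k * uPow v i l) Ω⟫_ℂ = 0 := by linear_combination h
    exact (mul_eq_zero.1 this).resolve_left (sub_ne_zero.2 ha.symm)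
  by_cases hl : l = 0
  · subst hl
    have hk : k ≠ 0 := by rintro rfl; exact hs rfl
    have e : uPow u i k * uPow v i 0 = d ^ k • (uPow v i 1 * (uPow u i k * uPow v i (-1))) := by
      have := uPow_mul_uPow hd huv i k 1
      rw [mul_one] at this
      rw [← mul_assoc, ← smul_mul_assoc, ← this, mul_assoc, ← uPow_add]
      simp
    refine fin (d ^ k) (zpow_ne_one_of_root hroot hk) ?_
    conv_lhs => rw [e]
    rw [smul_apply, inner_smul_right,
      hM.trace_comm (vPow_mem_factorR i 1)
        (mul_mem (uPow_mem_factorR i k) (vPow_mem_factorR i (-1))), mul_assoc, hvv]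
    simp
  · have e : uPow u i k * uPow v i l = d ^ (-l) • (uPow u i 1 * (uPow u i k * uPow v i l *
        uPow u i (-1))) := by
      have h1 := uPow_mul_uPow hd huv i 1 l
      have h2 : uPow v i l * uPow u i (-1) = d ^ l • (uPow u i (-1) * uPow v i l) := by
        rw [uPow_mul_uPow hd huv i (-1) l, smul_smul, ← zpow_add₀ hne]; simp
      rw [mul_assoc (uPow u i k), h2, mul_smul_comm, mul_smul_comm, smul_smul, ← zpow_add₀ hne,
        ← mul_assoc, ← mul_assoc, ← uPow_add, ← uPow_add]
      simp
    refine fin (d ^ (-l)) (zpow_ne_one_of_root hroot (neg_ne_zero.2 hl)) ?_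
    conv_lhs => rw [e]
    rw [smul_apply, inner_smul_right,
      hM.trace_comm (uPow_mem_factorR i 1)
        (mul_mem hmem (uPow_mem_factorR i (-1))), mul_assoc, huu]
    simp

omit hd hroot huv in
theorem IsFreeProduct.inner_prod_eq_zero (a : List (Fin 2 × (H →L[ℂ] H))) (h0 : a ≠ [])
    (h1 : a.IsChain fun s t => s.1 ≠ t.1)
    (h2 : ∀ s ∈ a, s.2 ∈ factorR u v s.1 ∧ ⟪Ω, s.2 Ω⟫_ℂ = 0) :
    ⟪Ω, (a.map Prod.snd).prod Ω⟫_ℂ = 0 := hM.free a h0 h1 h2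

omit hd hroot hM huv in
theorem star_wordOp_eq (w : List Syllable) :
    star (wordOp u v w) = ((w.reverse.map fun s => (s.1, star (sylOp u v s))).map Prod.snd).prod := by
  induction w with
  | nil => simp
  | cons s t ih => simp [ih]

omit hd hroot hM huv in
theorem wordOp_eq (w : List Syllable) :
    wordOp u v w = ((w.map fun s => (s.1, sylOp u v s)).map Prod.snd).prod := by
  induction w with
  | nil => simp
  | cons s t ih => simp [ih]

/-- Common initial syllables cancel. Where the words first differ, either the indices differ and the
product alternates, or two syllables of one index combine to a single element of trace zero. In each
case freeness applies. -/
theorem inner_wordOp_of_ne {w w' : List Syllable} (h : IsReducedWord w) (h' : IsReducedWord w')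
    (hne : w ≠ w') : ⟪Ω, (star (wordOp u v w) * wordOp u v w') Ω⟫_ℂ = 0 := by
  have hstar : ∀ x : H →L[ℂ] H, ⟪Ω, x Ω⟫_ℂ = 0 → ⟪Ω, star x Ω⟫_ℂ = 0 := by
    intro x hx
    rw [ContinuousLinearMap.star_eq_adjoint, ContinuousLinearMap.adjoint_inner_right,
      ← inner_conj_symm, hx, map_zero]
  have hgood : ∀ w : List Syllable, IsReducedWord w →
      ∀ s ∈ w.map (fun s => (s.1, sylOp u v s)), s.2 ∈ factorR u v s.1 ∧ ⟪Ω, s.2 Ω⟫_ℂ = 0 := by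
    intro w hw s hs
    obtain ⟨t, ht, rfl⟩ := List.mem_map.1 hs
    exact ⟨sylOp_mem_factorR t, trace_sylOp hd hroot huv hM (hw.2 t ht)⟩
  have hgood' : ∀ w : List Syllable, IsReducedWord w →
      ∀ s ∈ w.reverse.map (fun s => (s.1, star (sylOp u v s))),
        s.2 ∈ factorR u v s.1 ∧ ⟪Ω, s.2 Ω⟫_ℂ = 0 := by
    intro w hw s hs
    obtain ⟨t, ht, rfl⟩ := List.mem_map.1 hs
    exact ⟨star_mem (sylOp_mem_factorR t), hstar _ (trace_sylOp hd hroot huv hM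
      (hw.2 t (by simpa using ht)))⟩
  induction w generalizing w' with
  | nil =>
    rw [wordOp_nil, star_one, one_mul, wordOp_eq]
    refine hM.inner_prod_eq_zero _ (by simpa using hne.symm) ?_ (hgood _ h')
    rw [List.isChain_map]; exact h'.1
  | cons s t ih =>
    rcases w' with _ | ⟨s', t'⟩
    · rw [wordOp_nil, mul_one, star_wordOp_eq]
      refine hM.inner_prod_eq_zero _ (by simp) ?_ (hgood' _ h)
      rw [List.isChain_map]; exact h.reverse.1
    · have hst := isReducedWord_cons.1 h
      have hst' := isReducedWord_cons.1 h'
      by_cases hi : s.1 = s'.1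
      · by_cases hs : s = s'
        · subst hs
          have hu : star (sylOp u v s) * sylOp u v s = 1 := by
            rw [sylOp, star_mul, mul_assoc, ← mul_assoc (star (uPow u s.1 s.2.1)), star_uPow,
              star_uPow, ← uPow_add, neg_add_cancel, uPow_zero, one_mul, ← uPow_add,
              neg_add_cancel, uPow_zero]
          rw [wordOp_cons, wordOp_cons, star_mul, mul_assoc,
            ← mul_assoc (star (sylOp u v s)), hu, one_mul]
          exact ih hst.2.2 hst'.2.2 fun h => hne (by rw [h])
        · obtain ⟨i, k, l⟩ := s
          obtain ⟨i', k', l'⟩ := s'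
          simp only at hi; subst hi
          have h0 : (k' - k, l' - l) ≠ ((0, 0) : ℤ × ℤ) := by
            intro h0; apply hs
            simp only [Prod.mk.injEq] at h0 ⊢
            exact ⟨trivial, by omega, by omega⟩
          -- By the trace property v_i^{-l} may be moved to the right end, which leaves one
          -- non-trivial syllable.
          have hm : ⟪Ω, (star (sylOp u v (i, k, l)) * sylOp u v (i, k', l')) Ω⟫_ℂ = 0 := by
            have e : star (sylOp u v (i, k, l)) * sylOp u v (i, k', l') =
                uPow v i (-l) * (uPow u i (k' - k) * uPow v i l') := by
              simp only [sylOp, star_mul, star_uPow]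
              rw [mul_assoc, ← mul_assoc (uPow u i (-k)), ← uPow_add, neg_add_eq_sub]
            rw [e, hM.trace_comm (vPow_mem_factorR i _)
              (mul_mem (uPow_mem_factorR i _) (vPow_mem_factorR i _)), mul_assoc, ← uPow_add,
              ← sub_eq_add_neg]
            exact trace_sylOp hd hroot huv hM (s := (i, k' - k, l' - l)) h0
          have e : star (wordOp u v ((i, k, l) :: t)) * wordOp u v ((i, k', l') :: t') =
              (((t.reverse.map fun s => (s.1, star (sylOp u v s))) ++
                ((i, star (sylOp u v (i, k, l)) * sylOp u v (i, k', l')) ::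
                  t'.map fun s => (s.1, sylOp u v s))).map Prod.snd).prod := by
            rw [List.map_append, List.prod_append, ← star_wordOp_eq, List.map_cons,
              List.prod_cons, ← wordOp_eq, wordOp_cons, wordOp_cons, star_mul]
            simp only [mul_assoc]
          rw [e]
          refine hM.inner_prod_eq_zero _ (by simp) ?_ ?_
          · rw [List.isChain_append, List.isChain_map, List.isChain_cons, List.isChain_map]
            refine ⟨hst.2.2.reverse.1, ⟨?_, hst'.2.2.1⟩, ?_⟩
            · intro y hy
              simp only [List.head?_map, Option.mem_map] at hy
              obtain ⟨x, hx, rfl⟩ := hy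
              exact hst'.1 x hx
            · intro x hx y hy
              simp only [List.head?_cons, Option.mem_some_iff] at hy
              subst hy
              simp only [List.getLast?_map, List.getLast?_reverse, Option.mem_map] at hx
              obtain ⟨z, hz, rfl⟩ := hx
              exact (hst.1 z hz).symm
          · intro x hx
            rcases List.mem_append.1 hx with hx | hx
            · exact hgood' t hst.2.2 x hx
            · rcases List.mem_cons.1 hx with rfl | hx
              · exact ⟨mul_mem (star_mem (sylOp_mem_factorR (i, k, l)))
                  (sylOp_mem_factorR (i, k', l')), hm⟩
              · exact hgood t' hst'.2.2 x hx
      · rw [star_wordOp_eq, wordOp_eq, ← List.prod_append, ← List.map_append]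
        refine hM.inner_prod_eq_zero _ (by simp) ?_ ?_
        · rw [List.isChain_append, List.isChain_map, List.isChain_map]
          refine ⟨h.reverse.1, h'.1, ?_⟩
          intro x hx y hy
          simp only [List.getLast?_map, List.getLast?_reverse, Option.mem_map,
            List.head?_cons, Option.mem_some_iff] at hx hy
          obtain ⟨z, rfl, rfl⟩ := hx
          obtain ⟨z, rfl, rfl⟩ := hy
          exact hi
        · intro x hx
          rcases List.mem_append.1 hx with hx | hx
          · exact hgood' _ h x hx
          · exact hgood _ h' x hx

omit hd hroot huv in
theorem norm_wordOp (w : List Syllable) : ‖wordOp u v w Ω‖ = 1 := by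
  have hu : ∀ (a : unitary (H →L[ℂ] H)) (x : H), ‖(a : H →L[ℂ] H) x‖ = ‖x‖ := fun a x =>
    (ContinuousLinearMap.norm_map_of_mem_unitary a.2 x)
  induction w with
  | nil => simpa using hM.gns.norm_eq_one
  | cons s t ih =>
    rw [wordOp_cons]
    change ‖uPow u s.1 s.2.1 (uPow v s.1 s.2.2 (wordOp u v t Ω))‖ = 1
    rw [uPow, uPow, hu, hu, ih]

/-- The words form an orthonormal system. -/
theorem orthonormal_words : Orthonormal ℂ fun w : RWord => wordOp u v w.1 Ω := by
  refine ⟨fun w => norm_wordOp hM w.1, fun w w' hne => ?_⟩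
  have := inner_wordOp_of_ne hd hroot huv hM w.2 w'.2 fun h => hne (RWord.ext h)
  rwa [mul_apply_eq_comp, ContinuousLinearMap.star_eq_adjoint,
    ContinuousLinearMap.adjoint_inner_right] at this

/-! ### Totality of the words -/

omit hd hroot huv hM in
theorem wordOp_lmul (c : Letter) (w : List Syllable) :
    wordOp u v (lmul c w) = uPow u c.1 c.2 * wordOp u v w := by
  rcases w with _ | ⟨⟨i, k, l⟩, t⟩
  · simp [lmul, sylOp]
  · rw [lmul_cons]
    split_ifs with hi hk
    · obtain ⟨hk, rfl⟩ := hk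
      rw [wordOp_cons, sylOp, ← mul_assoc, ← mul_assoc, hi, ← uPow_add, add_comm, hk]
      simp
    · rw [wordOp_cons, wordOp_cons, sylOp, sylOp, ← mul_assoc, ← mul_assoc, hi, ← uPow_add,
        add_comm]
    · simp [sylOp]

omit hroot hM in
theorem wordOp_mul_uPow (c : Letter) (w : List Syllable) :
    wordOp u v w * uPow u c.1 c.2 = phaseHead d c w.reverse • wordOp u v (rmul c w) := by
  rcases List.eq_nil_or_concat w with rfl | ⟨t, ⟨i, k, l⟩, rfl⟩
  · simp [rmul, lmul, phaseHead, sylOp]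
  · rw [List.concat_eq_append, rmul_append (by simp), wordOp_append, wordOp_append, mul_assoc,
      wordOp_cons, wordOp_nil,
      mul_one, ← mul_smul_comm]
    congr 1
    simp only [List.reverse_append, List.reverse_singleton,
      List.singleton_append, phaseHead]
    by_cases hi : i = c.1
    · subst hi
      have e : uPow v c.1 l * uPow u c.1 c.2 = d ^ (-(l * c.2)) •
          (uPow u c.1 c.2 * uPow v c.1 l) := by
        rw [uPow_mul_uPow hd huv, smul_smul, ← zpow_add₀ (norm_one_ne_zero hd), mul_comm l]
        simp
      have e2 : wordOp u v (rmul c [(c.1, k, l)]) = uPow u c.1 (k + c.2) * uPow v c.1 l := by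
        rw [rmul, List.reverse_singleton, lmul_cons, if_pos rfl]
        split_ifs with hk
        · simp [hk]
        · simp [sylOp]
      rw [sylOp, mul_assoc, e, e2, mul_smul_comm, if_pos rfl, ← mul_assoc, ← uPow_add]
    · simp [rmul, lmul, hi, sylOp]

omit hroot hM in
-- Adjacent syllables of the same index merge into one, up to a phase.
theorem sylOp_mul_wordOp_mem (s : Syllable) {w : List Syllable} (hw : IsReducedWord w) :
    sylOp u v s * wordOp u v w ∈ Submodule.span ℂ (Set.range fun w : RWord => wordOp u v w.1) := by
  by_cases hs : s.2 = (0, 0)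
  · obtain ⟨i, k, l⟩ := s
    simp only [Prod.mk.injEq] at hs
    obtain ⟨rfl, rfl⟩ := hs
    simp only [sylOp, uPow_zero, one_mul]
    exact Submodule.subset_span ⟨⟨w, hw⟩, rfl⟩
  by_cases h1 : ∀ x ∈ w.head?, s.1 ≠ x.1
  · exact Submodule.subset_span ⟨⟨s :: w, isReducedWord_cons.2 ⟨h1, hs, hw⟩⟩, by simp⟩
  · rcases w with _ | ⟨⟨j, k', l'⟩, t⟩
    · simp at h1
    · have hi : s.1 = j := by simpa using h1
      obtain ⟨i, k, l⟩ := s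
      simp only at hi; subst hi
      obtain ⟨h2, h3, h4⟩ := isReducedWord_cons.1 hw
      have e : uPow v i l * uPow u i k' = d ^ (-(k' * l)) • (uPow u i k' * uPow v i l) := by
        rw [uPow_mul_uPow hd huv, smul_smul, ← zpow_add₀ (norm_one_ne_zero hd)]
        simp
      have e2 : sylOp u v (i, k, l) * wordOp u v ((i, k', l') :: t) =
          d ^ (-(k' * l)) • wordOp u v (syl i (k + k') (l + l') ++ t) := by
        have e3 : wordOp u v (syl i (k + k') (l + l')) = uPow u i (k + k') * uPow v i (l + l') := by
          unfold syl; split_ifs with h <;> simp [h, sylOp]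
        rw [wordOp_append, e3, wordOp_cons, sylOp, sylOp, uPow_add, uPow_add]
        simp only [mul_assoc]
        rw [← mul_assoc (uPow v i l), e]
        simp only [mul_assoc, smul_mul_assoc, mul_smul_comm]
      rw [e2]
      refine Submodule.smul_mem _ _ (Submodule.subset_span ⟨⟨_, ?_⟩, rfl⟩)
      unfold syl
      split_ifs with h
      · exact h4
      · exact isReducedWord_cons.2 ⟨h2, by simpa using h, h4⟩

omit hroot in
/-- The words span a dense subspace. -/
theorem dense_span_words :
    (Submodule.span ℂ (Set.range fun w : RWord => wordOp u v w.1 Ω)).topologicalClosure = ⊤ := by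
  set K := (Submodule.span ℂ (Set.range fun w : RWord => wordOp u v w.1 Ω)).topologicalClosure
  have : CompleteSpace K := (Submodule.isClosed_topologicalClosure _).completeSpace_coe
  have hinv : ∀ s : Syllable, ∀ ξ ∈ K, sylOp u v s ξ ∈ K := by
    intro s ξ hξ
    have h1 : Submodule.span ℂ (Set.range fun w : RWord => wordOp u v w.1 Ω) ≤
        K.comap (sylOp u v s : H →ₗ[ℂ] H) := by
      refine Submodule.span_le.2 ?_
      rintro _ ⟨w, rfl⟩
      refine Submodule.le_topologicalClosure _ ?_
      have h2 := Submodule.mem_map_of_mem (f := toL2 Ω) (sylOp_mul_wordOp_mem hd huv s w.2)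
      rw [Submodule.map_span, ← Set.range_comp] at h2
      exact h2
    have h3 : IsClosed ((K.comap (sylOp u v s : H →ₗ[ℂ] H) : Submodule ℂ H) : Set H) :=
      (Submodule.isClosed_topologicalClosure _).preimage (sylOp u v s).continuous
    exact (Submodule.topologicalClosure_minimal _ h1 h3) hξ
  have hu : ∀ i k, ∀ ξ ∈ K, uPow u i k ξ ∈ K := fun i k ξ hξ => by
    simpa [sylOp] using hinv (i, k, 0) ξ hξ
  have hv : ∀ i k, ∀ ξ ∈ K, uPow v i k ξ ∈ K := fun i k ξ hξ => by
    simpa [sylOp] using hinv (i, 0, k) ξ hξ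
  -- Invariance passes from the generators to each R_i, and then in the same way to the algebra
  -- generated by both.
  have hR : ∀ i, ∀ x ∈ factorR u v i, ∀ ξ ∈ K, x ξ ∈ K := by
    intro i x hx ξ hξ
    have e1 : ∀ a : Fin 2 → unitary (H →L[ℂ] H), (a i : H →L[ℂ] H) = uPow a i 1 := fun a => by
      simp [uPow]
    refine generatedVN_invariant ?_ ?_ hx hξ
    · rintro s (rfl | rfl) ξ hξ
      · rw [e1]; exact hu _ _ ξ hξ
      · rw [e1]; exact hv _ _ ξ hξ
    · rintro s (rfl | rfl) ξ hξ
      · rw [e1, star_uPow]; exact hu _ _ ξ hξ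
      · rw [e1, star_uPow]; exact hv _ _ ξ hξ
  have hΩ : Ω ∈ K := by
    refine Submodule.le_topologicalClosure _ (Submodule.subset_span ⟨⟨[], isReducedWord_nil⟩, ?_⟩)
    simp
  have hsub : {ξ : H | ∃ x ∈ generatedVN (⋃ i, (factorR u v i : Set (H →L[ℂ] H))), x Ω = ξ} ⊆ K := by
    rintro _ ⟨x, hx, rfl⟩
    refine generatedVN_invariant ?_ ?_ hx hΩ
    · intro s hs ξ hξ
      obtain ⟨i, hi⟩ := Set.mem_iUnion.1 hs
      exact hR i s hi ξ hξ
    · intro s hs ξ hξ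
      obtain ⟨i, hi⟩ := Set.mem_iUnion.1 hs
      exact hR i _ (star_mem hi) ξ hξ
  rw [Submodule.eq_top_iff']
  intro x
  have h1 := (hM.gns.cyclic.mono hsub) x
  rwa [(Submodule.isClosed_topologicalClosure _).closure_eq] at h1

end FreeProduct

/-! ### Spans of sets of words, grading by length, and spheres -/

section Graded

variable {X E : Type*} [NormedAddCommGroup E] [InnerProductSpace ℂ E] {len : X → ℕ}

/-- The span of the basis vectors with indices in `T`. -/
def wspan (b : Module.Basis X ℂ E) (T : Set X) : Submodule ℂ E := Submodule.span ℂ (b '' T)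

section wspan

variable {b : Module.Basis X ℂ E} {T T' : Set X}

theorem basis_mem_wspan {x : X} (hx : x ∈ T) : b x ∈ wspan b T :=
  Submodule.subset_span ⟨x, hx, rfl⟩

theorem wspan_mono (h : T ⊆ T') : wspan b T ≤ wspan b T' :=
  Submodule.span_mono (Set.image_mono h)

theorem mem_wspan_iff {x : E} : x ∈ wspan b T ↔ ∀ i, b.repr x i ≠ 0 → i ∈ T := by
  rw [wspan, Module.Basis.mem_span_image]
  simp [Set.subset_def]

theorem wspan_le_comap {T' : Set X} {f : E →ₗ[ℂ] E} (h : ∀ x ∈ T, f (b x) ∈ wspan b T') {x : E}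
    (hx : x ∈ wspan b T) : f x ∈ wspan b T' := by
  have : wspan b T ≤ (wspan b T').comap f := by
    refine Submodule.span_le.2 ?_
    rintro _ ⟨x, hx, rfl⟩
    exact h x hx
  exact this hx

theorem repr_eq_inner (hb : Orthonormal ℂ b) (x : E) (i : X) : b.repr x i = ⟪b i, x⟫_ℂ := by
  conv_rhs => rw [← b.linearCombination_repr x]
  rw [hb.inner_right_finsupp]

theorem inner_eq_zero_of_disjoint (hb : Orthonormal ℂ b) (hT : Disjoint T T') {x y : E}
    (hx : x ∈ wspan b T) (hy : y ∈ wspan b T') : ⟪x, y⟫_ℂ = 0 := by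
  have h1 : wspan b T ≤ (wspan b T')ᗮ := by
    refine Submodule.span_le.2 ?_
    rintro _ ⟨x, hx, rfl⟩
    change b x ∈ (wspan b T')ᗮ
    have h2 : wspan b T' ≤ (Submodule.span ℂ {b x})ᗮ := by
      refine Submodule.span_le.2 ?_
      rintro _ ⟨y, hy, rfl⟩
      change b y ∈ (Submodule.span ℂ {b x})ᗮ
      rw [Submodule.mem_orthogonal_singleton_iff_inner_right]
      exact hb.2 fun h => Set.disjoint_left.1 hT hx (h ▸ hy)
    rw [Submodule.mem_orthogonal']
    intro u hu
    exact (Submodule.mem_orthogonal_singleton_iff_inner_right).1 (h2 hu)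
  exact Submodule.inner_left_of_mem_orthogonal hy (h1 hx)

/-- The sum of the basis vectors with indices in a finite set. -/
def setVec (b : Module.Basis X ℂ E) {T : Set X} (hT : T.Finite) : E := ∑ x ∈ hT.toFinset, b x

theorem setVec_mem (hT : T.Finite) : setVec b hT ∈ wspan b T :=
  Submodule.sum_mem _ fun _ hx => basis_mem_wspan (hT.mem_toFinset.1 hx)

theorem ext_inner_basis {x y : E} (h : ∀ i, ⟪b i, x⟫_ℂ = ⟪b i, y⟫_ℂ) : x = y := by
  rw [← sub_eq_zero, ← inner_self_eq_zero (𝕜 := ℂ)]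
  have h1 : ∀ z ∈ Submodule.span ℂ (Set.range b), ⟪z, x - y⟫_ℂ = 0 := by
    intro z hz
    induction hz using Submodule.span_induction with
    | mem z hz => obtain ⟨i, rfl⟩ := hz; rw [inner_sub_right, h, sub_self]
    | zero => simp
    | add y z _ _ hy hz => rw [inner_add_left, hy, hz, add_zero]
    | smul a y _ hy => rw [inner_smul_left, hy, mul_zero]
  exact h1 _ (b.mem_span _)

open Classical in
theorem inner_setVec (hb : Orthonormal ℂ b) (hT : T.Finite) (x : X) :
    ⟪b x, setVec b hT⟫_ℂ = if x ∈ T then 1 else 0 := by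
  simp [setVec, orthonormal_iff_ite.mp hb]

end wspan

namespace LetterAction

variable (α β : LetterAction len) (b : Module.Basis X ℂ E)

/-- The sum of the letters. -/
def total : Module.End ℂ E := α.up b + α.dn b

theorem total_apply (x : E) : α.total b x = α.up b x + α.dn b x := rfl

theorem total_basis (x : X) : α.total b (b x) = ∑ c, α.wt c x • b (α.act c x) := by
  rw [total_apply, up_basis, dn_basis, ← Finset.sum_add_distrib]
  refine Finset.sum_congr rfl fun c _ => ?_
  by_cases h : len (α.act c x) < len x
  · rw [if_pos h, if_neg h.not_gt, zero_add]
  · rw [if_neg h, if_pos (α.not_lt_iff.1 h), add_zero]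

variable {b}

theorem inner_total (hb : Orthonormal ℂ b) (x y : E) :
    ⟪α.total b x, y⟫_ℂ = ⟪x, α.total b y⟫_ℂ := by
  rw [total_apply, total_apply, inner_add_left, inner_add_right, inner_up_left α hb,
    inner_up_right α hb, add_comm]

variable {α β} in
theorem Compatible.total_total {G : Set X} (h : α.Compatible β G) (x : E) :
    α.total b (β.total b x) = β.total b (α.total b x) := by
  have : α.total b ∘ₗ β.total b = β.total b ∘ₗ α.total b := by
    refine b.ext fun x => ?_
    simp only [LinearMap.comp_apply, total_basis, map_sum, map_smul, Finset.smul_sum, smul_smul,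
      h.wt_left, h.wt_right]
    rw [Finset.sum_comm]
    refine Finset.sum_congr rfl fun c _ => Finset.sum_congr rfl fun c' _ => ?_
    rw [h.comm, mul_comm]
  exact LinearMap.congr_fun this x

theorem up_mem_wspan {T T' : Set X} (hT : ∀ x ∈ T, ∀ c, len x < len (α.act c x) → α.act c x ∈ T')
    {x : E} (hx : x ∈ wspan b T) : α.up b x ∈ wspan b T' := by
  refine wspan_le_comap (fun x hx => ?_) hx
  rw [up_basis]
  refine Submodule.sum_mem _ fun c _ => ?_
  split_ifs with h1
  · exact Submodule.smul_mem _ _ (basis_mem_wspan (hT x hx c h1))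
  · exact zero_mem _

theorem dn_mem_wspan {T T' : Set X} (hT : ∀ x ∈ T, ∀ c, len (α.act c x) < len x → α.act c x ∈ T')
    {x : E} (hx : x ∈ wspan b T) : α.dn b x ∈ wspan b T' := by
  refine wspan_le_comap (fun x hx => ?_) hx
  rw [dn_basis]
  refine Submodule.sum_mem _ fun c _ => ?_
  split_ifs with h1
  · exact Submodule.smul_mem _ _ (basis_mem_wspan (hT x hx c h1))
  · exact zero_mem _

theorem up_mem_len {l : ℕ} {x : E} (hx : x ∈ wspan b {x | len x = l}) :
    α.up b x ∈ wspan b {x | len x = l + 1} :=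
  α.up_mem_wspan (fun x hx c h => by
    rw [α.len_lt_iff] at h; simp only [Set.mem_ofPred_eq] at hx ⊢; omega) hx

theorem up_pow_mem_len {l : ℕ} {x : E} (hx : x ∈ wspan b {x | len x = l}) (r : ℕ) :
    (α.up b ^ r) x ∈ wspan b {x | len x = l + r} := by
  induction r with
  | zero => exact hx
  | succ r ih => rw [pow_succ_up]; exact α.up_mem_len ih

theorem up_mem_len_lt {n : ℕ} {x : E} (hx : x ∈ wspan b {x | len x < n}) :
    α.up b x ∈ wspan b {x | len x < n + 1} :=
  α.up_mem_wspan (fun x hx c h => by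
    rw [α.len_lt_iff] at h; simp only [Set.mem_ofPred_eq] at hx ⊢; omega) hx

theorem dn_mem_len {n : ℕ} {x : E} (hx : x ∈ wspan b {x | len x = n}) :
    α.dn b x ∈ wspan b {x | len x < n} :=
  α.dn_mem_wspan (fun x hx c h => by simp only [Set.mem_ofPred_eq] at hx ⊢; omega) hx

theorem dn_mem_len_lt {n : ℕ} {x : E} (hx : x ∈ wspan b {x | len x < n}) :
    α.dn b x ∈ wspan b {x | len x < n} :=
  α.dn_mem_wspan (fun x hx c h => by simp only [Set.mem_ofPred_eq] at hx ⊢; omega) hx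

theorem total_mem_len_lt {n : ℕ} {x : E} (hx : x ∈ wspan b {x | len x < n}) :
    α.total b x ∈ wspan b {x | len x < n + 1} :=
  add_mem (α.up_mem_len_lt hx)
    (wspan_mono (fun x hx => by simp only [Set.mem_ofPred_eq] at hx ⊢; omega) (α.dn_mem_len_lt hx))

variable (b) in
/-- The operator of multiplication by the sum of the words of length `r` in the letters, written
as a polynomial in the operator of multiplication by the sum of the letters. -/
def sphere : ℕ → Module.End ℂ E
  | 0 => 1
  | 1 => α.total b
  | 2 => α.total b * α.total b - (4 : ℂ) • 1
  | r + 3 => α.total b * sphere (r + 2) - (3 : ℂ) • sphere (r + 1)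

theorem sphere_mem_len_lt (r : ℕ) : ∀ {n : ℕ} {x : E}, x ∈ wspan b {x | len x < n} →
    α.sphere b r x ∈ wspan b {x | len x < n + r} := by
  induction r using Nat.strong_induction_on with
  | _ r ih =>
    intro n x hx
    match r, ih with
    | 0, _ => exact hx
    | 1, _ => exact α.total_mem_len_lt hx
    | 2, _ =>
      exact sub_mem (α.total_mem_len_lt (α.total_mem_len_lt hx)) (Submodule.smul_mem _ _
        (wspan_mono (fun x hx => by simp only [Set.mem_ofPred_eq] at hx ⊢; omega) hx))
    | r + 3, ih =>
      exact sub_mem (α.total_mem_len_lt (ih (r + 2) (by omega) hx)) (Submodule.smul_mem _ _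
        (wspan_mono (fun x hx => by simp only [Set.mem_ofPred_eq] at hx ⊢; omega)
          (ih (r + 1) (by omega) hx)))

/-- Only lengthening at every step reaches length l + r; all other terms of the polynomial stay
shorter. Thus projecting to the top length isolates `up ^ r`. -/
theorem sphere_sub_mem (r : ℕ) : ∀ {l : ℕ} {x : E}, x ∈ wspan b {x | len x = l} →
    α.sphere b r x - (α.up b ^ r) x ∈ wspan b {x | len x < l + r} := by
  have hlt : ∀ {l n : ℕ} {x : E}, l < n → x ∈ wspan b {x | len x = l} →
      x ∈ wspan b {x | len x < n} := fun h hx =>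
    wspan_mono (fun x hx => by simp only [Set.mem_ofPred_eq] at hx ⊢; omega) hx
  have hmono : ∀ {m n : ℕ} {x : E}, m ≤ n → x ∈ wspan b {x | len x < m} →
      x ∈ wspan b {x | len x < n} := fun h hx =>
    wspan_mono (fun x hx => by simp only [Set.mem_ofPred_eq] at hx ⊢; omega) hx
  induction r using Nat.strong_induction_on with
  | _ r ih =>
    intro l x hx
    match r, ih with
    | 0, _ => simp [sphere]
    | 1, _ =>
      have : α.sphere b 1 x - (α.up b ^ 1) x = α.dn b x := by
        simp [sphere, total_apply]
      rw [this]
      exact hmono (by omega) (α.dn_mem_len hx)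
    | 2, _ =>
      have : α.sphere b 2 x - (α.up b ^ 2) x =
          α.dn b (α.up b x) + α.total b (α.dn b x) - (4 : ℂ) • x := by
        simp only [sphere, total_apply, LinearMap.sub_apply, Module.End.mul_apply, map_add,
          LinearMap.smul_apply, Module.End.one_apply, pow_two]
        abel
      rw [this]
      refine sub_mem (add_mem ?_ ?_) (Submodule.smul_mem _ _ (hlt (by omega) hx))
      · exact hmono (by omega) (α.dn_mem_len (α.up_mem_len hx))
      · exact hmono (by omega) (α.total_mem_len_lt (α.dn_mem_len hx))
    | r + 3, ih =>
      have : α.sphere b (r + 3) x - (α.up b ^ (r + 3)) x =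
          α.total b (α.sphere b (r + 2) x - (α.up b ^ (r + 2)) x) +
            α.dn b ((α.up b ^ (r + 2)) x) - (3 : ℂ) • α.sphere b (r + 1) x := by
        rw [pow_succ_up, map_sub, total_apply (x := (α.up b ^ (r + 2)) x)]
        simp only [sphere, LinearMap.sub_apply, Module.End.mul_apply, LinearMap.smul_apply]
        abel
      rw [this]
      refine sub_mem (add_mem ?_ ?_) (Submodule.smul_mem _ _ ?_)
      · exact α.total_mem_len_lt (ih (r + 2) (by omega) hx)
      · exact hmono (by omega) (α.dn_mem_len (α.up_pow_mem_len hx _))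
      · exact hmono (by omega) (α.sphere_mem_len_lt (r + 1) (hlt (Nat.lt_succ_self l) hx))

end LetterAction

end Graded

/-! ### Words with no or exactly one syllable containing v -/

section Lists

theorem eq_nil_of_wordLength {w : List Syllable} (h : IsReducedWord w) (h0 : wordLength w = 0) :
    w = [] := by
  rcases w with _ | ⟨⟨i, k, l⟩, t⟩
  · rfl
  · have := (isReducedWord_cons.1 h).2.1
    simp only [wordLength_cons] at h0
    exact absurd (by simp only [Prod.mk.injEq]; omega) this

/-- The trivial word is therefore the only root among the words in the letters u, and `root`
vanishes on non-trivial ones. -/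
theorem exists_descent_of_vCount_eq_zero {w : List Syllable} (h : IsReducedWord w)
    (h0 : vCount w = 0) (hw : w ≠ []) : ∃ c, IsLeftDescent c w := by
  rcases w with _ | ⟨⟨i, k, l⟩, t⟩
  · exact absurd rfl hw
  · have h1 := (isReducedWord_cons.1 h).2.1
    have hl : l = 0 := by
      by_contra hl; simp [hl] at h0
    subst hl
    have hk : k ≠ 0 := by simpa using h1
    rcases lt_or_gt_of_ne hk with hk | hk
    · exact ⟨(i, 1), k, 0, t, rfl, by simpa using hk⟩
    · exact ⟨(i, -1), k, 0, t, rfl, by simpa using hk⟩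

theorem isReducedWord_append {w w' : List Syllable} :
    IsReducedWord (w ++ w') ↔ IsReducedWord w ∧ IsReducedWord w' ∧
      ∀ x ∈ w.getLast?, ∀ y ∈ w'.head?, x.1 ≠ y.1 := by
  simp only [IsReducedWord, List.isChain_append, List.mem_append]
  constructor
  · rintro ⟨⟨h1, h2, h3⟩, h4⟩
    exact ⟨⟨h1, fun s hs => h4 s (Or.inl hs)⟩, ⟨h2, fun s hs => h4 s (Or.inr hs)⟩, h3⟩
  · rintro ⟨⟨h1, h2⟩, ⟨h3, h4⟩, h5⟩
    exact ⟨⟨h1, h3, h5⟩, fun s hs => hs.elim (h2 s) (h4 s)⟩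

theorem exists_eq_of_vCount_eq_one {w : List Syllable} (h : vCount w = 1) :
    ∃ x i k l y, w = x ++ (i, k, l) :: y ∧ vCount x = 0 ∧ vCount y = 0 ∧ l ≠ 0 := by
  induction w with
  | nil => simp at h
  | cons s t ih =>
    obtain ⟨i, k, l⟩ := s
    by_cases hl : l = 0
    · obtain ⟨x, i', k', l', y, rfl, h1, h2, h3⟩ := ih (by simpa [hl] using h)
      exact ⟨(i, k, l) :: x, i', k', l', y, rfl, by simp [hl, h1], h2, h3⟩
    · exact ⟨[], i, k, l, t, rfl, rfl, by simpa [hl] using h, hl⟩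

theorem vLength_eq_zero {w : List Syllable} (h : vCount w = 0) : vLength w = 0 := by
  induction w with
  | nil => rfl
  | cons s t ih =>
    by_cases hl : s.2.2 = 0
    · simp [hl] at h ⊢; exact ih h
    · simp [hl] at h

theorem eq_letter_of_wordLength {w : List Syllable} (h : IsReducedWord w)
    (h0 : vCount w = 0) (h1 : wordLength w = 1) : ∃ c : Letter, w = [(c.1, (c.2 : ℤ), 0)] := by
  rcases w with _ | ⟨⟨i, k, l⟩, t⟩
  · simp at h1
  · have h2 := isReducedWord_cons.1 h
    have hl : l = 0 := by
      by_contra hl; simp [hl] at h0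
    subst hl
    have hk : k ≠ 0 := by simpa using h2.2.1
    simp only [wordLength_cons, Int.natAbs_zero, add_zero] at h1
    have ht := eq_nil_of_wordLength h2.2.2 (by omega)
    subst ht
    have : k = 1 ∨ k = -1 := by simp at h1; omega
    rcases this with rfl | rfl
    · exact ⟨(i, 1), by simp⟩
    · exact ⟨(i, -1), by simp⟩

/-- The words with one power `v_i^l` and one further letter. -/
theorem eq_of_vLength_add_one {w : List Syllable} (h : IsReducedWord w) (h0 : vCount w = 1)
    (h1 : vLength w + 1 = wordLength w) :
    ∃ (i : Fin 2) (l : ℤ) (c : Letter), l ≠ 0 ∧ l.natAbs = vLength w ∧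
      ((c.1 = i ∧ w = [(i, (c.2 : ℤ), l)]) ∨ (c.1 ≠ i ∧ w = [(c.1, (c.2 : ℤ), 0), (i, 0, l)]) ∨
        (c.1 ≠ i ∧ w = [(i, 0, l), (c.1, (c.2 : ℤ), 0)])) := by
  obtain ⟨x, i, k, l, y, rfl, hx, hy, hl⟩ := exists_eq_of_vCount_eq_one h0
  simp only [vLength_append, vLength_cons, vLength_eq_zero hx, vLength_eq_zero hy,
    wordLength_append, wordLength_cons] at h1 ⊢
  obtain ⟨h2, h3, h4⟩ := isReducedWord_append.1 h
  obtain ⟨h5, h6, h7⟩ := isReducedWord_cons.1 h3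
  have hcase : (wordLength x = 0 ∧ wordLength y = 0 ∧ k.natAbs = 1) ∨
    (wordLength x = 1 ∧ wordLength y = 0 ∧ k = 0) ∨ (wordLength x = 0 ∧ wordLength y = 1 ∧ k = 0) := by
    omega
  rcases hcase with ⟨e1, e2, e3⟩ | ⟨e1, e2, rfl⟩ | ⟨e1, e2, rfl⟩
  · have := eq_nil_of_wordLength h2 e1; subst this
    have := eq_nil_of_wordLength h7 e2; subst this
    have : k = 1 ∨ k = -1 := by omega
    rcases this with rfl | rfl
    · exact ⟨i, l, (i, 1), hl, by simp, Or.inl ⟨rfl, by simp⟩⟩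
    · exact ⟨i, l, (i, -1), hl, by simp, Or.inl ⟨rfl, by simp⟩⟩
  · have := eq_nil_of_wordLength h7 e2; subst this
    obtain ⟨c, rfl⟩ := eq_letter_of_wordLength h2 hx e1
    exact ⟨i, l, c, hl, by simp, Or.inr (Or.inl ⟨by simpa using h4, by simp⟩)⟩
  · have := eq_nil_of_wordLength h2 e1; subst this
    obtain ⟨c, rfl⟩ := eq_letter_of_wordLength h7 hy e2
    exact ⟨i, l, c, hl, by simp, Or.inr (Or.inr ⟨by simpa [eq_comm] using h5, by simp⟩)⟩

theorem eq_of_vLength_eq {w : List Syllable} (h : IsReducedWord w) (h0 : vCount w = 1)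
    (h1 : vLength w = wordLength w) :
    ∃ (i : Fin 2) (l : ℤ), l ≠ 0 ∧ l.natAbs = vLength w ∧ w = [(i, 0, l)] := by
  obtain ⟨x, i, k, l, y, rfl, hx, hy, hl⟩ := exists_eq_of_vCount_eq_one h0
  simp only [vLength_append, vLength_cons, vLength_eq_zero hx, vLength_eq_zero hy,
    wordLength_append, wordLength_cons] at h1 ⊢
  obtain ⟨h2, h3, h4⟩ := isReducedWord_append.1 h
  obtain ⟨h5, h6, h7⟩ := isReducedWord_cons.1 h3
  have := eq_nil_of_wordLength h2 (by omega); subst this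
  have := eq_nil_of_wordLength h7 (by omega); subst this
  have : k = 0 := by omega
  subst this
  exact ⟨i, l, hl, by simp, by simp⟩

theorem vLength_le_wordLength (w : List Syllable) : vLength w ≤ wordLength w := by
  induction w with
  | nil => rfl
  | cons s t ih => simp; omega

theorem one_sub_ne (i : Fin 2) : 1 - i ≠ i := by fin_cases i <;> decide

theorem eq_one_sub {i j : Fin 2} (h : i ≠ j) : i = 1 - j := by
  fin_cases i <;> fin_cases j <;> simp at *

end Lists

theorem left_descent_iff {c : Letter} {w : RWord} :
    RWord.len (leftAction.act c w) < w.len ↔ IsLeftDescent c w.1 := by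
  rcases wordLength_lmul w.2 c with h | h
  · exact ⟨fun _ => h.1, fun _ => by change wordLength _ < wordLength _; simp only [leftAction]; omega⟩
  · refine ⟨fun h' => ?_, fun h' => absurd h' h.1⟩
    change wordLength _ < wordLength _ at h'; simp only [leftAction] at h'; omega

theorem right_descent_iff {d : ℂ} (hd : ‖d‖ = 1) {c : Letter} {w : RWord} :
    RWord.len ((rightAction d hd).act c w) < w.len ↔ IsLeftDescent c w.1.reverse := by
  have e : RWord.len ((rightAction d hd).act c w) = wordLength (lmul c w.1.reverse) := by
    simp [RWord.len, rightAction, rmul]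
  have e2 : w.len = wordLength w.1.reverse := by simp [RWord.len]
  rw [e, e2]
  rcases wordLength_lmul w.2.reverse c with h | h
  · exact ⟨fun _ => h.1, fun _ => by omega⟩
  · exact ⟨fun h' => by omega, fun h' => absurd h' h.1⟩

/-- The reduced words of a given type and length. -/
def typeSet (j l : ℕ) : Set RWord := {w | w.len = l ∧ min (vCount w.1) 2 = j}

theorem mem_typeSet {j l : ℕ} {w : RWord} :
    w ∈ typeSet j l ↔ w.len = l ∧ min (vCount w.1) 2 = j := Iff.rfl

theorem mem_wordsOfType {j l : ℕ} {w : List Syllable} :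
    w ∈ wordsOfType j l ↔ IsReducedWord w ∧ wordLength w = l ∧ min (vCount w) 2 = j := by
  simp [wordsOfType, words, and_assoc]

theorem finite_len (l : ℕ) : {w : RWord | w.len = l}.Finite := by
  refine Set.Finite.of_injOn (f := Subtype.val) (t := {w | IsReducedWord w ∧ wordLength w = l})
    (fun w hw => ⟨w.2, hw⟩) Subtype.val_injective.injOn (finite_reducedWords l)

theorem finite_typeSet (j l : ℕ) : (typeSet j l).Finite :=
  (finite_len l).subset fun _ hw => hw.1

/-- The trivial word. -/
def RWord.nil : RWord := ⟨[], isReducedWord_nil⟩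

/-! ### The span of the words as a model for multiplication by χ₁ -/

section Model

variable {H : Type*} [NormedAddCommGroup H] [InnerProductSpace ℂ H] [CompleteSpace H]
variable {u v : Fin 2 → unitary (H →L[ℂ] H)} {Ω : H}

variable (u v Ω) in
/-- The span of the words in `L²`. -/
abbrev wordSpan : Submodule ℂ H := Submodule.span ℂ (Set.range fun w : RWord => wordOp u v w.1 Ω)

variable (hON : Orthonormal ℂ fun w : RWord => wordOp u v w.1 Ω)

/-- The words as a basis of their span. -/
def wordBasis : Module.Basis RWord ℂ (wordSpan u v Ω) := Module.Basis.span hON.linearIndependent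

theorem coe_wordBasis (w : RWord) : (wordBasis hON w : H) = wordOp u v w.1 Ω := by
  rw [wordBasis, Module.Basis.span_apply]

theorem orthonormal_wordBasis : Orthonormal ℂ (wordBasis hON) := by
  have : Orthonormal ℂ ((wordSpan u v Ω).subtypeₗᵢ ∘ wordBasis hON) := by
    convert hON using 1
    ext w; exact coe_wordBasis hON w
  exact (LinearIsometry.orthonormal_comp_iff _).1 this

/-- The operator corresponding to a linear combination of words. -/
def toOp : wordSpan u v Ω →ₗ[ℂ] (H →L[ℂ] H) :=
  (wordBasis hON).constr ℂ fun w => wordOp u v w.1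

theorem toOp_basis (w : RWord) : toOp hON (wordBasis hON w) = wordOp u v w.1 := by
  simp [toOp]

theorem toOp_apply (x : wordSpan u v Ω) : toOp hON x Ω = x := by
  have : toL2 Ω ∘ₗ toOp hON = (wordSpan u v Ω).subtype := by
    refine (wordBasis hON).ext fun w => ?_
    rw [LinearMap.comp_apply, toOp_basis]
    exact (coe_wordBasis hON w).symm
  exact LinearMap.congr_fun this x

theorem map_wspan (T : Set RWord) : (wspan (wordBasis hON) T).map (toOp hON) =
    Submodule.span ℂ ((fun w : RWord => wordOp u v w.1) '' T) := by
  rw [wspan, Submodule.map_span, Set.image_image]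
  simp only [toOp_basis]

theorem W_eq_map (j l : ℕ) : W u v j l = (wspan (wordBasis hON) (typeSet j l)).map (toOp hON) := by
  rw [map_wspan, W]
  congr 1
  ext x
  constructor
  · rintro ⟨w, hw, rfl⟩
    have := mem_wordsOfType.1 (Finset.mem_coe.1 hw)
    exact ⟨⟨w, this.1⟩, this.2, rfl⟩
  · rintro ⟨w, hw, rfl⟩
    exact ⟨w.1, Finset.mem_coe.2 (mem_wordsOfType.2 ⟨w.2, hw⟩), rfl⟩

/-- The sum of the words of length `r` in the letters `u_i^{±1}` as a vector. -/
def chiVec (r : ℕ) : wordSpan u v Ω := setVec (wordBasis hON) (finite_typeSet 0 r)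

theorem toOp_chiVec (r : ℕ) : toOp hON (chiVec hON r) = chi u v r := by
  rw [chiVec, setVec, map_sum, chi]
  simp only [toOp_basis]
  refine Finset.sum_bij (fun w _ => w.1) (fun w hw => ?_) (fun w _ w' _ h => RWord.ext h)
    (fun w hw => ?_) (fun w _ => rfl)
  · exact mem_wordsOfType.2 ⟨w.2, (finite_typeSet 0 r).mem_toFinset.1 hw⟩
  · have := mem_wordsOfType.1 hw
    exact ⟨⟨w, this.1⟩, (Set.Finite.mem_toFinset _).2 this.2, rfl⟩

/-- Tested against a word w by adjointness: the unique shortening of w has no v-syllable iff w has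
none, and a non-trivial word without shortening contains some v_i. -/
theorem up_chiVec (r : ℕ) :
    leftAction.up (wordBasis hON) (chiVec hON r) = chiVec hON (r + 1) := by
  classical
  refine ext_inner_basis (b := wordBasis hON) fun w => ?_
  rw [LetterAction.inner_up_right _ (orthonormal_wordBasis hON), chiVec, chiVec, inner_setVec
    (orthonormal_wordBasis hON)]
  by_cases h : ∃ c, RWord.len (leftAction.act c w) < RWord.len w
  · obtain ⟨c, hc⟩ := h
    rw [leftAction.dn_basis_of_descent _ hc, inner_smul_left, inner_setVec
      (orthonormal_wordBasis hON)]
    have e : leftAction.act c w ∈ typeSet 0 r ↔ w ∈ typeSet 0 (r + 1) := by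
      rw [leftAction.lt_len_iff] at hc
      simp only [mem_typeSet, ← hc, Nat.add_right_cancel_iff]
      rw [show vCount (leftAction.act c w).1 = vCount w.1 from vCount_lmul c]
    simp only [e, show leftAction.wt c w = 1 from rfl, map_one, one_mul]
  · rw [leftAction.dn_basis_of_root _ h, inner_zero_left, if_neg]
    rintro ⟨h1, h2⟩
    have h3 : w.1 ≠ [] := by
      intro h3; simp [RWord.len, h3] at h1
    obtain ⟨c, hc⟩ := exists_descent_of_vCount_eq_zero w.2 (by omega) h3
    exact h ⟨c, left_descent_iff.2 hc⟩

theorem chiVec_zero : chiVec hON 0 = wordBasis hON RWord.nil := by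
  have : (finite_typeSet 0 0).toFinset = {RWord.nil} := by
    ext w
    simp only [Set.Finite.mem_toFinset, mem_typeSet, Finset.mem_singleton]
    constructor
    · rintro ⟨h1, -⟩
      exact RWord.ext (eq_nil_of_wordLength w.2 h1)
    · rintro rfl
      exact ⟨rfl, rfl⟩
  rw [chiVec, setVec, this, Finset.sum_singleton]

include hON in
theorem chi_zero : chi u v 0 = 1 := by
  rw [← toOp_chiVec hON, chiVec_zero, toOp_basis]; rfl

theorem nil_up (c : Letter) : RWord.len RWord.nil < RWord.len (leftAction.act c RWord.nil) := by
  rw [← leftAction.not_lt_iff]; exact Nat.not_lt_zero _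

include hON in
theorem chi_one : chi u v 1 = ∑ c : Letter, uPow u c.1 c.2 := by
  rw [← toOp_chiVec hON, ← up_chiVec, chiVec_zero, LetterAction.up_basis, map_sum]
  refine Finset.sum_congr rfl fun c _ => ?_
  rw [if_pos (nil_up c), map_smul, toOp_basis]
  simp [leftAction, RWord.nil, wordOp_lmul]

theorem sum_letters {M : Type*} [AddCommMonoid M] (f : Fin 2 → ℤ → M) :
    ∑ c : Letter, f c.1 c.2 = (f 0 1 + f 0 (-1)) + (f 1 1 + f 1 (-1)) := by
  rw [Fintype.sum_prod_type, Fin.sum_univ_two]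
  have h : (Finset.univ : Finset ℤˣ) = {1, -1} := rfl
  have h1 : (1 : ℤˣ) ≠ -1 := by decide
  simp [h, Finset.sum_pair h1]

include hON in
theorem chi_one_eq : chi u v 1 = uPlus u 0 + uPlus u 1 := by
  rw [chi_one hON, sum_letters fun i k => uPow u i k]; rfl

theorem toOp_left_total (x : wordSpan u v Ω) :
    toOp hON (leftAction.total (wordBasis hON) x) = chi u v 1 * toOp hON x := by
  have : toOp hON ∘ₗ leftAction.total (wordBasis hON) =
      LinearMap.mulLeft ℂ (chi u v 1) ∘ₗ toOp hON := by
    refine (wordBasis hON).ext fun w => ?_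
    rw [LinearMap.comp_apply, LetterAction.total_basis, map_sum, LinearMap.comp_apply,
      LinearMap.mulLeft_apply, toOp_basis, chi_one hON, Finset.sum_mul]
    refine Finset.sum_congr rfl fun c _ => ?_
    rw [map_smul, toOp_basis]
    simp [leftAction, wordOp_lmul]
  exact LinearMap.congr_fun this x

variable {d : ℂ} (hd : ‖d‖ = 1)
variable (huv : ∀ i, (u i : H →L[ℂ] H) * (v i : H →L[ℂ] H) =
      d • ((v i : H →L[ℂ] H) * (u i : H →L[ℂ] H)))

include huv in
theorem toOp_right_total (x : wordSpan u v Ω) :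
    toOp hON ((rightAction d hd).total (wordBasis hON) x) = toOp hON x * chi u v 1 := by
  have : toOp hON ∘ₗ (rightAction d hd).total (wordBasis hON) =
      LinearMap.mulRight ℂ (chi u v 1) ∘ₗ toOp hON := by
    refine (wordBasis hON).ext fun w => ?_
    rw [LinearMap.comp_apply, LetterAction.total_basis, map_sum, LinearMap.comp_apply,
      LinearMap.mulRight_apply, toOp_basis, chi_one hON, Finset.mul_sum]
    refine Finset.sum_congr rfl fun c _ => ?_
    rw [map_smul, toOp_basis, wordOp_mul_uPow hd huv]
    rfl
  exact LinearMap.congr_fun this x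

theorem dn_chiVec_one :
    leftAction.dn (wordBasis hON) (chiVec hON 1) = (4 : ℂ) • chiVec hON 0 := by
  rw [← up_chiVec, LetterAction.dn_up, chiVec_zero, LetterAction.root_basis, if_neg]
  · module
  · rintro ⟨c, hc⟩; exact Nat.not_lt_zero _ hc

theorem dn_chiVec_succ (r : ℕ) :
    leftAction.dn (wordBasis hON) (chiVec hON (r + 2)) = (3 : ℂ) • chiVec hON (r + 1) := by
  rw [← up_chiVec, LetterAction.dn_up, ← up_chiVec, LetterAction.root_up, add_zero]

theorem chi_one_mul_chi (r : ℕ) : chi u v 1 * chi u v r =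
    chi u v (r + 1) + toOp hON (leftAction.dn (wordBasis hON) (chiVec hON r)) := by
  rw [← toOp_chiVec hON r, ← toOp_left_total, LetterAction.total_apply, up_chiVec, map_add,
    toOp_chiVec]

include hON in
-- The 4 counts the products of a letter with its inverse. For longer spheres, in `chi_add_three`,
-- each shorter word arises by cancellation in three ways only.
theorem chi_two : chi u v 2 = chi u v 1 * chi u v 1 - (4 : ℂ) • 1 := by
  rw [chi_one_mul_chi hON, dn_chiVec_one, map_smul, toOp_chiVec, chi_zero hON]
  abel

include hON in
theorem chi_add_three (r : ℕ) : chi u v (r + 3) = chi u v 1 * chi u v (r + 2) -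
    (3 : ℂ) • chi u v (r + 1) := by
  rw [chi_one_mul_chi hON, dn_chiVec_succ, map_smul, toOp_chiVec]
  abel

include hON in
-- For right multiplication the recursion for χ_r is needed with χ₁ on the other side.
theorem chi_one_comm (r : ℕ) : Commute (chi u v 1) (chi u v r) := by
  induction r using Nat.strong_induction_on with
  | _ r ih =>
    match r, ih with
    | 0, _ => rw [chi_zero hON]; exact Commute.one_right _
    | 1, _ => exact Commute.refl _
    | 2, _ =>
      rw [chi_two hON]
      exact ((Commute.refl _).mul_right (Commute.refl _)).sub_right
        ((Commute.one_right _).smul_right _)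
    | r + 3, ih =>
      rw [chi_add_three hON]
      exact ((Commute.refl _).mul_right (ih _ (by omega))).sub_right
        ((ih _ (by omega)).smul_right _)

theorem toOp_left_sphere (r : ℕ) (x : wordSpan u v Ω) :
    toOp hON (leftAction.sphere (wordBasis hON) r x) = chi u v r * toOp hON x := by
  induction r using Nat.strong_induction_on with
  | _ r ih =>
    match r, ih with
    | 0, _ => simp [chi_zero hON, LetterAction.sphere]
    | 1, _ => exact toOp_left_total hON x
    | 2, _ =>
      simp [chi_two hON, LetterAction.sphere, toOp_left_total, sub_mul, mul_assoc]
    | r + 3, ih =>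
      rw [chi_add_three hON, sub_mul, mul_assoc, smul_mul_assoc, ← ih (r + 2) (by omega),
        ← ih (r + 1) (by omega), ← toOp_left_total, ← map_smul, ← map_sub]
      rfl

include huv in
theorem toOp_right_sphere (r : ℕ) (x : wordSpan u v Ω) :
    toOp hON ((rightAction d hd).sphere (wordBasis hON) r x) = toOp hON x * chi u v r := by
  induction r using Nat.strong_induction_on with
  | _ r ih =>
    match r, ih with
    | 0, _ => simp [chi_zero hON, LetterAction.sphere]
    | 1, _ => exact toOp_right_total hON hd huv x
    | 2, _ =>
      simp [chi_two hON, LetterAction.sphere, toOp_right_total hON hd huv, mul_sub, mul_assoc]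
    | r + 3, ih =>
      rw [chi_add_three hON, (chi_one_comm hON (r + 2)).eq, mul_sub, ← mul_assoc, mul_smul_comm,
        ← ih (r + 2) (by omega),
        ← ih (r + 1) (by omega), ← toOp_right_total hON hd huv, ← map_smul, ← map_sub]
      rfl

/-! ### The projections `q_l` -/

theorem WL2_eq_map (l : ℕ) : WL2 u v Ω l =
    (wspan (wordBasis hON) {w | w.len = l}).map (wordSpan u v Ω).subtype := by
  rw [wspan, Submodule.map_span, Set.image_image, WL2]
  congr 1
  ext x
  constructor
  · rintro ⟨w, hw, rfl⟩
    have : IsReducedWord w ∧ wordLength w = l := by simpa [words] using hw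
    exact ⟨⟨w, this.1⟩, this.2, coe_wordBasis hON _⟩
  · rintro ⟨w, hw, rfl⟩
    refine ⟨w.1, ?_, (coe_wordBasis hON _).symm⟩
    simpa [words] using ⟨w.2, hw⟩

theorem q_of_mem {l : ℕ} {x : wordSpan u v Ω} (hx : x ∈ wspan (wordBasis hON) {w | w.len = l}) :
    q u v Ω l x = x := by
  rw [q, Submodule.starProjection_eq_self_iff, WL2_eq_map hON]
  exact ⟨x, hx, rfl⟩

theorem q_of_mem_ne {l : ℕ} {x : wordSpan u v Ω}
    (hx : x ∈ wspan (wordBasis hON) {w | w.len ≠ l}) : q u v Ω l x = 0 := by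
  rw [q, Submodule.starProjection_apply_eq_zero_iff, WL2_eq_map hON, Submodule.mem_orthogonal]
  rintro _ ⟨y, hy, rfl⟩
  refine inner_eq_zero_of_disjoint (orthonormal_wordBasis hON) ?_ hy hx
  rw [Set.disjoint_left]
  intro w h1 h2
  exact h2 h1

theorem q_of_mem_lt {l : ℕ} {x : wordSpan u v Ω}
    (hx : x ∈ wspan (wordBasis hON) {w | w.len < l}) : q u v Ω l x = 0 :=
  q_of_mem_ne hON (wspan_mono (fun _ hw => (ne_of_lt hw)) hx)

include huv in
/-- The vector `x_{r,s}` is obtained by applying the lengthening operators. -/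
theorem shift_toOp {l : ℕ} {x : wordSpan u v Ω}
    (hx : x ∈ wspan (wordBasis hON) {w | w.len = l}) (r s : ℕ) :
    shift u v Ω l (toOp hON x) r s =
      ((leftAction.up (wordBasis hON) ^ r)
        (((rightAction d hd).up (wordBasis hON) ^ s) x) : wordSpan u v Ω) := by
  rw [(compatible d hd).up_pow_up_pow]
  set y := (leftAction.up (wordBasis hON) ^ r) x with hy
  have hyl : y ∈ wspan (wordBasis hON) {w | w.len = l + r} := leftAction.up_pow_mem_len hx r
  set x' := leftAction.sphere (wordBasis hON) r x with hx'
  -- The error of the left multiplication is shorter than l + r, remains shorter than l + r + s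
  -- after multiplication by χ_s, and is annihilated by the projection.
  have h1 : x' - y ∈ wspan (wordBasis hON) {w | w.len < l + r} := leftAction.sphere_sub_mem r hx
  have h2 := (rightAction d hd).sphere_mem_len_lt s h1
  have h3 := (rightAction d hd).sphere_sub_mem s hyl
  have h4 := add_mem h2 h3
  rw [map_sub, sub_add_sub_cancel] at h4
  have h5 := q_of_mem_lt hON h4
  rw [shift, ← toOp_left_sphere, ← toOp_right_sphere hON hd huv, toOp_apply]
  rw [← q_of_mem hON ((rightAction d hd).up_pow_mem_len hyl s)]
  rw [Submodule.coe_sub, map_sub, sub_eq_zero] at h5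
  exact h5

end Model

/-! ### Vectors killed by both shortening operators -/

section Kinds

variable {H : Type*} [NormedAddCommGroup H] [InnerProductSpace ℂ H] [CompleteSpace H]
variable {u v : Fin 2 → unitary (H →L[ℂ] H)} {Ω : H}
variable (hON : Orthonormal ℂ fun w : RWord => wordOp u v w.1 Ω)
variable {d : ℂ} (hd : ‖d‖ = 1)
variable (huv : ∀ i, (u i : H →L[ℂ] H) * (v i : H →L[ℂ] H) =
      d • ((v i : H →L[ℂ] H) * (u i : H →L[ℂ] H)))

/-- The vectors annihilated by both shortening operators. -/
def dnKer : Submodule ℂ (wordSpan u v Ω) :=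
  LinearMap.ker (leftAction.dn (wordBasis hON)) ⊓
    LinearMap.ker ((rightAction d hd).dn (wordBasis hON))

theorem mem_dnKer {x : wordSpan u v Ω} : x ∈ dnKer hON hd ↔
    leftAction.dn (wordBasis hON) x = 0 ∧ (rightAction d hd).dn (wordBasis hON) x = 0 := Iff.rfl

/-- The vectors supported on generic words and annihilated by both shortening operators. -/
abbrev prim : Submodule ℂ (wordSpan u v Ω) :=
  LetterAction.primitive leftAction (rightAction d hd) (wordBasis hON) {w | IsGeneric w.1}

theorem vCount_left (c : Letter) (w : RWord) : vCount (leftAction.act c w).1 = vCount w.1 :=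
  vCount_lmul c

theorem vCount_right (c : Letter) (w : RWord) :
    vCount ((rightAction d hd).act c w).1 = vCount w.1 := by
  simp [rightAction, rmul, vCount_lmul]

theorem vLength_left (c : Letter) (w : RWord) : vLength (leftAction.act c w).1 = vLength w.1 :=
  vLength_lmul c

theorem vLength_right (c : Letter) (w : RWord) :
    vLength ((rightAction d hd).act c w).1 = vLength w.1 := by
  simp [rightAction, rmul, vLength_lmul]

/-- The combinations of words of length `l` whose numbers of `v`-syllables and of letters
`v_i^{±1}` satisfy `p`. -/
def gradedSpan (p : ℕ → ℕ → Prop) (l : ℕ) : Submodule ℂ (wordSpan u v Ω) :=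
  wspan (wordBasis hON) {w | w.len = l ∧ p (vCount w.1) (vLength w.1)}

variable {p : ℕ → ℕ → Prop} {l : ℕ}

theorem left_up_mem_gradedSpan {x : wordSpan u v Ω} (hx : x ∈ gradedSpan hON p l) :
    leftAction.up (wordBasis hON) x ∈ gradedSpan hON p (l + 1) :=
  leftAction.up_mem_wspan (fun w hw c h => by
    rw [leftAction.len_lt_iff] at h
    exact ⟨by rw [h, hw.1], by rw [vCount_left, vLength_left]; exact hw.2⟩) hx

theorem right_up_mem_gradedSpan {x : wordSpan u v Ω} (hx : x ∈ gradedSpan hON p l) :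
    (rightAction d hd).up (wordBasis hON) x ∈ gradedSpan hON p (l + 1) :=
  (rightAction d hd).up_mem_wspan (fun w hw c h => by
    rw [(rightAction d hd).len_lt_iff] at h
    exact ⟨by rw [h, hw.1], by rw [vCount_right, vLength_right]; exact hw.2⟩) hx

theorem left_dn_mem_gradedSpan {x : wordSpan u v Ω} (hx : x ∈ gradedSpan hON p (l + 1)) :
    leftAction.dn (wordBasis hON) x ∈ gradedSpan hON p l :=
  leftAction.dn_mem_wspan (fun w hw c h => by
    rw [leftAction.lt_len_iff, hw.1] at h
    exact ⟨by simpa using h, by rw [vCount_left, vLength_left]; exact hw.2⟩) hx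

theorem right_dn_mem_gradedSpan {x : wordSpan u v Ω} (hx : x ∈ gradedSpan hON p (l + 1)) :
    (rightAction d hd).dn (wordBasis hON) x ∈ gradedSpan hON p l :=
  (rightAction d hd).dn_mem_wspan (fun w hw c h => by
    rw [(rightAction d hd).lt_len_iff, hw.1] at h
    exact ⟨by simpa using h, by rw [vCount_right, vLength_right]; exact hw.2⟩) hx

theorem gradedSpan_le_len : gradedSpan hON p l ≤ wspan (wordBasis hON) {w | w.len = l} :=
  wspan_mono fun _ hw => hw.1

instance : FiniteDimensional ℂ (gradedSpan hON p l) :=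
  FiniteDimensional.span_of_finite ℂ
    (((finite_len l).subset fun _ hw => hw.1).image _)

/-- Every homogeneous vector is the sum of an element of `dnKer` and of lengthened vectors. -/
theorem exists_decomposition {x : wordSpan u v Ω} (hx : x ∈ gradedSpan hON p (l + 1)) :
    ∃ y ∈ gradedSpan hON p l, ∃ z ∈ gradedSpan hON p l, ∃ ξ ∈ gradedSpan hON p (l + 1),
      ξ ∈ dnKer hON hd ∧ x = leftAction.up (wordBasis hON) y +
        (rightAction d hd).up (wordBasis hON) z + ξ := by
  set A := leftAction.up (wordBasis hON)
  set B := (rightAction d hd).up (wordBasis hON)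
  set K : Submodule ℂ (wordSpan u v Ω) :=
    (gradedSpan hON p l).map A ⊔ (gradedSpan hON p l).map B with hK
  have hb := orthonormal_wordBasis hON
  have hle : K ≤ gradedSpan hON p (l + 1) := by
    refine sup_le ?_ ?_
    · rintro _ ⟨y, hy, rfl⟩; exact left_up_mem_gradedSpan hON hy
    · rintro _ ⟨y, hy, rfl⟩; exact right_up_mem_gradedSpan hON hd hy
  have h1 : K.starProjection x ∈ K := K.starProjection_apply_mem x
  have h2 : x - K.starProjection x ∈ Kᗮ := K.sub_starProjection_mem_orthogonal x
  have h3 : x - K.starProjection x ∈ gradedSpan hON p (l + 1) := sub_mem hx (hle h1)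
  obtain ⟨_, ⟨y, hy, rfl⟩, _, ⟨z, hz, rfl⟩, h4⟩ := Submodule.mem_sup.1 h1
  refine ⟨y, hy, z, hz, x - K.starProjection x, h3, (mem_dnKer hON hd).2 ⟨?_, ?_⟩, ?_⟩
  -- The squared norm of the shortened remainder is its inner product with a lengthened vector, to
  -- which the remainder is orthogonal by construction.
  · rw [← inner_self_eq_zero (𝕜 := ℂ), ← LetterAction.inner_up_left _ hb]
    exact Submodule.inner_right_of_mem_orthogonal (Submodule.mem_sup_left
      (Submodule.mem_map_of_mem (left_dn_mem_gradedSpan hON h3))) h2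
  · rw [← inner_self_eq_zero (𝕜 := ℂ), ← LetterAction.inner_up_left _ hb]
    exact Submodule.inner_right_of_mem_orthogonal (Submodule.mem_sup_right
      (Submodule.mem_map_of_mem (right_dn_mem_gradedSpan hON hd h3))) h2
  · rw [h4]; abel

theorem wspan_typeSet (j l : ℕ) : wspan (wordBasis hON) (typeSet j l) =
    gradedSpan hON (fun a _ => min a 2 = j) l := rfl

include huv in
/-- A vector of `W_l^j` is orthogonal to `S_l^j` iff it lies in `dnKer`. -/
theorem mem_S_orthogonal_iff {j l : ℕ} {x : wordSpan u v Ω}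
    (hx : x ∈ gradedSpan hON (fun a _ => min a 2 = j) l) :
    (x : H) ∈ (S u v Ω j l)ᗮ ↔ x ∈ dnKer hON hd := by
  have hb := orthonormal_wordBasis hON
  -- A product with χ₁ has length at most k + 1, so only k = l - 1 contributes: S_l^j is spanned by
  -- the left and right lengthenings of W_{l-1}^j.
  have hq : ∀ k y, k < l → y ∈ gradedSpan hON (fun a _ => min a 2 = j) k →
      (q u v Ω l (leftAction.total (wordBasis hON) y : wordSpan u v Ω) =
        if k + 1 = l then (leftAction.up (wordBasis hON) y : H) else 0) ∧
      (q u v Ω l ((rightAction d hd).total (wordBasis hON) y : wordSpan u v Ω) =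
        if k + 1 = l then ((rightAction d hd).up (wordBasis hON) y : H) else 0) := by
    intro k y hk hy
    have hy' := gradedSpan_le_len hON hy
    have key : ∀ α : LetterAction RWord.len, (q u v Ω l (α.total (wordBasis hON) y :
        wordSpan u v Ω) = if k + 1 = l then (α.up (wordBasis hON) y : H) else 0) := by
      intro α
      have hdn : q u v Ω l (α.dn (wordBasis hON) y : wordSpan u v Ω) = 0 :=
        q_of_mem_lt hON (wspan_mono (fun w hw => lt_trans hw hk) (α.dn_mem_len hy'))
      rw [LetterAction.total_apply, Submodule.coe_add, map_add, hdn, add_zero]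
      split_ifs with h
      · exact q_of_mem hON (h ▸ α.up_mem_len hy')
      · refine q_of_mem_lt hON (wspan_mono (fun w hw => ?_) (α.up_mem_len hy'))
        simp only [Set.mem_ofPred_eq] at hw ⊢; omega
    exact ⟨key _, key _⟩
  have hW : ∀ k w, w ∈ W u v j k ↔ ∃ y ∈ gradedSpan hON (fun a _ => min a 2 = j) k,
      toOp hON y = w := by
    intro k w
    rw [W_eq_map hON, wspan_typeSet, Submodule.mem_map]
  constructor
  · intro h
    rcases l with _ | l
    · have h0 : ∀ α : LetterAction RWord.len, α.dn (wordBasis hON) x = 0 := by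
        intro α
        have := α.dn_mem_len (gradedSpan_le_len hON hx)
        rw [wspan, show {x : RWord | x.len < 0} = ∅ from
          Set.eq_empty_of_forall_notMem fun w hw => Nat.not_lt_zero _ hw] at this
        simpa using this
      exact (mem_dnKer hON hd).2 ⟨h0 _, h0 _⟩
    · refine (mem_dnKer hON hd).2 ⟨?_, ?_⟩
      · rw [← inner_self_eq_zero (𝕜 := ℂ), ← LetterAction.inner_up_left _ hb]
        have hy := left_dn_mem_gradedSpan hON hx
        refine Submodule.inner_right_of_mem_orthogonal (K := S u v Ω j (l + 1)) ?_ h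
        refine Submodule.subset_span ⟨l, Nat.lt_succ_self l, _, (hW l _).2 ⟨_, hy, rfl⟩, Or.inl ?_⟩
        rw [← toOp_left_total, toOp_apply, (hq l _ (Nat.lt_succ_self l) hy).1, if_pos rfl]
        rfl
      · rw [← inner_self_eq_zero (𝕜 := ℂ), ← LetterAction.inner_up_left _ hb]
        have hy := right_dn_mem_gradedSpan hON hd hx
        refine Submodule.inner_right_of_mem_orthogonal (K := S u v Ω j (l + 1)) ?_ h
        refine Submodule.subset_span ⟨l, Nat.lt_succ_self l, _, (hW l _).2 ⟨_, hy, rfl⟩, Or.inr ?_⟩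
        rw [← toOp_right_total hON hd huv, toOp_apply, (hq l _ (Nat.lt_succ_self l) hy).2,
          if_pos rfl]
        rfl
  · intro h
    obtain ⟨h1, h2⟩ := (mem_dnKer hON hd).1 h
    have : S u v Ω j l ≤ (Submodule.span ℂ {(x : H)})ᗮ := by
      refine Submodule.span_le.2 ?_
      rintro ξ ⟨k, hk, w, hw, hξ⟩
      change ξ ∈ (Submodule.span ℂ {(x : H)})ᗮ
      obtain ⟨y, hy, rfl⟩ := (hW k w).1 hw
      rw [Submodule.mem_orthogonal_singleton_iff_inner_right]
      rw [← toOp_left_total, ← toOp_right_total hON hd huv, toOp_apply, toOp_apply,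
        (hq k y hk hy).1, (hq k y hk hy).2] at hξ
      split_ifs at hξ with h3
      · rcases hξ with rfl | rfl
        · change ⟪x, leftAction.up (wordBasis hON) y⟫_ℂ = 0
          rw [LetterAction.inner_up_right _ hb, h1, inner_zero_left]
        · change ⟪x, (rightAction d hd).up (wordBasis hON) y⟫_ℂ = 0
          rw [LetterAction.inner_up_right _ hb, h2, inner_zero_left]
      · rcases hξ with rfl | rfl <;> simp
    rw [Submodule.mem_orthogonal]
    intro ξ hξ
    exact (Submodule.mem_orthogonal_singleton_iff_inner_left).1 (this hξ)

/-! ### Special words -/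

theorem isReducedWord_letter_syl {c : Letter} {i : Fin 2} {l : ℤ} (hl : l ≠ 0) (hc : c.1 ≠ i) :
    IsReducedWord [(c.1, (c.2 : ℤ), 0), (i, 0, l)] := by
  rcases unit_cases c.2 with h | h <;> simp [isReducedWord_cons, isReducedWord_nil, hl, hc, h]

theorem isReducedWord_syl_letter {c : Letter} {i : Fin 2} {l : ℤ} (hl : l ≠ 0) (hc : c.1 ≠ i) :
    IsReducedWord [(i, 0, l), (c.1, (c.2 : ℤ), 0)] := by
  rcases unit_cases c.2 with h | h <;> simp [isReducedWord_cons, isReducedWord_nil, hl, hc.symm, h]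

end Kinds

/-! ### Powers of v_i with at most one further letter -/

section Special

variable {H : Type*} [NormedAddCommGroup H] [InnerProductSpace ℂ H] [CompleteSpace H]
variable {u v : Fin 2 → unitary (H →L[ℂ] H)} {Ω : H}
variable (hON : Orthonormal ℂ fun w : RWord => wordOp u v w.1 Ω)
variable {d : ℂ} (hd : ‖d‖ = 1)
variable (huv : ∀ i, (u i : H →L[ℂ] H) * (v i : H →L[ℂ] H) =
      d • ((v i : H →L[ℂ] H) * (u i : H →L[ℂ] H)))

open Classical in
/-- A word as a vector; zero if the word is not reduced. -/
def wvec (w : List Syllable) : wordSpan u v Ω :=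
  if h : IsReducedWord w then wordBasis hON ⟨w, h⟩ else 0

theorem wvec_of_reduced {w : List Syllable} (h : IsReducedWord w) :
    wvec hON w = wordBasis hON ⟨w, h⟩ := dif_pos h

theorem toOp_wvec {w : List Syllable} (h : IsReducedWord w) :
    toOp hON (wvec hON w) = wordOp u v w := by rw [wvec_of_reduced hON h, toOp_basis]

theorem toOp_injective : Function.Injective (toOp hON) := by
  intro x y h
  have := congrArg (fun T : H →L[ℂ] H => T Ω) h
  simpa only [toOp_apply, Subtype.coe_inj] using this

theorem wvec_mem {T : Set RWord} {w : List Syllable} (h : ∀ h : IsReducedWord w, ⟨w, h⟩ ∈ T) :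
    wvec hON w ∈ wspan (wordBasis hON) T := by
  unfold wvec
  split_ifs with h1
  · exact basis_mem_wspan (h h1)
  · exact zero_mem _

/-- The vector `v_i ^ m`. -/
def vecV (i : Fin 2) (m : ℤ) : wordSpan u v Ω := wvec hON [(i, 0, m)]
/-- The vector `u_i ^ ε * v_i ^ m`. -/
def vecUV (i : Fin 2) (e : ℤˣ) (m : ℤ) : wordSpan u v Ω := wvec hON [(i, (e : ℤ), m)]
/-- The vector `u_{1-i} ^ ε * v_i ^ m`. -/
def vecL (i : Fin 2) (e : ℤˣ) (m : ℤ) : wordSpan u v Ω := wvec hON [(1 - i, (e : ℤ), 0), (i, 0, m)]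
/-- The vector `v_i ^ m * u_{1-i} ^ ε`. -/
def vecR (i : Fin 2) (e : ℤˣ) (m : ℤ) : wordSpan u v Ω := wvec hON [(i, 0, m), (1 - i, (e : ℤ), 0)]

variable {i : Fin 2} {m : ℤ} (hm : m ≠ 0) (e : ℤˣ)

include hm

theorem isReducedWord_vecV : IsReducedWord [(i, 0, m)] := by
  simp [isReducedWord_singleton, hm]

theorem isReducedWord_vecUV : IsReducedWord [(i, (e : ℤ), m)] := by
  simp [isReducedWord_singleton, hm]

theorem isReducedWord_vecL : IsReducedWord [(1 - i, (e : ℤ), 0), (i, 0, m)] :=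
  isReducedWord_letter_syl (c := (1 - i, e)) hm (one_sub_ne i)

theorem isReducedWord_vecR : IsReducedWord [(i, 0, m), (1 - i, (e : ℤ), 0)] :=
  isReducedWord_syl_letter (c := (1 - i, e)) hm (one_sub_ne i)

theorem toOp_vecV : toOp hON (vecV hON i m) = uPow v i m := by
  rw [vecV, toOp_wvec hON (isReducedWord_vecV hm)]; simp [sylOp]

theorem toOp_vecUV : toOp hON (vecUV hON i e m) = uPow u i e * uPow v i m := by
  rw [vecUV, toOp_wvec hON (isReducedWord_vecUV hm e)]; simp [sylOp]

theorem toOp_vecL : toOp hON (vecL hON i e m) = uPow u (1 - i) e * uPow v i m := by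
  rw [vecL, toOp_wvec hON (isReducedWord_vecL hm e)]; simp [sylOp]

theorem toOp_vecR : toOp hON (vecR hON i e m) = uPow v i m * uPow u (1 - i) e := by
  rw [vecR, toOp_wvec hON (isReducedWord_vecR hm e)]; simp [sylOp]

include hd huv in
theorem toOp_vecUV' : uPow v i m * uPow u i e =
    d ^ (-(m * e)) • toOp hON (vecUV hON i e m) := by
  rw [toOp_vecUV hON hm, uPow_mul_uPow hd huv, smul_smul, ← zpow_add₀ (norm_one_ne_zero hd),
    mul_comm m]
  simp

omit hm in
include hON in
theorem chi_one_eq' (i : Fin 2) : chi u v 1 = uPlus u i + uPlus u (1 - i) := by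
  rw [chi_one_eq hON]
  fin_cases i
  · rfl
  · exact add_comm _ _

theorem left_total_vecV : leftAction.total (wordBasis hON) (vecV hON i m) =
    vecUV hON i 1 m + vecUV hON i (-1) m + (vecL hON i 1 m + vecL hON i (-1) m) := by
  apply toOp_injective hON
  rw [toOp_left_total, toOp_vecV hON hm, chi_one_eq' hON i, map_add, map_add, map_add,
    toOp_vecUV hON hm, toOp_vecUV hON hm, toOp_vecL hON hm, toOp_vecL hON hm, uPlus, uPlus]
  simp [add_mul]

include huv in
theorem right_total_vecV : (rightAction d hd).total (wordBasis hON) (vecV hON i m) =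
    d ^ (-m) • vecUV hON i 1 m + d ^ m • vecUV hON i (-1) m +
      (vecR hON i 1 m + vecR hON i (-1) m) := by
  apply toOp_injective hON
  have h1 := toOp_vecUV' hON hd huv (i := i) hm 1
  have h2 := toOp_vecUV' hON hd huv (i := i) hm (-1)
  simp only [Units.val_one, mul_one, Units.val_neg, mul_neg, neg_neg] at h1 h2
  rw [toOp_right_total hON hd huv, toOp_vecV hON hm, chi_one_eq' hON i, map_add, map_add, map_add,
    map_smul, map_smul, ← h1, ← h2, toOp_vecR hON hm, toOp_vecR hON hm, uPlus, uPlus]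
  simp [mul_add]

theorem left_dn_vecV : leftAction.dn (wordBasis hON) (vecV hON i m) = 0 := by
  rw [vecV, wvec_of_reduced hON (isReducedWord_vecV hm)]
  refine leftAction.dn_basis_of_root _ ?_
  rintro ⟨c, hc⟩
  obtain ⟨k, l, t, h1, h2⟩ := left_descent_iff.1 hc
  simp only [List.cons.injEq, Prod.mk.injEq] at h1
  rw [← h1.1.2.1] at h2; simp at h2

theorem right_dn_vecV : (rightAction d hd).dn (wordBasis hON) (vecV hON i m) = 0 := by
  rw [vecV, wvec_of_reduced hON (isReducedWord_vecV hm)]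
  refine (rightAction d hd).dn_basis_of_root _ ?_
  rintro ⟨c, hc⟩
  obtain ⟨k, l, t, h1, h2⟩ := (right_descent_iff hd).1 hc
  simp only [List.reverse_singleton, List.cons.injEq, Prod.mk.injEq] at h1
  rw [← h1.1.2.1] at h2; simp at h2

theorem left_dn_vecR : leftAction.dn (wordBasis hON) (vecR hON i e m) = 0 := by
  rw [vecR, wvec_of_reduced hON (isReducedWord_vecR hm e)]
  refine leftAction.dn_basis_of_root _ ?_
  rintro ⟨c, hc⟩
  obtain ⟨k, l, t, h1, h2⟩ := left_descent_iff.1 hc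
  simp only [List.cons.injEq, Prod.mk.injEq] at h1
  rw [← h1.1.2.1] at h2; simp at h2

theorem right_dn_vecL : (rightAction d hd).dn (wordBasis hON) (vecL hON i e m) = 0 := by
  rw [vecL, wvec_of_reduced hON (isReducedWord_vecL hm e)]
  refine (rightAction d hd).dn_basis_of_root _ ?_
  rintro ⟨c, hc⟩
  obtain ⟨k, l, t, h1, h2⟩ := (right_descent_iff hd).1 hc
  simp only [List.reverse_cons, List.reverse_nil, List.nil_append, List.singleton_append,
    List.cons.injEq, Prod.mk.injEq] at h1
  rw [← h1.1.2.1] at h2; simp at h2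

omit hm in
theorem unit_mul_neg_self (e : ℤˣ) : (e : ℤ) * ((-e : ℤˣ) : ℤ) < 0 := by
  rcases unit_cases e with h | h <;> simp [h]

theorem left_dn_vecUV : leftAction.dn (wordBasis hON) (vecUV hON i e m) = vecV hON i m := by
  rw [vecUV, wvec_of_reduced hON (isReducedWord_vecUV hm e), vecV,
    wvec_of_reduced hON (isReducedWord_vecV hm),
    leftAction.dn_basis_of_descent (c := (i, -e)) _ (left_descent_iff.2
      ⟨e, m, [], rfl, unit_mul_neg_self e⟩)]
  rw [show leftAction.wt (i, -e) _ = 1 from rfl, one_smul]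
  congr 1
  exact RWord.ext (by simp [leftAction, lmul, hm])

theorem left_dn_vecL : leftAction.dn (wordBasis hON) (vecL hON i e m) = vecV hON i m := by
  rw [vecL, wvec_of_reduced hON (isReducedWord_vecL hm e), vecV,
    wvec_of_reduced hON (isReducedWord_vecV hm),
    leftAction.dn_basis_of_descent (c := (1 - i, -e)) _ (left_descent_iff.2
      ⟨e, 0, _, rfl, unit_mul_neg_self e⟩)]
  rw [show leftAction.wt (1 - i, -e) _ = 1 from rfl, one_smul]
  congr 1
  exact RWord.ext (by simp [leftAction, lmul])

theorem right_dn_vecUV : (rightAction d hd).dn (wordBasis hON) (vecUV hON i e m) =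
    d ^ (m * e) • vecV hON i m := by
  rw [vecUV, wvec_of_reduced hON (isReducedWord_vecUV hm e), vecV,
    wvec_of_reduced hON (isReducedWord_vecV hm),
    (rightAction d hd).dn_basis_of_descent (c := (i, -e)) _ ((right_descent_iff hd).2
      ⟨e, m, [], rfl, unit_mul_neg_self e⟩)]
  congr 1
  · simp [rightAction, phaseHead]
  congr 1
  exact RWord.ext (by simp [rightAction, rmul, lmul, hm])

theorem right_dn_vecR : (rightAction d hd).dn (wordBasis hON) (vecR hON i e m) =
    vecV hON i m := by
  rw [vecR, wvec_of_reduced hON (isReducedWord_vecR hm e), vecV,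
    wvec_of_reduced hON (isReducedWord_vecV hm),
    (rightAction d hd).dn_basis_of_descent (c := (1 - i, -e)) _ ((right_descent_iff hd).2
      ⟨e, 0, [(i, 0, m)], rfl, unit_mul_neg_self e⟩)]
  have h1 : (rightAction d hd).wt (1 - i, -e) ⟨_, isReducedWord_vecR (i := i) hm e⟩ = 1 := by
    simp [rightAction, phaseHead]
  rw [h1, one_smul]
  congr 1
  exact RWord.ext (by simp [rightAction, rmul, lmul])

theorem left_up_vecV : leftAction.up (wordBasis hON) (vecV hON i m) =
    vecUV hON i 1 m + vecUV hON i (-1) m + (vecL hON i 1 m + vecL hON i (-1) m) := by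
  rw [← left_total_vecV hON hm, LetterAction.total_apply, left_dn_vecV hON hm, add_zero]

include huv in
theorem right_up_vecV : (rightAction d hd).up (wordBasis hON) (vecV hON i m) =
    d ^ (-m) • vecUV hON i 1 m + d ^ m • vecUV hON i (-1) m +
      (vecR hON i 1 m + vecR hON i (-1) m) := by
  rw [← right_total_vecV hON hd huv hm, LetterAction.total_apply, right_dn_vecV hON hd hm,
    add_zero]

/-! ### Generic words -/

omit hm in
theorem isGeneric_of_wordLength {w : List Syllable} (h : vLength w + 2 ≤ wordLength w) :
    IsGeneric w := by
  refine ⟨by rintro rfl; simp at h, ?_⟩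
  rintro i k l rfl
  simp at h; omega

omit hm in
theorem isGeneric_of_vCount {w : List Syllable} (h : 2 ≤ vCount w) : IsGeneric w := by
  refine ⟨by rintro rfl; simp at h, ?_⟩
  rintro i k l rfl
  by_cases hl : l = 0 <;> simp [hl] at h

omit hm in
theorem inner_wvec_of_not_generic {x : wordSpan u v Ω}
    (hx : x ∈ wspan (wordBasis hON) {w | IsGeneric w.1}) {w : List Syllable}
    (hw : ¬ IsGeneric w) : ⟪x, wvec hON w⟫_ℂ = 0 := by
  refine inner_eq_zero_of_disjoint (orthonormal_wordBasis hON) (T' := {w : RWord | ¬ IsGeneric w.1}) ?_ hx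
    (wvec_mem hON fun h => hw)
  rw [Set.disjoint_left]
  exact fun w h h' => h' h

omit hm in
theorem not_isGeneric_syl (i : Fin 2) {k : ℤ} (hk : k.natAbs ≤ 1) (l : ℤ) :
    ¬ IsGeneric [(i, k, l)] := fun h => by
  have := h.2 i k l rfl
  omega

/-- The lengthening of v_i^m is orthogonal to x, whose shortening is zero. Its terms u_i^{±1} v_i^m
are not generic and do not meet x, so only the symmetric sum remains. -/
theorem inner_prim_vecL {x : wordSpan u v Ω} (hx : x ∈ prim hON hd) :
    ⟪x, vecL hON i 1 m + vecL hON i (-1) m⟫_ℂ = 0 := by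
  have h1 : ⟪x, leftAction.up (wordBasis hON) (vecV hON i m)⟫_ℂ = 0 := by
    rw [LetterAction.inner_up_right _ (orthonormal_wordBasis hON), hx.2.1, inner_zero_left]
  rw [left_up_vecV hON hm, inner_add_right, inner_add_right, vecUV, vecUV,
    inner_wvec_of_not_generic hON hx.1 (not_isGeneric_syl i (by simp) m),
    inner_wvec_of_not_generic hON hx.1 (not_isGeneric_syl i (by simp) m), zero_add, zero_add] at h1
  exact h1

include huv in
theorem inner_prim_vecR {x : wordSpan u v Ω} (hx : x ∈ prim hON hd) :
    ⟪x, vecR hON i 1 m + vecR hON i (-1) m⟫_ℂ = 0 := by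
  have h1 : ⟪x, (rightAction d hd).up (wordBasis hON) (vecV hON i m)⟫_ℂ = 0 := by
    rw [LetterAction.inner_up_right _ (orthonormal_wordBasis hON), hx.2.2, inner_zero_left]
  rw [right_up_vecV hON hd huv hm, inner_add_right, inner_add_right, inner_smul_right,
    inner_smul_right, vecUV, vecUV,
    inner_wvec_of_not_generic hON hx.1 (not_isGeneric_syl i (by simp) m),
    inner_wvec_of_not_generic hON hx.1 (not_isGeneric_syl i (by simp) m), mul_zero, mul_zero,
    zero_add, zero_add] at h1
  exact h1

/-! ### The vectors `γ` -/

omit hm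

variable (d) in
/-- The vector `γ^i_l` with `m = l - sgn l`. -/
def gamVec (i : Fin 2) (m : ℤ) : wordSpan u v Ω :=
  (2 / (d ^ (-m) - d ^ m)) • (d ^ (-m) • vecUV hON i 1 m - d ^ m • vecUV hON i (-1) m) -
    (vecL hON i 1 m + vecL hON i (-1) m)

variable (d) in
/-- The vector `γ̄^i_l` with `m = l - sgn l`. -/
def gamBarVec (i : Fin 2) (m : ℤ) : wordSpan u v Ω :=
  (2 / (d ^ m - d ^ (-m))) • (vecUV hON i 1 m - vecUV hON i (-1) m) -
    (vecR hON i 1 m + vecR hON i (-1) m)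

include hd huv in
theorem toOp_gamVec {l : ℤ} (hl : l - l.sign ≠ 0) :
    toOp hON (gamVec hON d i (l - l.sign)) = gam d u v i l := by
  have h1 := toOp_vecUV' hON hd huv (i := i) hl 1
  have h2 := toOp_vecUV' hON hd huv (i := i) hl (-1)
  simp only [Units.val_one, mul_one, Units.val_neg, mul_neg, neg_neg] at h1 h2
  rw [gamVec, map_sub, map_smul, map_sub, map_smul, map_smul, ← h1, ← h2, map_add,
    toOp_vecL hON hl, toOp_vecL hON hl, gam, uPlus, add_mul]
  rfl

include hd huv in
theorem toOp_gamBarVec {l : ℤ} (hl : l - l.sign ≠ 0) :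
    toOp hON (gamBarVec hON d i (l - l.sign)) = gamBar d u v i l := by
  have h1 := toOp_vecUV' hON hd huv (i := i) hl 1
  have h2 := toOp_vecUV' hON hd huv (i := i) hl (-1)
  simp only [Units.val_one, mul_one, Units.val_neg, mul_neg, neg_neg] at h1 h2
  have hne := norm_one_ne_zero hd
  rw [gamBarVec, map_sub, map_smul, map_sub, map_add,
    toOp_vecR hON hl, toOp_vecR hON hl, gamBar, uPlus, mul_add, h1, h2, smul_smul, smul_smul,
    ← zpow_add₀ hne, ← zpow_add₀ hne]
  simp

variable (hroot : ∀ n : ℕ, n ≠ 0 → d ^ n ≠ 1)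
include hroot hm hd

omit hON in
theorem zpow_sub_ne_zero : d ^ m - d ^ (-m) ≠ 0 := by
  have hne := norm_one_ne_zero hd
  intro h
  have h1 : d ^ (m + m) = 1 := by
    rw [zpow_add₀ hne]
    nth_rw 2 [sub_eq_zero.1 h]
    rw [← zpow_add₀ hne]; simp
  exact zpow_ne_one_of_root hroot (by omega) h1

/-- From the left all four words shorten to v_i^m, and the factor 2 / (d^(-m) - d^m) is chosen so
that the coefficients sum to zero. From the right only u_i^{±1} v_i^m shorten; the phases d^{±m}
undo the coefficients d^{∓m}, and the two terms cancel. -/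
theorem gamVec_mem_dnKer : gamVec hON d i m ∈ dnKer hON hd := by
  have hne := zpow_sub_ne_zero hd hm hroot
  have hne' : d ^ (-m) - d ^ m ≠ 0 := by rw [← neg_sub]; exact neg_ne_zero.2 hne
  have hd0 := norm_one_ne_zero hd
  refine (mem_dnKer hON hd).2 ⟨?_, ?_⟩
  · simp only [gamVec, map_sub, map_smul, map_add, left_dn_vecUV hON hm, left_dn_vecL hON hm]
    rw [← sub_smul, smul_smul, div_mul_cancel₀ _ hne']
    module
  · simp only [gamVec, map_sub, map_smul, map_add, right_dn_vecUV hON hd hm,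
      right_dn_vecL hON hd hm]
    rw [smul_smul, smul_smul, ← zpow_add₀ hd0, ← zpow_add₀ hd0]
    simp

theorem gamBarVec_mem_dnKer : gamBarVec hON d i m ∈ dnKer hON hd := by
  have hne := zpow_sub_ne_zero hd hm hroot
  refine (mem_dnKer hON hd).2 ⟨?_, ?_⟩
  · simp only [gamBarVec, map_sub, map_smul, map_add, left_dn_vecUV hON hm, left_dn_vecR hON hm]
    simp
  · simp only [gamBarVec, map_sub, map_smul, map_add, right_dn_vecUV hON hd hm,
      right_dn_vecR hON hd hm, Units.val_one, Units.val_neg, mul_one, mul_neg]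
    rw [← sub_smul, smul_smul, div_mul_cancel₀ _ hne]
    module

omit hroot
theorem inner_prim_gamVec {x : wordSpan u v Ω} (hx : x ∈ prim hON hd) :
    ⟪x, gamVec hON d i m⟫_ℂ = 0 := by
  rw [gamVec, inner_sub_right, inner_prim_vecL hON hd hm hx, inner_smul_right, inner_sub_right,
    inner_smul_right, inner_smul_right, vecUV, vecUV,
    inner_wvec_of_not_generic hON hx.1 (not_isGeneric_syl i (by simp) m),
    inner_wvec_of_not_generic hON hx.1 (not_isGeneric_syl i (by simp) m)]
  simp

include huv in
theorem inner_prim_gamBarVec {x : wordSpan u v Ω} (hx : x ∈ prim hON hd) :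
    ⟪x, gamBarVec hON d i m⟫_ℂ = 0 := by
  rw [gamBarVec, inner_sub_right, inner_prim_vecR hON hd huv hm hx, inner_smul_right,
    inner_sub_right, vecUV, vecUV,
    inner_wvec_of_not_generic hON hx.1 (not_isGeneric_syl i (by simp) m),
    inner_wvec_of_not_generic hON hx.1 (not_isGeneric_syl i (by simp) m)]
  simp

include hroot
omit huv hm hroot in
-- A factor of the determinant in `vec_mem_of_generators`; two numbers of modulus 1 cannot sum to
-- 14.
theorem det_ne_zero : (14 : ℂ) - d ^ (2 * m) - d ^ (-(2 * m)) ≠ 0 := by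
  intro h
  have h1 : ‖d ^ (2 * m) + d ^ (-(2 * m))‖ ≤ 2 := by
    refine (norm_add_le _ _).trans ?_
    rw [norm_zpow, norm_zpow, hd]; norm_num
  have h2 : d ^ (2 * m) + d ^ (-(2 * m)) = 14 := by linear_combination -h
  rw [h2] at h1
  norm_num at h1

include huv in
/-- The words `u_i^{±1} v_i^m`, `u_{1-i}^{±1} v_i^m`, `v_i^m u_{1-i}^{±1}` are obtained from
`γ`, `γ̄`, multiples of `v_i^m` and antisymmetric vectors. -/
theorem vec_mem_of_generators {T : Submodule ℂ (wordSpan u v Ω)}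
    (h1 : leftAction.up (wordBasis hON) (vecV hON i m) ∈ T)
    (h2 : (rightAction d hd).up (wordBasis hON) (vecV hON i m) ∈ T)
    (h3 : gamVec hON d i m ∈ T) (h4 : gamBarVec hON d i m ∈ T)
    (h5 : vecL hON i 1 m - vecL hON i (-1) m ∈ T) (h6 : vecR hON i 1 m - vecR hON i (-1) m ∈ T)
    (e : ℤˣ) : vecUV hON i e m ∈ T ∧ vecL hON i e m ∈ T ∧ vecR hON i e m ∈ T := by
  rw [left_up_vecV hON hm] at h1
  rw [right_up_vecV hON hd huv hm] at h2
  have hd0 := norm_one_ne_zero hd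
  have hne := zpow_sub_ne_zero hd hm hroot
  have hdet := det_ne_zero hd (m := m)
  rw [two_mul, neg_add, zpow_add₀ hd0, zpow_add₀ hd0] at hdet
  have hinv : d ^ (-m) = (d ^ m)⁻¹ := zpow_neg d m
  have hw : d ^ m ≠ 0 := zpow_ne_zero m hd0
  set w := d ^ m with hwdef
  set p := vecUV hON i 1 m
  set q' := vecUV hON i (-1) m
  set s := vecL hON i 1 m + vecL hON i (-1) m with hs
  set t := vecR hON i 1 m + vecR hON i (-1) m with ht
  have g3 : (2 / (w⁻¹ - w)) • (w⁻¹ • p - w • q') - s ∈ T := by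
    have := h3; rw [gamVec, hinv] at this; exact this
  have g4 : (2 / (w - w⁻¹)) • (p - q') - t ∈ T := by
    have := h4; rw [gamBarVec, hinv] at this; exact this
  rw [hinv] at h2 hne hdet
  have hne' : w⁻¹ - w ≠ 0 := by rw [← neg_sub]; exact neg_ne_zero.2 hne
  -- Adding γ to χ₁ v_i^m removes s, and the scalar clears the denominator. In the same way γ̄
  -- removes t from v_i^m χ₁ below.
  have k1 : (3 * w⁻¹ - w) • p + (w⁻¹ - 3 * w) • q' ∈ T := by
    have := T.smul_mem (w⁻¹ - w) (add_mem h1 g3)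
    have e : (w⁻¹ - w) • (p + q' + s + ((2 / (w⁻¹ - w)) • (w⁻¹ • p - w • q') - s)) =
        (3 * w⁻¹ - w) • p + (w⁻¹ - 3 * w) • q' := by
      have : (w⁻¹ - w) * (2 / (w⁻¹ - w)) = 2 := mul_div_cancel₀ _ hne'
      rw [add_add_sub_cancel, smul_add, smul_smul, this]
      module
    rwa [e] at this
  have k2 : (3 - w⁻¹ * w⁻¹) • p + (w * w - 3) • q' ∈ T := by
    have := T.smul_mem (w - w⁻¹) (add_mem h2 g4)
    have e : (w - w⁻¹) • (w⁻¹ • p + w • q' + t + ((2 / (w - w⁻¹)) • (p - q') - t)) =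
        (3 - w⁻¹ * w⁻¹) • p + (w * w - 3) • q' := by
      have e1 : (w - w⁻¹) * (2 / (w - w⁻¹)) = 2 := mul_div_cancel₀ _ hne
      have e2 : w * w⁻¹ = 1 := mul_inv_cancel₀ hw
      rw [add_add_sub_cancel, smul_add, smul_smul, e1]
      have e3 : (3 : ℂ) - w⁻¹ * w⁻¹ = (w - w⁻¹) * w⁻¹ + 2 := by linear_combination -e2
      have e4 : w * w - 3 = (w - w⁻¹) * w - 2 := by linear_combination e2
      rw [e3, e4]
      module
    rwa [e] at this
  -- This is the determinant of the system formed by `k1` and `k2` in the unknowns p and q', which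
  -- Cramer's rule then solves.
  have hD : (w - w⁻¹) * (14 - w * w - w⁻¹ * w⁻¹) ≠ 0 := mul_ne_zero hne hdet
  have e2 : w * w⁻¹ = 1 := mul_inv_cancel₀ hw
  have hp : p ∈ T := by
    have h := sub_mem (T.smul_mem (w * w - 3) k1) (T.smul_mem (w⁻¹ - 3 * w) k2)
    have e : (w * w - 3) • ((3 * w⁻¹ - w) • p + (w⁻¹ - 3 * w) • q') -
        (w⁻¹ - 3 * w) • ((3 - w⁻¹ * w⁻¹) • p + (w * w - 3) • q') =
        ((w - w⁻¹) * (14 - w * w - w⁻¹ * w⁻¹)) • p := by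
      have : (w - w⁻¹) * (14 - w * w - w⁻¹ * w⁻¹) =
          (w * w - 3) * (3 * w⁻¹ - w) - (w⁻¹ - 3 * w) * (3 - w⁻¹ * w⁻¹) := by
        linear_combination (-2 * w + 2 * w⁻¹) * e2
      rw [this]; module
    rw [e] at h
    exact (T.smul_mem_iff hD).1 h
  have hq : q' ∈ T := by
    have h := sub_mem (T.smul_mem (3 * w⁻¹ - w) k2) (T.smul_mem (3 - w⁻¹ * w⁻¹) k1)
    have e : (3 * w⁻¹ - w) • ((3 - w⁻¹ * w⁻¹) • p + (w * w - 3) • q') -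
        (3 - w⁻¹ * w⁻¹) • ((3 * w⁻¹ - w) • p + (w⁻¹ - 3 * w) • q') =
        ((w - w⁻¹) * (14 - w * w - w⁻¹ * w⁻¹)) • q' := by
      have : (w - w⁻¹) * (14 - w * w - w⁻¹ * w⁻¹) =
          (w * w - 3) * (3 * w⁻¹ - w) - (w⁻¹ - 3 * w) * (3 - w⁻¹ * w⁻¹) := by
        linear_combination (-2 * w + 2 * w⁻¹) * e2
      rw [this]; module
    rw [e] at h
    exact (T.smul_mem_iff hD).1 h
  have hs' : s ∈ T := by
    have := sub_mem h1 (add_mem hp hq); rwa [add_sub_cancel_left] at this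
  have ht' : t ∈ T := by
    have := sub_mem h2 (add_mem (T.smul_mem w⁻¹ hp) (T.smul_mem w hq))
    rwa [add_sub_cancel_left] at this
  have half : ∀ {a b : wordSpan u v Ω}, a + b ∈ T → a - b ∈ T → a ∈ T ∧ b ∈ T := by
    intro a b ha hb
    constructor
    · have := T.smul_mem (1 / 2 : ℂ) (add_mem ha hb)
      convert this using 1; module
    · have := T.smul_mem (1 / 2 : ℂ) (sub_mem ha hb)
      convert this using 1; module
  obtain ⟨l1, l2⟩ := half hs' h5
  obtain ⟨r1, r2⟩ := half ht' h6
  rcases Int.units_eq_one_or e with rfl | rfl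
  · exact ⟨hp, l1, r1⟩
  · exact ⟨hq, l2, r2⟩

end Special

/-! ### The four kinds of kernel vectors -/

section KindSpans

variable {H : Type*} [NormedAddCommGroup H] [InnerProductSpace ℂ H] [CompleteSpace H]
variable {u v : Fin 2 → unitary (H →L[ℂ] H)} {Ω : H}
variable (hON : Orthonormal ℂ fun w : RWord => wordOp u v w.1 Ω)
variable {d : ℂ} (hd : ‖d‖ = 1)
variable (huv : ∀ i, (u i : H →L[ℂ] H) * (v i : H →L[ℂ] H) =
      d • ((v i : H →L[ℂ] H) * (u i : H →L[ℂ] H)))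

/-- The antisymmetric vectors spanning `W_l^{1,α,2}`. -/
def alphaTwoSet (l : ℕ) : Set (wordSpan u v Ω) :=
  {x | ∃ (i : Fin 2) (m : ℤ), m ≠ 0 ∧ m.natAbs + 1 = l ∧
    (x = vecL hON i 1 m - vecL hON i (-1) m ∨ x = vecR hON i 1 m - vecR hON i (-1) m)}

/-- The spaces `W_l^κ ⊖ S_l^j` as spaces of vectors. -/
def kindSpan : Kind → ℕ → Submodule ℂ (wordSpan u v Ω)
  | Kind.zero, l => gradedSpan hON (fun a _ => a = 0) l ⊓ dnKer hON hd
  | Kind.two, l => gradedSpan hON (fun a _ => 2 ≤ a) l ⊓ dnKer hON hd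
  | Kind.alphaTwo, l => Submodule.span ℂ (alphaTwoSet hON l)
  | Kind.beta, l => gradedSpan hON (fun a h => a = 1 ∧ h + 2 ≤ l) l ⊓ dnKer hON hd

theorem gradedSpan_mono {p p' : ℕ → ℕ → Prop} (h : ∀ a b, p a b → p' a b) (l : ℕ) :
    gradedSpan hON p l ≤ gradedSpan hON p' l := wspan_mono fun _ hw => ⟨hw.1, h _ _ hw.2⟩

theorem wvec_mem_gradedSpan {p : ℕ → ℕ → Prop} {l : ℕ} {w : List Syllable}
    (h : wordLength w = l) (hp : p (vCount w) (vLength w)) : wvec hON w ∈ gradedSpan hON p l :=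
  wvec_mem hON fun _ => ⟨h, hp⟩

section

variable {i : Fin 2} {m : ℤ} (hm : m ≠ 0) (e : ℤˣ)
include hm

theorem vecL_mem_gradedSpan :
    vecL hON i e m ∈ gradedSpan hON (fun a h => a = 1 ∧ h = m.natAbs) (m.natAbs + 1) :=
  wvec_mem_gradedSpan hON (by rcases unit_cases e with h | h <;> simp [h, add_comm])
    (by simp [hm])

theorem vecR_mem_gradedSpan :
    vecR hON i e m ∈ gradedSpan hON (fun a h => a = 1 ∧ h = m.natAbs) (m.natAbs + 1) :=
  wvec_mem_gradedSpan hON (by rcases unit_cases e with h | h <;> simp [h])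
    (by simp [hm])

theorem vecUV_mem_gradedSpan :
    vecUV hON i e m ∈ gradedSpan hON (fun a h => a = 1 ∧ h = m.natAbs) (m.natAbs + 1) :=
  wvec_mem_gradedSpan hON (by rcases unit_cases e with h | h <;> simp [h, add_comm])
    (by simp [hm])

theorem vecV_mem_gradedSpan :
    vecV hON i m ∈ gradedSpan hON (fun a h => a = 1 ∧ h = m.natAbs) m.natAbs :=
  wvec_mem_gradedSpan hON (by simp) (by simp [hm])

theorem vecL_sub_mem_dnKer : vecL hON i 1 m - vecL hON i (-1) m ∈ dnKer hON hd :=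
  (mem_dnKer hON hd).2 (by
    simp only [map_sub, left_dn_vecL hON hm, right_dn_vecL hON hd hm, sub_self, and_self])

theorem vecR_sub_mem_dnKer : vecR hON i 1 m - vecR hON i (-1) m ∈ dnKer hON hd :=
  (mem_dnKer hON hd).2 (by
    simp only [map_sub, left_dn_vecR hON hm, right_dn_vecR hON hd hm, sub_self, and_self])

omit hm in
theorem isGeneric_pair (s t : Syllable) : IsGeneric [s, t] :=
  ⟨by simp, fun i k l h => by simp at h⟩

theorem left_root_vecL : leftAction.root (wordBasis hON) (vecL hON i e m) = 0 := by
  rw [vecL, wvec_of_reduced hON (isReducedWord_vecL hm e), LetterAction.root_basis, if_pos]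
  exact ⟨(1 - i, -e), left_descent_iff.2 ⟨e, 0, _, rfl, unit_mul_neg_self e⟩⟩

theorem right_root_vecR : (rightAction d hd).root (wordBasis hON) (vecR hON i e m) = 0 := by
  rw [vecR, wvec_of_reduced hON (isReducedWord_vecR hm e), LetterAction.root_basis, if_pos]
  exact ⟨(1 - i, -e), (right_descent_iff hd).2
    ⟨e, 0, [(i, 0, m)], rfl, unit_mul_neg_self e⟩⟩

theorem left_root_vecR : leftAction.root (wordBasis hON) (vecR hON i e m) = vecR hON i e m := by
  rw [vecR, wvec_of_reduced hON (isReducedWord_vecR hm e), LetterAction.root_basis, if_neg]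
  rintro ⟨c, hc⟩
  obtain ⟨k, l, t, h1, h2⟩ := left_descent_iff.1 hc
  simp only [List.cons.injEq, Prod.mk.injEq] at h1
  rw [← h1.1.2.1] at h2; simp at h2

theorem right_root_vecL :
    (rightAction d hd).root (wordBasis hON) (vecL hON i e m) = vecL hON i e m := by
  rw [vecL, wvec_of_reduced hON (isReducedWord_vecL hm e), LetterAction.root_basis, if_neg]
  rintro ⟨c, hc⟩
  obtain ⟨k, l, t, h1, h2⟩ := (right_descent_iff hd).1 hc
  simp only [List.reverse_cons, List.reverse_nil, List.nil_append, List.singleton_append,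
    List.cons.injEq, Prod.mk.injEq] at h1
  rw [← h1.1.2.1] at h2; simp at h2

end

theorem kindSpan_le_dnKer (κ : Kind) (l : ℕ) : kindSpan hON hd κ l ≤ dnKer hON hd := by
  cases κ
  · exact inf_le_right
  · exact inf_le_right
  · refine Submodule.span_le.2 ?_
    rintro _ ⟨i, m, hm, -, rfl | rfl⟩
    · exact vecL_sub_mem_dnKer hON hd hm
    · exact vecR_sub_mem_dnKer hON hd hm
  · exact inf_le_right

/-- The condition on the numbers of `v`-syllables and of letters `v_i^{±1}` corresponding to a kind
of words. -/
def kindProp : Kind → ℕ → ℕ → ℕ → Prop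
  | Kind.zero, _ => fun a _ => a = 0
  | Kind.two, _ => fun a _ => 2 ≤ a
  | Kind.alphaTwo, l => fun a h => a = 1 ∧ h + 1 = l
  | Kind.beta, l => fun a h => a = 1 ∧ h + 2 ≤ l

theorem kindSpan_le_gradedSpan (κ : Kind) (l : ℕ) :
    kindSpan hON hd κ l ≤ gradedSpan hON (kindProp κ l) l := by
  cases κ
  · exact inf_le_left
  · exact inf_le_left
  · refine Submodule.span_le.2 ?_
    rintro _ ⟨i, m, hm, rfl, rfl | rfl⟩
    · exact gradedSpan_mono hON (fun a b h => ⟨h.1, by rw [h.2]⟩) _ (sub_mem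
        (vecL_mem_gradedSpan hON hm 1) (vecL_mem_gradedSpan hON hm (-1)))
    · exact gradedSpan_mono hON (fun a b h => ⟨h.1, by rw [h.2]⟩) _ (sub_mem
        (vecR_mem_gradedSpan hON hm 1) (vecR_mem_gradedSpan hON hm (-1)))
  · exact inf_le_left

theorem kindSpan_le_len (κ : Kind) (l : ℕ) :
    kindSpan hON hd κ l ≤ wspan (wordBasis hON) {w | w.len = l} :=
  (kindSpan_le_gradedSpan hON hd κ l).trans (gradedSpan_le_len hON)

/-- For l ≥ 1 the excluded case consists of combinations of single letters. These are never generic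
and are treated by means of `flip`. -/
theorem kindSpan_le_generic {κ : Kind} {l : ℕ} (h : κ ≠ Kind.zero ∨ 2 ≤ l) :
    kindSpan hON hd κ l ≤ wspan (wordBasis hON) {w | IsGeneric w.1} := by
  cases κ
  · have hl : 2 ≤ l := by simpa using h
    refine inf_le_left.trans (wspan_mono fun w hw => isGeneric_of_wordLength ?_)
    have h1 := hw.1; have h2 := vLength_eq_zero hw.2
    simp only [RWord.len] at h1; omega
  · exact inf_le_left.trans (wspan_mono fun w hw => isGeneric_of_vCount hw.2)
  · refine Submodule.span_le.2 ?_
    rintro _ ⟨i, m, hm, rfl, rfl | rfl⟩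
    · exact sub_mem (wvec_mem hON fun _ => isGeneric_pair _ _)
        (wvec_mem hON fun _ => isGeneric_pair _ _)
    · exact sub_mem (wvec_mem hON fun _ => isGeneric_pair _ _)
        (wvec_mem hON fun _ => isGeneric_pair _ _)
  · refine inf_le_left.trans (wspan_mono fun w hw => isGeneric_of_wordLength ?_)
    have h1 := hw.1; have h2 := hw.2.2
    simp only [RWord.len] at h1; omega

theorem kindSpan_le_prim {κ : Kind} {l : ℕ} (h : κ ≠ Kind.zero ∨ 2 ≤ l) :
    kindSpan hON hd κ l ≤ prim hON hd :=
  le_inf (kindSpan_le_generic hON hd h) (kindSpan_le_dnKer hON hd κ l)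

theorem wspan_root_mem {α : LetterAction RWord.len} {T : Set RWord} {x : wordSpan u v Ω}
    (hx : x ∈ wspan (wordBasis hON) T) :
    α.root (wordBasis hON) x ∈ wspan (wordBasis hON) T := LetterAction.root_mem hx

theorem left_root_eq_zero {l : ℕ} {x : wordSpan u v Ω}
    (hx : x ∈ gradedSpan hON (fun a _ => a = 0) (l + 1)) :
    leftAction.root (wordBasis hON) x = 0 := by
  have : leftAction.root (wordBasis hON) x ∈ wspan (wordBasis hON) ∅ := by
    refine wspan_le_comap (fun w hw => ?_) hx
    rw [LetterAction.root_basis, if_pos]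
    · exact zero_mem _
    · have h1 := hw.1
      obtain ⟨c, hc⟩ := exists_descent_of_vCount_eq_zero w.2 hw.2 (by
        intro h; simp [RWord.len, h] at h1)
      exact ⟨c, left_descent_iff.2 hc⟩
  simpa [wspan] using this

theorem right_root_eq_zero {l : ℕ} {x : wordSpan u v Ω}
    (hx : x ∈ gradedSpan hON (fun a _ => a = 0) (l + 1)) :
    (rightAction d hd).root (wordBasis hON) x = 0 := by
  have : (rightAction d hd).root (wordBasis hON) x ∈ wspan (wordBasis hON) ∅ := by
    refine wspan_le_comap (fun w hw => ?_) hx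
    rw [LetterAction.root_basis, if_pos]
    · exact zero_mem _
    · have h1 := hw.1
      obtain ⟨c, hc⟩ := exists_descent_of_vCount_eq_zero w.2.reverse
        (by rw [vCount_reverse]; exact hw.2) (by
        intro h; simp only [List.reverse_eq_nil_iff] at h; simp [RWord.len, h] at h1)
      exact ⟨c, (right_descent_iff hd).2 hc⟩
  simpa [wspan] using this

/-- By `dn_up`, shortening a once lengthened vector produces a `root` term; this keeps that term
among the vectors being shifted. -/
theorem left_root_mem_kindSpan {κ : Kind} {l : ℕ} (hl : 1 ≤ l) {x : wordSpan u v Ω}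
    (hx : x ∈ kindSpan hON hd κ l) :
    leftAction.root (wordBasis hON) x ∈ kindSpan hON hd κ l := by
  obtain ⟨l, rfl⟩ := Nat.exists_eq_add_of_le' hl
  cases κ
  · rw [left_root_eq_zero hON hx.1]; exact zero_mem _
  · exact ⟨wspan_root_mem hON hx.1, ((compatible d hd).root_mem_primitive
      (kindSpan_le_prim hON hd (Or.inl (by simp)) hx)).2⟩
  · have : kindSpan hON hd Kind.alphaTwo (l + 1) ≤
        (kindSpan hON hd Kind.alphaTwo (l + 1)).comap (leftAction.root (wordBasis hON)) := by
      refine Submodule.span_le.2 ?_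
      rintro _ ⟨i, m, hm, h, rfl | rfl⟩
      · change leftAction.root (wordBasis hON) (_ - _) ∈
          kindSpan hON hd Kind.alphaTwo (l + 1)
        rw [map_sub, left_root_vecL hON hm, left_root_vecL hON hm, sub_zero]
        exact zero_mem _
      · change leftAction.root (wordBasis hON) (_ - _) ∈
          kindSpan hON hd Kind.alphaTwo (l + 1)
        rw [map_sub, left_root_vecR hON hm, left_root_vecR hON hm]
        exact Submodule.subset_span ⟨i, m, hm, h, Or.inr rfl⟩
    exact this hx
  · exact ⟨wspan_root_mem hON hx.1, ((compatible d hd).root_mem_primitive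
      (kindSpan_le_prim hON hd (Or.inl (by simp)) hx)).2⟩

theorem right_root_mem_kindSpan {κ : Kind} {l : ℕ} (hl : 1 ≤ l) {x : wordSpan u v Ω}
    (hx : x ∈ kindSpan hON hd κ l) :
    (rightAction d hd).root (wordBasis hON) x ∈ kindSpan hON hd κ l := by
  have key : ∀ x ∈ prim hON hd, (rightAction d hd).root (wordBasis hON) x ∈ prim hON hd :=
    fun x hx => LetterAction.mem_primitive_symm ((compatible d hd).symm.root_mem_primitive
      (LetterAction.mem_primitive_symm hx))
  obtain ⟨l, rfl⟩ := Nat.exists_eq_add_of_le' hl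
  cases κ
  · rw [right_root_eq_zero hON hd hx.1]; exact zero_mem _
  · exact ⟨wspan_root_mem hON hx.1, (key _ (kindSpan_le_prim hON hd (Or.inl (by simp)) hx)).2⟩
  · have : kindSpan hON hd Kind.alphaTwo (l + 1) ≤
        (kindSpan hON hd Kind.alphaTwo (l + 1)).comap
          ((rightAction d hd).root (wordBasis hON)) := by
      refine Submodule.span_le.2 ?_
      rintro _ ⟨i, m, hm, h, rfl | rfl⟩
      · change (rightAction d hd).root (wordBasis hON) (_ - _) ∈
          kindSpan hON hd Kind.alphaTwo (l + 1)
        rw [map_sub, right_root_vecL hON hd hm, right_root_vecL hON hd hm]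
        exact Submodule.subset_span ⟨i, m, hm, h, Or.inl rfl⟩
      · change (rightAction d hd).root (wordBasis hON) (_ - _) ∈
          kindSpan hON hd Kind.alphaTwo (l + 1)
        rw [map_sub, right_root_vecR hON hd hm, right_root_vecR hON hd hm, sub_zero]
        exact zero_mem _
    exact this hx
  · exact ⟨wspan_root_mem hON hx.1, (key _ (kindSpan_le_prim hON hd (Or.inl (by simp)) hx)).2⟩

/-! ### Comparison with the spaces of operators -/

theorem mem_ominus_map {P : Submodule ℂ (wordSpan u v Ω)} {K : Submodule ℂ H} {X : H →L[ℂ] H} :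
    X ∈ ominus Ω (P.map (toOp hON)) K ↔ ∃ x ∈ P, (x : H) ∈ Kᗮ ∧ toOp hON x = X := by
  constructor
  · rintro ⟨⟨x, hx, rfl⟩, h⟩
    refine ⟨x, hx, ?_, rfl⟩
    have h' : toOp hON x Ω ∈ Kᗮ := h
    rwa [toOp_apply] at h'
  · rintro ⟨x, hx, h, rfl⟩
    refine ⟨⟨x, hx, rfl⟩, ?_⟩
    change toOp hON x Ω ∈ Kᗮ
    rwa [toOp_apply]

include huv in
theorem ominus_S_eq_map {P : Submodule ℂ (wordSpan u v Ω)} {j l : ℕ}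
    (hP : P ≤ gradedSpan hON (fun a _ => min a 2 = j) l) :
    ominus Ω (P.map (toOp hON)) (S u v Ω j l) = (P ⊓ dnKer hON hd).map (toOp hON) := by
  ext X
  rw [mem_ominus_map]
  constructor
  · rintro ⟨x, hx, h, rfl⟩
    exact ⟨x, ⟨hx, (mem_S_orthogonal_iff hON hd huv (hP hx)).1 h⟩, rfl⟩
  · rintro ⟨x, ⟨hx, h⟩, rfl⟩
    exact ⟨x, hx, (mem_S_orthogonal_iff hON hd huv (hP hx)).2 h, rfl⟩

theorem exists_unit {s : ℤ} (hs : |s| = 1) : ∃ e : ℤˣ, (e : ℤ) = s := by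
  rcases (abs_eq (by norm_num)).1 hs with rfl | rfl
  · exact ⟨1, rfl⟩
  · exact ⟨-1, rfl⟩

include hd huv in
theorem exists_toOp_of_mem_Walpha {l : ℕ} (hl : 1 ≤ l) {X : H →L[ℂ] H}
    (hX : X ∈ Walpha u v l ⊔ Wv v l) : ∃ x ∈ wspan (wordBasis hON)
      {w : RWord | vCount w.1 = 1 → l ≤ vLength w.1 + 1}, toOp hON x = X := by
  set T : Set RWord := {w : RWord | vCount w.1 = 1 → l ≤ vLength w.1 + 1}
  change X ∈ (wspan (wordBasis hON) T).map (toOp hON)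
  refine (sup_le (Submodule.span_le.2 ?_) (Submodule.span_le.2 ?_) :
    Walpha u v l ⊔ Wv v l ≤ (wspan (wordBasis hON) T).map (toOp hON)) hX
  · rintro x ⟨i, j, s, t, hs, ht, hx⟩
    rw [Int.abs_eq_natAbs] at ht
    obtain ⟨e, rfl⟩ := exists_unit hs
    -- This happens only for l = 1. The generator is then a letter u without any v-syllable, which
    -- is why T is defined by an implication.
    by_cases h0 : t = 0
    · have : x = toOp hON (wvec hON [(i, (e : ℤ), 0)]) := by
        rw [toOp_wvec hON (isReducedWord_singleton.2 (by simp))]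
        rcases hx with rfl | rfl <;> simp [sylOp, h0]
      exact ⟨_, wvec_mem hON fun _ h => by simp at h, this.symm⟩
    · have ht' : l ≤ t.natAbs + 1 := by omega
      by_cases hij : i = j
      · subst hij
        rcases hx with rfl | rfl
        · rw [← toOp_vecUV hON h0]
          exact ⟨_, wvec_mem hON fun _ _ => by simpa using ht', rfl⟩
        · rw [toOp_vecUV' hON hd huv h0]
          exact Submodule.smul_mem _ _ ⟨_, wvec_mem hON fun _ _ => by simpa using ht', rfl⟩
      · obtain rfl := eq_one_sub hij
        rcases hx with rfl | rfl
        · rw [← toOp_vecL hON h0]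
          exact ⟨_, wvec_mem hON fun _ _ => by simpa using ht', rfl⟩
        · rw [← toOp_vecR hON h0]
          exact ⟨_, wvec_mem hON fun _ _ => by simpa using ht', rfl⟩
  · rintro x ⟨i, t, ht, rfl⟩
    rw [Int.abs_eq_natAbs] at ht
    have h0 : t ≠ 0 := by rintro rfl; simp at ht; omega
    rw [← toOp_vecV hON h0]
    exact ⟨_, wvec_mem hON fun _ _ => by simp; omega, rfl⟩

theorem wordOp_mem_Walpha {w : RWord} {l : ℕ} (h1 : w.len = l) (h2 : vCount w.1 = 1)
    (h3 : l ≤ vLength w.1 + 1) : wordOp u v w.1 ∈ Walpha u v l ⊔ Wv v l := by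
  obtain ⟨w, hw⟩ := w
  simp only [RWord.len] at h1 h2 h3
  have h4 := vLength_le_wordLength w
  rcases (by omega : vLength w = wordLength w ∨ vLength w + 1 = wordLength w) with h5 | h5
  · obtain ⟨i, t, ht, h6, rfl⟩ := eq_of_vLength_eq hw h2 h5
    refine Submodule.mem_sup_right (Submodule.subset_span ⟨i, t, ?_, by simp [sylOp]⟩)
    rw [Int.abs_eq_natAbs]; omega
  · obtain ⟨i, t, c, ht, h6, h7⟩ := eq_of_vLength_add_one hw h2 h5
    have hc : |(c.2 : ℤ)| = 1 := by rcases unit_cases c.2 with h | h <;> simp [h]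
    refine Submodule.mem_sup_left (Submodule.subset_span ⟨c.1, i, c.2, t, hc,
      by rw [Int.abs_eq_natAbs]; omega, ?_⟩)
    rcases h7 with ⟨rfl, rfl⟩ | ⟨-, rfl⟩ | ⟨-, rfl⟩
    · left; simp [sylOp]
    · left; simp [sylOp]
    · right; simp [sylOp]

include hd huv in
-- The words of W_l^1 with at most one letter u are exactly those removed. As words are orthonormal,
-- the orthogonal difference is spanned by the remaining ones.
theorem Wbeta_eq_map {l : ℕ} (hl : 1 ≤ l) : Wbeta u v Ω l =
    (gradedSpan hON (fun a h => a = 1 ∧ h + 2 ≤ l) l).map (toOp hON) := by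
  have hb := orthonormal_wordBasis hON
  ext X
  rw [Wbeta, W_eq_map hON, wspan_typeSet, mem_ominus_map]
  constructor
  · rintro ⟨x, hx, h, rfl⟩
    refine ⟨x, mem_wspan_iff.2 fun w hw => ?_, rfl⟩
    have h1 := mem_wspan_iff.1 hx w hw
    refine ⟨h1.1, by have := h1.2; omega, ?_⟩
    by_contra h2
    refine hw ?_
    rw [repr_eq_inner hb]
    change ⟪(wordBasis hON w : H), x⟫_ℂ = 0
    rw [coe_wordBasis]
    refine Submodule.inner_right_of_mem_orthogonal ?_ h
    exact ⟨_, wordOp_mem_Walpha h1.1 (by have := h1.2; omega) (by omega), rfl⟩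
  · rintro ⟨x, hx, rfl⟩
    refine ⟨x, gradedSpan_mono hON (fun a b h => by rw [h.1]; rfl) _ hx, ?_, rfl⟩
    rw [Submodule.mem_orthogonal]
    rintro _ ⟨X, hX, rfl⟩
    obtain ⟨y, hy, rfl⟩ := exists_toOp_of_mem_Walpha hON hd huv hl hX
    change ⟪toOp hON y Ω, (x : H)⟫_ℂ = 0
    rw [toOp_apply]
    refine inner_eq_zero_of_disjoint hb ?_ hy hx
    rw [Set.disjoint_left]
    rintro w h1 ⟨-, h2, h3⟩
    have := h1 h2
    omega

theorem Walpha2_eq_map (l : ℕ) : Walpha2 u v l =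
    (kindSpan hON hd Kind.alphaTwo l).map (toOp hON) := by
  rw [kindSpan, Submodule.map_span, Walpha2]
  congr 1
  have hL : ∀ (i : Fin 2) {m : ℤ}, m ≠ 0 → toOp hON (vecL hON i 1 m - vecL hON i (-1) m) =
      uMinus u (1 - i) * uPow v i m := fun i m hm => by
    rw [map_sub, toOp_vecL hON hm, toOp_vecL hON hm, uMinus, sub_mul]; rfl
  have hR : ∀ (i : Fin 2) {m : ℤ}, m ≠ 0 → toOp hON (vecR hON i 1 m - vecR hON i (-1) m) =
      uPow v i m * uMinus u (1 - i) := fun i m hm => by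
    rw [map_sub, toOp_vecR hON hm, toOp_vecR hON hm, uMinus, mul_sub]; rfl
  ext X
  constructor
  · rintro ⟨hl, i, t, ht, hX⟩
    rw [Int.abs_eq_natAbs] at ht
    have h0 : t ≠ 0 := by rintro rfl; simp at ht; omega
    rcases hX with rfl | rfl
    · exact ⟨_, ⟨i, t, h0, by omega, Or.inl rfl⟩, hL i h0⟩
    · exact ⟨_, ⟨i, t, h0, by omega, Or.inr rfl⟩, hR i h0⟩
  · rintro ⟨_, ⟨i, m, hm, rfl, rfl | rfl⟩, rfl⟩
    · exact ⟨by omega, i, m, by simp, Or.inl (hL i hm)⟩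
    · exact ⟨by omega, i, m, by simp, Or.inr (hR i hm)⟩

include huv in
-- The passage from operators to vectors: from here on the bases are taken in spaces on which `up`
-- and `dn` act.
theorem N_eq_map (κ : Kind) {l : ℕ} (hl : 1 ≤ l) :
    N u v Ω κ l = (kindSpan hON hd κ l).map (toOp hON) := by
  cases κ
  · rw [N, W_eq_map hON, wspan_typeSet, ominus_S_eq_map hON hd huv le_rfl, kindSpan]
    simp
  · rw [N, W_eq_map hON, wspan_typeSet, ominus_S_eq_map hON hd huv le_rfl, kindSpan]
    simp
  · rw [N, Walpha2_eq_map hON hd, ominus_S_eq_map hON hd huv, inf_eq_left.2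
      (kindSpan_le_dnKer hON hd _ _)]
    refine (kindSpan_le_gradedSpan hON hd _ _).trans (gradedSpan_mono hON ?_ _)
    rintro a b ⟨rfl, -⟩
    rfl
  · rw [N, Wbeta_eq_map hON hd huv hl, ominus_S_eq_map hON hd huv, kindSpan]
    refine gradedSpan_mono hON ?_ _
    rintro a b ⟨rfl, -⟩
    rfl

end KindSpans

/-! ### Two supplements on letter actions -/

section Operators

variable {X E : Type*} [NormedAddCommGroup E] [InnerProductSpace ℂ E] {len : X → ℕ}
variable {α β : LetterAction len} {b : Module.Basis X ℂ E} {G : Set X}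

/-- With the root part absent, `dn ∘ up` is multiplication by 3. -/
theorem LetterAction.inner_up_pow_of_root (hb : Orthonormal ℂ b) {y : E} (hy : α.root b y = 0)
    (r : ℕ) (x : E) : ⟪(α.up b ^ r) x, (α.up b ^ r) y⟫_ℂ = 3 ^ r * ⟪x, y⟫_ℂ := by
  induction r with
  | zero => simp
  | succ r ih =>
    have h0 : α.root b ((α.up b ^ r) y) = 0 := by
      cases r with
      | zero => exact hy
      | succ r => rw [pow_succ_up, root_up]
    rw [pow_succ_up, pow_succ_up, inner_up_left α hb, dn_up, h0, add_zero, inner_smul_right, ih]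
    ring

/-- The two multiplications commute; removing from both products the part that lengthens twice,
equal by `up_up`, leaves this. It holds also where genericity fails, as for single letters. -/
theorem LetterAction.Compatible.dn_up_comm (h : α.Compatible β G) {x : E} (hα : α.dn b x = 0)
    (hβ : β.dn b x = 0) : α.dn b (β.up b x) = β.dn b (α.up b x) := by
  have h1 := h.total_total (b := b) x
  simp only [total_apply, hα, hβ, add_zero] at h1
  rw [h.up_up] at h1
  exact add_left_cancel h1

end Operators

/-! ### Combinations of single letters and the operator `flip` -/

section Letters

variable {H : Type*} [NormedAddCommGroup H] [InnerProductSpace ℂ H] [CompleteSpace H]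
variable {u v : Fin 2 → unitary (H →L[ℂ] H)} {Ω : H}
variable (hON : Orthonormal ℂ fun w : RWord => wordOp u v w.1 Ω)
variable {d : ℂ} (hd : ‖d‖ = 1)
variable (huv : ∀ i, (u i : H →L[ℂ] H) * (v i : H →L[ℂ] H) =
      d • ((v i : H →L[ℂ] H) * (u i : H →L[ℂ] H)))

theorem dn_nil (α : LetterAction RWord.len) :
    α.dn (wordBasis hON) (wordBasis hON RWord.nil) = 0 :=
  α.dn_basis_of_root _ fun ⟨_, hc⟩ => Nat.not_lt_zero _ hc

theorem nil_lt (α : LetterAction RWord.len) (c : Letter) :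
    RWord.nil.len < (α.act c RWord.nil).len := by
  rw [← α.not_lt_iff]; exact Nat.not_lt_zero _

include huv in
theorem right_up_nil : (rightAction d hd).up (wordBasis hON) (wordBasis hON RWord.nil) =
    leftAction.up (wordBasis hON) (wordBasis hON RWord.nil) := by
  have h1 := LetterAction.total_apply (rightAction d hd) (wordBasis hON) (wordBasis hON RWord.nil)
  have h2 := LetterAction.total_apply leftAction (wordBasis hON) (wordBasis hON RWord.nil)
  rw [dn_nil, add_zero] at h1 h2
  rw [← h1, ← h2]
  apply toOp_injective hON
  rw [toOp_left_total, toOp_right_total hON hd huv, toOp_basis]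
  simp [RWord.nil]

/-- A combination of letters orthogonal to `χ₁`. -/
abbrev letterSpan : Submodule ℂ (wordSpan u v Ω) := kindSpan hON hd Kind.zero 1

/-- The operator `x ↦ (q₂ (x χ₁))` followed by the left shortening operator. -/
def flip : Module.End ℂ (wordSpan u v Ω) :=
  leftAction.dn (wordBasis hON) ∘ₗ (rightAction d hd).up (wordBasis hON)

theorem flip_apply (x : wordSpan u v Ω) : flip hON hd x =
    leftAction.dn (wordBasis hON) ((rightAction d hd).up (wordBasis hON) x) := rfl

variable {hON hd}

theorem flip_eq {x : wordSpan u v Ω} (hx : x ∈ letterSpan hON hd) : flip hON hd x =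
    (rightAction d hd).dn (wordBasis hON) (leftAction.up (wordBasis hON) x) := by
  have h := (mem_dnKer hON hd).1 (kindSpan_le_dnKer hON hd _ _ hx)
  rw [flip_apply, (compatible d hd).dn_up_comm h.1 h.2]

theorem generic_of_gradedSpan_zero {l : ℕ} (hl : 2 ≤ l) {x : wordSpan u v Ω}
    (hx : x ∈ gradedSpan hON (fun a _ => a = 0) l) :
    x ∈ wspan (wordBasis hON) {w | IsGeneric w.1} := by
  refine wspan_mono (fun w hw => isGeneric_of_wordLength ?_) hx
  have h1 := hw.1; have h2 := vLength_eq_zero hw.2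
  simp only [RWord.len] at h1; omega

/-- After one lengthening the words have length at least 2 and are generic, so `dn` passes through
the other s factors; only the innermost one meets the exceptional words. -/
theorem left_dn_right_up_pow_succ {x : wordSpan u v Ω} (hx : x ∈ letterSpan hON hd) (s : ℕ) :
    leftAction.dn (wordBasis hON) (((rightAction d hd).up (wordBasis hON) ^ (s + 1)) x) =
      ((rightAction d hd).up (wordBasis hON) ^ s) (flip hON hd x) := by
  rw [pow_succ, Module.End.mul_apply, (compatible d hd).dn_up_pow_of_mem]
  · rfl
  · exact generic_of_gradedSpan_zero le_rfl (right_up_mem_gradedSpan hON hd hx.1)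

theorem right_dn_left_up_pow_succ {x : wordSpan u v Ω} (hx : x ∈ letterSpan hON hd) (s : ℕ) :
    (rightAction d hd).dn (wordBasis hON) ((leftAction.up (wordBasis hON) ^ (s + 1)) x) =
      (leftAction.up (wordBasis hON) ^ s) (flip hON hd x) := by
  rw [pow_succ, Module.End.mul_apply, (compatible d hd).symm.dn_up_pow_of_mem, ← flip_eq hx]
  exact generic_of_gradedSpan_zero le_rfl (left_up_mem_gradedSpan hON hx.1)

include huv

/-- Orthogonality to χ₁ is moved by adjoints to the pairing of χ₂ with a lengthening of x. As χ₂ can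
be lengthened from the same side, `dn_up` reduces this to 3 times the pairing of χ₁ with x, which is
zero. -/
theorem flip_mem {x : wordSpan u v Ω} (hx : x ∈ letterSpan hON hd) :
    flip hON hd x ∈ letterSpan hON hd := by
  have hb := orthonormal_wordBasis hON
  have hx0 := (mem_dnKer hON hd).1 hx.2
  have h1 : flip hON hd x ∈ gradedSpan hON (fun a _ => a = 0) 1 :=
    left_dn_mem_gradedSpan hON (right_up_mem_gradedSpan hON hd hx.1)
  have hnil : ∀ y ∈ gradedSpan hON (fun a _ => a = 0) 0, ⟪wordBasis hON RWord.nil, y⟫_ℂ = 0 →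
      y = 0 := by
    intro y hy h
    refine ext_inner_basis (b := wordBasis hON) fun w => ?_
    rw [inner_zero_right]
    by_cases hw : w = RWord.nil
    · rw [hw, h]
    · by_contra h2
      rw [← repr_eq_inner hb] at h2
      exact hw (RWord.ext (eq_nil_of_wordLength w.2 (mem_wspan_iff.1 hy w h2).1))
  -- Both sides are χ₂.
  have hAA : leftAction.up (wordBasis hON) (leftAction.up (wordBasis hON)
      (wordBasis hON RWord.nil)) = (rightAction d hd).up (wordBasis hON)
        ((rightAction d hd).up (wordBasis hON) (wordBasis hON RWord.nil)) := by
    rw [right_up_nil hON hd huv, ← (compatible d hd).up_up, right_up_nil hON hd huv]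
  refine ⟨h1, (mem_dnKer hON hd).2 ⟨hnil _ (left_dn_mem_gradedSpan hON h1) ?_,
    hnil _ (right_dn_mem_gradedSpan hON hd h1) ?_⟩⟩
  · rw [← LetterAction.inner_up_left _ hb, flip_apply, ← LetterAction.inner_up_left _ hb, hAA,
      LetterAction.inner_up_left _ hb, LetterAction.dn_up, right_root_eq_zero hON hd hx.1,
      add_zero, inner_smul_right, LetterAction.inner_up_left _ hb, hx0.2, inner_zero_right, mul_zero]
  · rw [← LetterAction.inner_up_left _ hb, flip_eq hx, ← LetterAction.inner_up_left _ hb, ← hAA,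
      LetterAction.inner_up_left _ hb, LetterAction.dn_up, left_root_eq_zero hON hx.1,
      add_zero, inner_smul_right, LetterAction.inner_up_left _ hb, hx0.1, inner_zero_right, mul_zero]

theorem flip_pow_mem {x : wordSpan u v Ω} (hx : x ∈ letterSpan hON hd) (t : ℕ) :
    (flip hON hd ^ t) x ∈ letterSpan hON hd := by
  induction t with
  | zero => exact hx
  | succ t ih => rw [pow_succ', Module.End.mul_apply]; exact flip_mem huv ih

omit huv in
-- On the right u_c is lengthened by every letter except its inverse; removing u_c again leaves χ₁
-- without that inverse letter.
theorem flip_basis (c : Letter) :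
    flip hON hd (wordBasis hON (leftAction.act c RWord.nil)) =
      (rightAction d hd).up (wordBasis hON) (wordBasis hON RWord.nil) -
        (rightAction d hd).wt (letterInv c) RWord.nil •
          wordBasis hON ((rightAction d hd).act (letterInv c) RWord.nil) := by
  have key : ∀ c', leftAction.dn (wordBasis hON) (if (leftAction.act c RWord.nil).len <
      ((rightAction d hd).act c' (leftAction.act c RWord.nil)).len then
        (rightAction d hd).wt c' (leftAction.act c RWord.nil) •
          wordBasis hON ((rightAction d hd).act c' (leftAction.act c RWord.nil)) else 0) =
      if c' = letterInv c then 0 else (rightAction d hd).wt c' RWord.nil •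
        wordBasis hON ((rightAction d hd).act c' RWord.nil) := by
    intro c'
    have h1 : ((rightAction d hd).act c' (leftAction.act c RWord.nil)).len <
        (leftAction.act c RWord.nil).len ↔ c' = letterInv c := by
      rw [right_descent_iff]
      simp only [leftAction, RWord.nil, lmul, List.reverse_singleton, IsLeftDescent,
        List.cons.injEq, Prod.mk.injEq]
      constructor
      · rintro ⟨k, l, t, ⟨⟨h1, rfl, -⟩, -⟩, h2⟩
        refine Prod.ext h1.symm (Units.ext ?_)
        rcases unit_cases c.2 with h | h <;> rcases unit_cases c'.2 with h' | h' <;>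
          simp [h, h'] at h2 ⊢
      · rintro rfl
        exact ⟨c.2, 0, [], ⟨⟨rfl, rfl, rfl⟩, rfl⟩, unit_mul_neg_self c.2⟩
    by_cases h2 : c' = letterInv c
    · rw [if_neg (h1.2 h2).not_gt, if_pos h2, map_zero]
    · rw [if_neg h2]
      rw [← h1, (rightAction d hd).not_lt_iff] at h2
      rw [if_pos h2]
      have e : leftAction.act (letterInv c)
          ((rightAction d hd).act c' (leftAction.act c RWord.nil)) =
          (rightAction d hd).act c' RWord.nil := by
        rw [(compatible d hd).comm, leftAction.act_inv]
      have h3 := (rightAction d hd).len_lt_iff.1 h2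
      have h4 := leftAction.len_lt_iff.1 (nil_lt leftAction c)
      have h5 := (rightAction d hd).len_lt_iff.1 (nil_lt (rightAction d hd) c')
      rw [map_smul, leftAction.dn_basis_of_descent (c := letterInv c) _ (by rw [e]; omega), e,
        (compatible d hd).wt_right]
      exact congrArg _ (one_smul _ _)
  rw [flip_apply, LetterAction.up_basis, LetterAction.up_basis, map_sum,
    Finset.sum_congr rfl fun c' _ => key c', eq_sub_iff_add_eq,
    Finset.sum_congr rfl fun c' _ => if_pos (nil_lt (rightAction d hd) c'),
    ← Finset.sum_erase_add _ _ (Finset.mem_univ (letterInv c)), if_pos rfl, add_zero,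
    ← Finset.sum_erase_add _ _ (Finset.mem_univ (letterInv c))]
  congr 1
  exact Finset.sum_congr rfl fun c' hc' => if_neg (Finset.ne_of_mem_erase hc')

omit huv in
theorem exists_letter_coeff {x : wordSpan u v Ω} (hx : x ∈ gradedSpan hON (fun a _ => a = 0) 1) :
    ∃ a : Letter → ℂ, x = ∑ c, a c • wordBasis hON (leftAction.act c RWord.nil) := by
  have : gradedSpan hON (fun a _ => a = 0) 1 ≤ Submodule.span ℂ
      (Set.range fun c => wordBasis hON (leftAction.act c RWord.nil)) := by
    refine Submodule.span_le.2 ?_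
    rintro _ ⟨w, hw, rfl⟩
    obtain ⟨c, hc⟩ := eq_letter_of_wordLength w.2 hw.2 hw.1
    exact Submodule.subset_span ⟨c, congrArg _ (RWord.ext hc.symm)⟩
  obtain ⟨a, ha⟩ := (Submodule.mem_span_range_iff_exists_fun ℂ).1 (this hx)
  exact ⟨a, ha.symm⟩

omit huv in
theorem act_nil_injective (α : LetterAction RWord.len) :
    Function.Injective fun c => α.act c RWord.nil := by
  intro c c' h
  have h1 : ∀ c, (α.act (letterInv c) (α.act c RWord.nil)).len < (α.act c RWord.nil).len := by
    intro c
    rw [α.act_inv]; exact nil_lt α c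
  have h2 := h1 c'
  rw [show α.act c' RWord.nil = α.act c RWord.nil from h.symm] at h2
  have := α.descent_unique _ _ _ (h1 c) h2
  rw [← letterInv_letterInv c, this, letterInv_letterInv]

omit huv in
theorem norm_sq_sum_letters (α : LetterAction RWord.len) (e : Letter ≃ Letter) (a : Letter → ℂ)
    (z : Letter → ℂ) (hz : ∀ c, ‖z c‖ = 1) :
    ‖∑ c, a c • z c • wordBasis hON (α.act (e c) RWord.nil)‖ ^ 2 = ∑ c, ‖a c‖ ^ 2 := by
  have h : Orthonormal ℂ fun c => wordBasis hON (α.act (e c) RWord.nil) :=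
    (orthonormal_wordBasis hON).comp _ ((act_nil_injective α).comp e.injective)
  have := h.inner_sum (fun c => a c * z c) (fun c => a c * z c) Finset.univ
  simp only [smul_smul]
  refine RCLike.ofReal_injective (K := ℂ) ?_
  rw [RCLike.ofReal_pow, ← inner_self_eq_norm_sq_to_K, this, RCLike.ofReal_sum]
  refine Finset.sum_congr rfl fun c _ => ?_
  rw [RCLike.conj_mul, norm_mul, hz, mul_one, RCLike.ofReal_pow]

omit huv in
-- The coefficients of x sum to zero, so the χ₁ terms of `flip_basis` cancel: up to sign, `flip`
-- just replaces each letter by its inverse.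
theorem norm_flip {x : wordSpan u v Ω} (hx : x ∈ letterSpan hON hd) : ‖flip hON hd x‖ = ‖x‖ := by
  obtain ⟨a, rfl⟩ := exists_letter_coeff hx.1
  have h0 := ((mem_dnKer hON hd).1 hx.2).1
  have hdn : ∀ c, leftAction.dn (wordBasis hON) (wordBasis hON (leftAction.act c RWord.nil)) =
      wordBasis hON RWord.nil := by
    intro c
    rw [leftAction.dn_basis_of_descent (c := letterInv c) _ (by
      rw [leftAction.act_inv]; exact nil_lt leftAction c), leftAction.act_inv]
    exact one_smul _ _
  have hsum : ∑ c, a c = 0 := by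
    simp only [map_sum, map_smul, hdn, ← Finset.sum_smul] at h0
    exact (smul_eq_zero.1 h0).resolve_right ((orthonormal_wordBasis hON).ne_zero _)
  have h1 : flip hON hd (∑ c, a c • wordBasis hON (leftAction.act c RWord.nil)) =
      -∑ c, a c • (rightAction d hd).wt (letterInv c) RWord.nil •
        wordBasis hON ((rightAction d hd).act (LetterAction.letterInvEquiv c) RWord.nil) := by
    simp only [map_sum, map_smul, flip_basis, smul_sub, Finset.sum_sub_distrib, ← Finset.sum_smul,
      hsum, zero_smul, zero_sub]
    rfl
  have h2 := norm_sq_sum_letters (hON := hON) (rightAction d hd) LetterAction.letterInvEquiv a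
    (fun c => (rightAction d hd).wt (letterInv c) RWord.nil)
    (fun c => (rightAction d hd).norm_wt _ _)
  have h3 := norm_sq_sum_letters (hON := hON) leftAction (Equiv.refl _) a (fun _ => 1) (by simp)
  simp only [one_smul, Equiv.refl_apply] at h3
  rw [h1, norm_neg, ← sq_eq_sq₀ (norm_nonneg _) (norm_nonneg _), h2, h3]

/-- Each left shortening consumes one right lengthening and leaves one `flip`. -/
theorem left_dn_pow_right_up {x : wordSpan u v Ω} (hx : x ∈ letterSpan hON hd) (s t : ℕ) :
    (leftAction.dn (wordBasis hON) ^ t) (((rightAction d hd).up (wordBasis hON) ^ (s + t)) x) =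
      ((rightAction d hd).up (wordBasis hON) ^ s) ((flip hON hd ^ t) x) := by
  induction t generalizing x with
  | zero => rfl
  | succ t ih =>
    rw [pow_succ, Module.End.mul_apply, ← add_assoc, left_dn_right_up_pow_succ hx,
      ih (flip_mem huv hx), pow_succ, Module.End.mul_apply]

/-- The inner products of the shifts of combinations of letters. -/
theorem inner_shift_letterSpan (x : wordSpan u v Ω) {y : wordSpan u v Ω}
    (hy : y ∈ letterSpan hON hd) (r s t : ℕ) :
    ⟪(leftAction.up (wordBasis hON) ^ (r + t))
        (((rightAction d hd).up (wordBasis hON) ^ s) x),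
      (leftAction.up (wordBasis hON) ^ r)
        (((rightAction d hd).up (wordBasis hON) ^ (s + t)) y)⟫_ℂ =
      3 ^ (r + s) * ⟪x, (flip hON hd ^ t) y⟫_ℂ := by
  have hb := orthonormal_wordBasis hON
  have hBg : ∀ s, ∀ x ∈ letterSpan hON hd, ((rightAction d hd).up (wordBasis hON) ^ s) x ∈
      gradedSpan hON (fun a _ => a = 0) (s + 1) := by
    intro s
    induction s with
    | zero => exact fun x hx => hx.1
    | succ s ih => intro x hx; rw [LetterAction.pow_succ_up]; exact right_up_mem_gradedSpan hON hd (ih x hx)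
  have hpow : ∀ t z w, ⟪(leftAction.up (wordBasis hON) ^ t) z, w⟫_ℂ =
      ⟪z, (leftAction.dn (wordBasis hON) ^ t) w⟫_ℂ := by
    intro t
    induction t with
    | zero => intro z w; rfl
    | succ t ih =>
      intro z w
      rw [LetterAction.pow_succ_up, LetterAction.inner_up_left _ hb, ih, pow_succ, Module.End.mul_apply]
  rw [add_comm r t, pow_add, Module.End.mul_apply]
  -- Non-trivial words in the letters u are never roots, so common powers of `up` contribute exact
  -- powers of 3.
  have hroot := left_root_eq_zero hON (hBg (s + t) y hy)
  rw [← Module.End.mul_apply, ← pow_add, add_comm t r, pow_add, Module.End.mul_apply,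
    LetterAction.inner_up_pow_of_root hb hroot, hpow, left_dn_pow_right_up huv hy,
    LetterAction.inner_up_pow_of_root hb
      (right_root_eq_zero hON hd (flip_pow_mem huv hy t).1)]
  ring

end Letters

/-! ### Orthogonality and totality of the shifts -/

section Decomposition

variable {H : Type*} [NormedAddCommGroup H] [InnerProductSpace ℂ H] [CompleteSpace H]
variable {u v : Fin 2 → unitary (H →L[ℂ] H)} {Ω : H}
variable (hON : Orthonormal ℂ fun w : RWord => wordOp u v w.1 Ω)
variable {d : ℂ} (hd : ‖d‖ = 1)
variable (huv : ∀ i, (u i : H →L[ℂ] H) * (v i : H →L[ℂ] H) =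
      d • ((v i : H →L[ℂ] H) * (u i : H →L[ℂ] H)))

theorem shift_mem_gradedSpan {p : ℕ → ℕ → Prop} {l : ℕ} {x : wordSpan u v Ω}
    (hx : x ∈ gradedSpan hON p l) (r s : ℕ) : (leftAction.up (wordBasis hON) ^ r)
      (((rightAction d hd).up (wordBasis hON) ^ s) x) ∈ gradedSpan hON p (l + r + s) := by
  have h1 : ((rightAction d hd).up (wordBasis hON) ^ s) x ∈ gradedSpan hON p (l + s) := by
    induction s with
    | zero => exact hx
    | succ s ih => rw [LetterAction.pow_succ_up]; exact right_up_mem_gradedSpan hON hd ih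
  induction r with
  | zero => exact h1
  | succ r ih =>
    rw [LetterAction.pow_succ_up, show l + (r + 1) + s = l + r + s + 1 by ring]
    exact left_up_mem_gradedSpan hON ih

theorem inner_gradedSpan {p p' : ℕ → ℕ → Prop} {l l' : ℕ} {x y : wordSpan u v Ω}
    (hx : x ∈ gradedSpan hON p l) (hy : y ∈ gradedSpan hON p' l')
    (h : l ≠ l' ∨ ∀ a b, p a b → ¬ p' a b) : ⟪x, y⟫_ℂ = 0 := by
  refine inner_eq_zero_of_disjoint (orthonormal_wordBasis hON) ?_ hx hy
  rw [Set.disjoint_left]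
  rintro w ⟨h1, h2⟩ ⟨h3, h4⟩
  rcases h with h | h
  · exact h (h1.symm.trans h3)
  · exact h _ _ h2 h4

theorem not_kindProp {κ κ' : Kind} (h : κ ≠ κ') (l a b : ℕ) (h1 : kindProp κ l a b) :
    ¬ kindProp κ' l a b := by
  cases κ <;> cases κ' <;> simp only [kindProp, ne_eq, not_true_eq_false] at * <;> omega

theorem not_kindProp_zero {κ : Kind} (h : κ ≠ Kind.zero) (l l' a b : ℕ)
    (h1 : kindProp Kind.zero l a b) : ¬ kindProp κ l' a b := by
  cases κ <;> simp only [kindProp, ne_eq, not_true_eq_false] at * <;> omega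

/-- The shifts of vectors from different spaces are orthogonal, and so are different shifts,
unless both vectors are combinations of letters. -/
theorem inner_shift_kindSpan {κ κ' : Kind} {l l' r s r' s' : ℕ} {x y : wordSpan u v Ω}
    (hx : x ∈ kindSpan hON hd κ l) (hy : y ∈ kindSpan hON hd κ' l')
    (hgood : κ ≠ Kind.zero ∨ 2 ≤ l) (hl' : 1 ≤ l')
    (hne : (r, s) ≠ (r', s') ∨ (κ, l) ≠ (κ', l')) :
    ⟪(leftAction.up (wordBasis hON) ^ r) (((rightAction d hd).up (wordBasis hON) ^ s) x),
      (leftAction.up (wordBasis hON) ^ r') (((rightAction d hd).up (wordBasis hON) ^ s') y)⟫_ℂ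
      = 0 := by
  have hb := orthonormal_wordBasis hON
  have hx' := shift_mem_gradedSpan hON hd (kindSpan_le_gradedSpan hON hd κ l hx) r s
  have hy' := shift_mem_gradedSpan hON hd (kindSpan_le_gradedSpan hON hd κ' l' hy) r' s'
  have hxp := kindSpan_le_prim hON hd hgood hx
  by_cases hlen : l + r + s = l' + r' + s'
  swap
  · exact inner_gradedSpan hON hx' hy' (Or.inl hlen)
  by_cases hrs : (r, s) = (r', s')
  · simp only [Prod.mk.injEq] at hrs
    obtain ⟨rfl, rfl⟩ := hrs
    have hl : l = l' := by omega
    subst hl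
    have hκ : κ ≠ κ' := by rintro rfl; simp at hne
    exact inner_gradedSpan hON hx' hy' (Or.inr (not_kindProp hκ l))
  · by_cases hgood' : κ' ≠ Kind.zero ∨ 2 ≤ l'
    · exact (compatible d hd).inner_shift hb hxp (kindSpan_le_prim hON hd hgood' hy) hrs
    · push Not at hgood'
      obtain ⟨rfl, h2⟩ := hgood'
      have hl1 : l' = 1 := by omega
      subst hl1
      by_cases hκ : κ = Kind.zero
      · subst hκ
        have h2l : 2 ≤ l := by simpa using hgood
        -- The total lengths agree and l' = 1 < l, so on one side y is shifted further than x. There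
        -- it is enough that x is primitive.
        rcases (by omega : r < r' ∨ s < s') with h | h
        · obtain ⟨t, rfl⟩ := Nat.exists_eq_add_of_lt h
          exact (compatible d hd).inner_shift_left hb hxp r s t _
        · obtain ⟨t, rfl⟩ := Nat.exists_eq_add_of_lt h
          rw [(compatible d hd).up_pow_up_pow _ r s, (compatible d hd).up_pow_up_pow _ r']
          exact (compatible d hd).symm.inner_shift_left hb
            (LetterAction.mem_primitive_symm hxp) s r t _
      · exact inner_gradedSpan hON hx' hy'
          (Or.inr fun a b h1 h2 => not_kindProp_zero hκ 1 l a b h2 h1)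

/-! ### The span of the shifts -/

/-- The sum of the spaces of vectors which are shifted. -/
def kernelSpan : Submodule ℂ (wordSpan u v Ω) :=
  ⨆ p : {p : Kind × ℕ // 1 ≤ p.2}, kindSpan hON hd p.1.1 p.1.2

/-- The span of all shifts. -/
def rieszSpan : Submodule ℂ (wordSpan u v Ω) :=
  LetterAction.shiftSpan leftAction (rightAction d hd) (wordBasis hON) (kernelSpan hON hd)

variable {hON hd}

theorem kindSpan_le_kernelSpan {κ : Kind} {l : ℕ} (hl : 1 ≤ l) :
    kindSpan hON hd κ l ≤ kernelSpan hON hd :=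
  le_iSup (fun p : {p : Kind × ℕ // 1 ≤ p.2} => kindSpan hON hd p.1.1 p.1.2) ⟨(κ, l), hl⟩

theorem shift_mem_rieszSpan {κ : Kind} {l : ℕ} (hl : 1 ≤ l) {x : wordSpan u v Ω}
    (hx : x ∈ kindSpan hON hd κ l) (r s : ℕ) : (leftAction.up (wordBasis hON) ^ r)
      (((rightAction d hd).up (wordBasis hON) ^ s) x) ∈ rieszSpan hON hd :=
  LetterAction.shift_mem_shiftSpan (kindSpan_le_kernelSpan hl hx) r s

theorem rieszSpan_le {T : Submodule ℂ (wordSpan u v Ω)}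
    (h : ∀ κ l, 1 ≤ l → ∀ x ∈ kindSpan hON hd κ l, ∀ r s, (leftAction.up (wordBasis hON) ^ r)
      (((rightAction d hd).up (wordBasis hON) ^ s) x) ∈ T) : rieszSpan hON hd ≤ T := by
  refine Submodule.span_le.2 ?_
  rintro _ ⟨r, s, x, hx, rfl⟩
  have : kernelSpan hON hd ≤ T.comap ((leftAction.up (wordBasis hON) ^ r) ∘ₗ
      ((rightAction d hd).up (wordBasis hON) ^ s)) :=
    iSup_le fun p x hx => h p.1.1 p.1.2 p.2 x hx r s
  exact this hx

theorem eq_zero_one_of_not_good {κ : Kind} {l : ℕ} (hl : 1 ≤ l)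
    (h : ¬ (κ ≠ Kind.zero ∨ 2 ≤ l)) : κ = Kind.zero ∧ l = 1 := by
  push Not at h
  exact ⟨h.1, by omega⟩

include huv

/-- On generic kernels `dn` passes through the right lengthenings and gives zero; on letters it
gives a `flip`, again an admissible combination of letters. The `root` terms stay in the same
spaces. -/
theorem left_dn_mem_rieszSpan {y : wordSpan u v Ω} (hy : y ∈ rieszSpan hON hd) :
    leftAction.dn (wordBasis hON) y ∈ rieszSpan hON hd := by
  refine LetterAction.dn_mem_shiftSpan (fun x hx s => ?_) (fun x hx s => ?_) hy
  · have : kernelSpan hON hd ≤ (rieszSpan hON hd).comap (leftAction.dn (wordBasis hON) ∘ₗ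
        ((rightAction d hd).up (wordBasis hON) ^ s)) := by
      refine iSup_le fun ⟨⟨κ, l⟩, hl⟩ x hx => ?_
      change leftAction.dn (wordBasis hON) (((rightAction d hd).up (wordBasis hON) ^ s) x) ∈
          rieszSpan hON hd
      by_cases hg : κ ≠ Kind.zero ∨ 2 ≤ l
      · have hxp := kindSpan_le_prim hON hd hg hx
        rw [(compatible d hd).dn_up_pow_of_mem hxp.1, ((mem_dnKer hON hd).1 hxp.2).1, map_zero]
        exact zero_mem _
      · obtain ⟨rfl, rfl⟩ := eq_zero_one_of_not_good hl hg
        rcases s with _ | s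
        · change leftAction.dn (wordBasis hON) x ∈
            rieszSpan hON hd
          rw [((mem_dnKer hON hd).1 hx.2).1]; exact zero_mem _
        · rw [left_dn_right_up_pow_succ hx]
          exact shift_mem_rieszSpan le_rfl (flip_mem huv hx) 0 s
    exact this hx
  · have : kernelSpan hON hd ≤ (rieszSpan hON hd).comap (leftAction.root (wordBasis hON) ∘ₗ
        ((rightAction d hd).up (wordBasis hON) ^ s)) := by
      refine iSup_le fun ⟨⟨κ, l⟩, hl⟩ x hx => ?_
      change leftAction.root (wordBasis hON) (((rightAction d hd).up (wordBasis hON) ^ s) x) ∈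
          rieszSpan hON hd
      by_cases hg : κ ≠ Kind.zero ∨ 2 ≤ l
      · rw [(compatible d hd).root_up_pow_of_mem (kindSpan_le_prim hON hd hg hx).1]
        exact shift_mem_rieszSpan hl (left_root_mem_kindSpan hON hd hl hx) 0 s
      · obtain ⟨rfl, rfl⟩ := eq_zero_one_of_not_good hl hg
        have h1 := shift_mem_gradedSpan hON hd hx.1 0 s
        rw [show 1 + 0 + s = s + 1 by ring] at h1
        have h2 := left_root_eq_zero hON h1
        rw [pow_zero, Module.End.one_apply] at h2
        rw [h2]; exact zero_mem _
    exact this hx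

theorem right_dn_mem_rieszSpan {y : wordSpan u v Ω} (hy : y ∈ rieszSpan hON hd) :
    (rightAction d hd).dn (wordBasis hON) y ∈ rieszSpan hON hd := by
  have hsymm : rieszSpan hON hd = LetterAction.shiftSpan (rightAction d hd) leftAction
      (wordBasis hON) (kernelSpan hON hd) := (compatible d hd).shiftSpan_symm _
  rw [hsymm] at hy ⊢
  refine LetterAction.dn_mem_shiftSpan (fun x hx s => ?_) (fun x hx s => ?_) hy
  · have : kernelSpan hON hd ≤ (rieszSpan hON hd).comap ((rightAction d hd).dn (wordBasis hON) ∘ₗ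
        (leftAction.up (wordBasis hON) ^ s)) := by
      refine iSup_le fun ⟨⟨κ, l⟩, hl⟩ x hx => ?_
      change (rightAction d hd).dn (wordBasis hON) ((leftAction.up (wordBasis hON) ^ s) x) ∈
          rieszSpan hON hd
      by_cases hg : κ ≠ Kind.zero ∨ 2 ≤ l
      · have hxp := kindSpan_le_prim hON hd hg hx
        rw [(compatible d hd).symm.dn_up_pow_of_mem hxp.1, ((mem_dnKer hON hd).1 hxp.2).2,
          map_zero]
        exact zero_mem _
      · obtain ⟨rfl, rfl⟩ := eq_zero_one_of_not_good hl hg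
        rcases s with _ | s
        · change (rightAction d hd).dn (wordBasis hON) x ∈
            rieszSpan hON hd
          rw [((mem_dnKer hON hd).1 hx.2).2]; exact zero_mem _
        · rw [right_dn_left_up_pow_succ hx]
          exact shift_mem_rieszSpan le_rfl (flip_mem huv hx) s 0
    rw [← hsymm]; exact this hx
  · have : kernelSpan hON hd ≤ (rieszSpan hON hd).comap
        ((rightAction d hd).root (wordBasis hON) ∘ₗ (leftAction.up (wordBasis hON) ^ s)) := by
      refine iSup_le fun ⟨⟨κ, l⟩, hl⟩ x hx => ?_
      change (rightAction d hd).root (wordBasis hON) ((leftAction.up (wordBasis hON) ^ s) x) ∈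
          rieszSpan hON hd
      by_cases hg : κ ≠ Kind.zero ∨ 2 ≤ l
      · rw [(compatible d hd).symm.root_up_pow_of_mem (kindSpan_le_prim hON hd hg hx).1]
        exact shift_mem_rieszSpan hl (right_root_mem_kindSpan hON hd hl hx) s 0
      · obtain ⟨rfl, rfl⟩ := eq_zero_one_of_not_good hl hg
        have h1 := shift_mem_gradedSpan hON hd hx.1 s 0
        rw [show 1 + s + 0 = s + 1 by ring] at h1
        have h2 := right_root_eq_zero hON hd h1
        rw [pow_zero, Module.End.one_apply] at h2
        rw [h2]; exact zero_mem _
    rw [← hsymm]; exact this hx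

theorem left_total_mem_rieszSpan {y : wordSpan u v Ω} (hy : y ∈ rieszSpan hON hd) :
    leftAction.total (wordBasis hON) y ∈ rieszSpan hON hd :=
  add_mem (LetterAction.up_mem_shiftSpan hy) (left_dn_mem_rieszSpan huv hy)

theorem right_total_mem_rieszSpan {y : wordSpan u v Ω} (hy : y ∈ rieszSpan hON hd) :
    (rightAction d hd).total (wordBasis hON) y ∈ rieszSpan hON hd := by
  refine add_mem ?_ (right_dn_mem_rieszSpan huv hy)
  have hsymm : rieszSpan hON hd = LetterAction.shiftSpan (rightAction d hd) leftAction
      (wordBasis hON) (kernelSpan hON hd) := (compatible d hd).shiftSpan_symm _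
  rw [hsymm] at hy ⊢
  exact LetterAction.up_mem_shiftSpan hy

/-! ### Orbits of the operators of multiplication by `χ₁` -/

omit huv

variable (hON hd) in
/-- The span of the vectors `χ₁^p x χ₁^q`, `x ∈ S`. -/
def orbitSpan (S : Set (wordSpan u v Ω)) : Submodule ℂ (wordSpan u v Ω) :=
  Submodule.span ℂ {y | ∃ p q, ∃ x ∈ S, y = (leftAction.total (wordBasis hON) ^ p)
    (((rightAction d hd).total (wordBasis hON) ^ q) x)}

theorem subset_orbitSpan {S : Set (wordSpan u v Ω)} {x : wordSpan u v Ω} (hx : x ∈ S) :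
    x ∈ orbitSpan hON hd S := Submodule.subset_span ⟨0, 0, x, hx, rfl⟩

theorem left_total_mem_orbitSpan {S : Set (wordSpan u v Ω)} {y : wordSpan u v Ω}
    (hy : y ∈ orbitSpan hON hd S) : leftAction.total (wordBasis hON) y ∈ orbitSpan hON hd S := by
  have : orbitSpan hON hd S ≤ (orbitSpan hON hd S).comap (leftAction.total (wordBasis hON)) := by
    refine Submodule.span_le.2 ?_
    rintro _ ⟨p, q, x, hx, rfl⟩
    exact Submodule.subset_span ⟨p + 1, q, x, hx, by rw [pow_succ', Module.End.mul_apply]⟩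
  exact this hy

theorem total_pow_comm (q : ℕ) (x : wordSpan u v Ω) : (rightAction d hd).total (wordBasis hON)
      ((leftAction.total (wordBasis hON) ^ q) x) =
    (leftAction.total (wordBasis hON) ^ q) ((rightAction d hd).total (wordBasis hON) x) := by
  induction q with
  | zero => rfl
  | succ q ih =>
    rw [pow_succ', Module.End.mul_apply, ← (compatible d hd).total_total, ih, Module.End.mul_apply]

theorem right_total_mem_orbitSpan {S : Set (wordSpan u v Ω)} {y : wordSpan u v Ω}
    (hy : y ∈ orbitSpan hON hd S) :
    (rightAction d hd).total (wordBasis hON) y ∈ orbitSpan hON hd S := by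
  have : orbitSpan hON hd S ≤
      (orbitSpan hON hd S).comap ((rightAction d hd).total (wordBasis hON)) := by
    refine Submodule.span_le.2 ?_
    rintro _ ⟨p, q, x, hx, rfl⟩
    exact Submodule.subset_span ⟨p, q + 1, x, hx, by
      rw [total_pow_comm, pow_succ', Module.End.mul_apply]⟩
  exact this hy

theorem orbitSpan_le {S : Set (wordSpan u v Ω)} {T : Submodule ℂ (wordSpan u v Ω)}
    (hS : S ⊆ T) (h1 : ∀ y ∈ T, leftAction.total (wordBasis hON) y ∈ T)
    (h2 : ∀ y ∈ T, (rightAction d hd).total (wordBasis hON) y ∈ T) : orbitSpan hON hd S ≤ T := by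
  refine Submodule.span_le.2 ?_
  rintro _ ⟨p, q, x, hx, rfl⟩
  have h3 : ((rightAction d hd).total (wordBasis hON) ^ q) x ∈ T := by
    induction q with
    | zero => exact hS hx
    | succ q ih => rw [pow_succ', Module.End.mul_apply]; exact h2 _ ih
  induction p with
  | zero => exact h3
  | succ p ih => rw [pow_succ', Module.End.mul_apply]; exact h1 _ ih

/-- Both multiplications by χ₁ are self-adjoint, so the complement of an invariant space is
invariant. It is enough to test the generators. -/
theorem inner_orbitSpan {S : Set (wordSpan u v Ω)} {T : Submodule ℂ (wordSpan u v Ω)}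
    (hS : ∀ x ∈ S, ∀ y ∈ T, ⟪x, y⟫_ℂ = 0)
    (h1 : ∀ y ∈ T, leftAction.total (wordBasis hON) y ∈ T)
    (h2 : ∀ y ∈ T, (rightAction d hd).total (wordBasis hON) y ∈ T) {x y : wordSpan u v Ω}
    (hx : x ∈ orbitSpan hON hd S) (hy : y ∈ T) : ⟪x, y⟫_ℂ = 0 := by
  have hb := orthonormal_wordBasis hON
  have : orbitSpan hON hd S ≤ Tᗮ := by
    refine orbitSpan_le (fun x hx => ?_) (fun x hx => ?_) (fun x hx => ?_)
    · exact (Submodule.mem_orthogonal' _ _).2 fun y hy => hS x hx y hy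
    · refine (Submodule.mem_orthogonal' _ _).2 fun y hy => ?_
      rw [LetterAction.inner_total _ hb]
      exact (Submodule.mem_orthogonal' _ _).1 hx _ (h1 y hy)
    · refine (Submodule.mem_orthogonal' _ _).2 fun y hy => ?_
      rw [LetterAction.inner_total _ hb]
      exact (Submodule.mem_orthogonal' _ _).1 hx _ (h2 y hy)
  exact (Submodule.mem_orthogonal' _ _).1 (this hx) y hy

variable (hON d) in
/-- The vectors generating `L`. -/
def generators : Set (wordSpan u v Ω) := {x | ∃ (i : Fin 2) (m : ℤ), m ≠ 0 ∧
  (x = vecV hON i m ∨ x = gamVec hON d i m ∨ x = gamBarVec hON d i m)}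

/-- A proper shift lies in the range of some `up`, whose adjoint kills g; only the unshifted vectors
have to be tested. -/
theorem inner_dnKer_rieszSpan {g : wordSpan u v Ω} (hg : g ∈ dnKer hON hd)
    (h : ∀ κ l, 1 ≤ l → ∀ x ∈ kindSpan hON hd κ l, ⟪x, g⟫_ℂ = 0) {y : wordSpan u v Ω}
    (hy : y ∈ rieszSpan hON hd) : ⟪g, y⟫_ℂ = 0 := by
  have hb := orthonormal_wordBasis hON
  have : rieszSpan hON hd ≤ (Submodule.span ℂ {g})ᗮ := by
    refine rieszSpan_le fun κ l hl x hx r s => ?_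
    rw [Submodule.mem_orthogonal_singleton_iff_inner_right]
    have hg' := (mem_dnKer hON hd).1 hg
    rcases r with _ | r
    · rcases s with _ | s
      · rw [← inner_conj_symm]
        change (starRingEnd ℂ) ⟪x, g⟫_ℂ = 0
        rw [h κ l hl x hx, map_zero]
      · rw [pow_zero, Module.End.one_apply, LetterAction.pow_succ_up,
          LetterAction.inner_up_right _ hb, hg'.2, inner_zero_left]
    · rw [LetterAction.pow_succ_up, LetterAction.inner_up_right _ hb, hg'.1, inner_zero_left]
  exact Submodule.mem_orthogonal_singleton_iff_inner_right.1 (this hy)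

theorem generators_mem_vCount {g : wordSpan u v Ω} (hg : g ∈ generators hON d) :
    g ∈ wspan (wordBasis hON) {w | vCount w.1 = 1} := by
  have key : ∀ {l} {p : ℕ → ℕ → Prop}, (∀ a b, p a b → a = 1) → gradedSpan hON p l ≤
      wspan (wordBasis hON) {w | vCount w.1 = 1} := fun hp =>
    wspan_mono fun w hw => hp _ _ hw.2
  obtain ⟨i, m, hm, rfl | rfl | rfl⟩ := hg
  · exact key (fun a b h => h.1) (vecV_mem_gradedSpan hON hm)
  · have h1 := fun e : ℤˣ => key (fun a b h => h.1) (vecUV_mem_gradedSpan hON (i := i) hm e)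
    have h2 := fun e : ℤˣ => key (fun a b h => h.1) (vecL_mem_gradedSpan hON (i := i) hm e)
    exact sub_mem (Submodule.smul_mem _ _ (sub_mem (Submodule.smul_mem _ _ (h1 _))
      (Submodule.smul_mem _ _ (h1 _)))) (add_mem (h2 _) (h2 _))
  · have h1 := fun e : ℤˣ => key (fun a b h => h.1) (vecUV_mem_gradedSpan hON (i := i) hm e)
    have h2 := fun e : ℤˣ => key (fun a b h => h.1) (vecR_mem_gradedSpan hON (i := i) hm e)
    exact sub_mem (Submodule.smul_mem _ _ (sub_mem (h1 _) (h1 _))) (add_mem (h2 _) (h2 _))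

theorem nil_mem_dnKer : wordBasis hON RWord.nil ∈ dnKer hON hd :=
  (mem_dnKer hON hd).2 ⟨dn_nil hON _, dn_nil hON _⟩

theorem inner_nil_rieszSpan {y : wordSpan u v Ω} (hy : y ∈ rieszSpan hON hd) :
    ⟪wordBasis hON RWord.nil, y⟫_ℂ = 0 := by
  refine inner_dnKer_rieszSpan nil_mem_dnKer (fun κ l hl x hx => ?_) hy
  refine inner_eq_zero_of_disjoint (orthonormal_wordBasis hON) ?_ (kindSpan_le_len hON hd κ l hx)
    (basis_mem_wspan (T := {RWord.nil}) rfl)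
  rw [Set.disjoint_singleton_right]
  intro h
  have : 0 = l := h
  omega

section

variable (hroot : ∀ n : ℕ, n ≠ 0 → d ^ n ≠ 1)
include huv hroot

omit huv in
theorem generators_mem_dnKer {g : wordSpan u v Ω} (hg : g ∈ generators hON d) :
    g ∈ dnKer hON hd := by
  obtain ⟨i, m, hm, rfl | rfl | rfl⟩ := hg
  · exact (mem_dnKer hON hd).2 ⟨left_dn_vecV hON hm, right_dn_vecV hON hd hm⟩
  · exact gamVec_mem_dnKer hON hd hm hroot
  · exact gamBarVec_mem_dnKer hON hd hm hroot

/-- Primitive vectors are orthogonal to the generators by genericity and adjointness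
(`inner_prim_gamVec`); combinations of letters contain no v, unlike the generators. -/
theorem inner_generators_rieszSpan {g : wordSpan u v Ω} (hg : g ∈ generators hON d)
    {y : wordSpan u v Ω} (hy : y ∈ rieszSpan hON hd) : ⟪g, y⟫_ℂ = 0 := by
  refine inner_dnKer_rieszSpan (generators_mem_dnKer hroot hg) (fun κ l hl x hx => ?_) hy
  by_cases hκ : κ ≠ Kind.zero ∨ 2 ≤ l
  · have hxp := kindSpan_le_prim hON hd hκ hx
    obtain ⟨i, m, hm, rfl | rfl | rfl⟩ := hg
    · exact inner_wvec_of_not_generic hON hxp.1 (not_isGeneric_syl i (by simp) m)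
    · exact inner_prim_gamVec hON hd hm hxp
    · exact inner_prim_gamBarVec hON hd huv hm hxp
  · obtain ⟨rfl, rfl⟩ := eq_zero_one_of_not_good hl hκ
    refine inner_eq_zero_of_disjoint (orthonormal_wordBasis hON) ?_ hx.1
      (generators_mem_vCount hg)
    rw [Set.disjoint_left]
    rintro w ⟨-, h1⟩ h2
    have h2' : vCount w.1 = 1 := h2
    omega

/-- The vectors in the span of the words are sums of vectors from `L²A`, from `L` and of
shifts. -/
theorem sup_eq_top : orbitSpan hON hd {wordBasis hON RWord.nil} ⊔
    orbitSpan hON hd (generators hON d) ⊔ rieszSpan hON hd = ⊤ := by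
  set V0 := orbitSpan hON hd {wordBasis hON RWord.nil} with hV0
  set V1 := orbitSpan hON hd (generators hON d) with hV1
  set T := V0 ⊔ V1 ⊔ rieszSpan hON hd with hT
  have hinv : ∀ f : Module.End ℂ (wordSpan u v Ω), (∀ y ∈ V0, f y ∈ V0) → (∀ y ∈ V1, f y ∈ V1) →
      (∀ y ∈ rieszSpan hON hd, f y ∈ rieszSpan hON hd) → ∀ y ∈ T, f y ∈ T := by
    intro f h0 h1 h2 y hy
    exact (sup_le (sup_le (fun y hy => Submodule.mem_sup_left (Submodule.mem_sup_left (h0 y hy)))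
      fun y hy => Submodule.mem_sup_left (Submodule.mem_sup_right (h1 y hy)))
      fun y hy => Submodule.mem_sup_right (h2 y hy) : T ≤ T.comap f) hy
  have hl := hinv (leftAction.total (wordBasis hON)) (fun y hy => left_total_mem_orbitSpan hy)
    (fun y hy => left_total_mem_orbitSpan hy) (fun y hy => left_total_mem_rieszSpan huv hy)
  have hr := hinv ((rightAction d hd).total (wordBasis hON))
    (fun y hy => right_total_mem_orbitSpan hy)
    (fun y hy => right_total_mem_orbitSpan hy) (fun y hy => right_total_mem_rieszSpan huv hy)
  have hZ : ∀ κ n, kindSpan hON hd κ (n + 1) ≤ T := fun κ n x hx =>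
    Submodule.mem_sup_right (shift_mem_rieszSpan (Nat.le_add_left 1 n) hx 0 0)
  have hgen : ∀ g ∈ generators hON d, g ∈ T := fun g hg =>
    Submodule.mem_sup_left (Submodule.mem_sup_right (subset_orbitSpan hg))
  -- Induction on length: longer words reduce to shorter ones multiplied by χ₁ and to vectors killed
  -- by both `dn`.
  have hind : ∀ n, wspan (wordBasis hON) {w | w.len < n} ≤ T := by
    intro n
    induction n with
    | zero =>
      refine Submodule.span_le.2 ?_
      rintro _ ⟨w, hw, rfl⟩
      exact absurd hw (Nat.not_lt_zero _)
    | succ n ih =>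
      refine Submodule.span_le.2 ?_
      rintro _ ⟨w, hw, rfl⟩
      change wordBasis hON w ∈ T
      rcases Nat.lt_succ_iff_lt_or_eq.1 hw with hw | hw
      · exact ih (basis_mem_wspan hw)
      rcases n with _ | n
      · rw [show w = RWord.nil from RWord.ext (eq_nil_of_wordLength w.2 hw)]
        exact Submodule.mem_sup_left (Submodule.mem_sup_left (subset_orbitSpan rfl))
      have hlen : ∀ y ∈ wspan (wordBasis hON) {w | w.len = n}, y ∈ T ∧
          ∀ α : LetterAction RWord.len, α.dn (wordBasis hON) y ∈ T := by
        intro y hy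
        refine ⟨ih (wspan_mono (fun w hw => ?_) hy), fun α =>
          ih (wspan_mono (fun w hw => ?_) (α.dn_mem_len hy))⟩
        all_goals simp only [Set.mem_ofPred_eq] at hw ⊢; omega
      -- Lengthening is multiplication by χ₁ minus a shorter vector, and T is invariant under that
      -- multiplication.
      have hA : ∀ y ∈ wspan (wordBasis hON) {w | w.len = n},
          leftAction.up (wordBasis hON) y ∈ T := by
        intro y hy
        have := sub_mem (hl y (hlen y hy).1) ((hlen y hy).2 leftAction)
        rwa [LetterAction.total_apply, add_sub_cancel_right] at this
      have hB : ∀ y ∈ wspan (wordBasis hON) {w | w.len = n},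
          (rightAction d hd).up (wordBasis hON) y ∈ T := by
        intro y hy
        have := sub_mem (hr y (hlen y hy).1) ((hlen y hy).2 (rightAction d hd))
        rwa [LetterAction.total_apply, add_sub_cancel_right] at this
      have hdec : ∀ p : ℕ → ℕ → Prop, gradedSpan hON p (n + 1) ⊓ dnKer hON hd ≤ T →
          gradedSpan hON p (n + 1) ≤ T := by
        intro p hp x hx
        obtain ⟨y, hy, z, hz, ξ, hξ, hξ', rfl⟩ := exists_decomposition hON hd hx
        exact add_mem (add_mem (hA y (gradedSpan_le_len hON hy))
          (hB z (gradedSpan_le_len hON hz))) (hp ⟨hξ, hξ'⟩)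
      rcases (by omega : vCount w.1 = 0 ∨ 2 ≤ vCount w.1 ∨ vCount w.1 = 1) with hv | hv | hv
      · exact hdec _ (hZ Kind.zero n) (basis_mem_wspan ⟨hw, hv⟩)
      · exact hdec _ (hZ Kind.two n) (basis_mem_wspan ⟨hw, hv⟩)
      · have hwl : wordLength w.1 = n + 1 := hw
        rcases (by have := vLength_le_wordLength w.1; omega : vLength w.1 = wordLength w.1 ∨
          vLength w.1 + 1 = wordLength w.1 ∨ vLength w.1 + 2 ≤ n + 1) with h1 | h1 | h1
        · obtain ⟨i, m, hm, -, h2⟩ := eq_of_vLength_eq w.2 hv h1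
          have : wordBasis hON w = vecV hON i m := by
            rw [vecV, wvec_of_reduced hON (isReducedWord_vecV hm)]
            exact congrArg _ (RWord.ext h2)
          rw [this]
          exact hgen _ ⟨i, m, hm, Or.inl rfl⟩
        -- Here the common kernel of the shortening operators is not computed; the explicit linear
        -- system takes its place, and this is where γ and γ̄ enter.
        · obtain ⟨i, m, c, hm, h2, h3⟩ := eq_of_vLength_add_one w.2 hv h1
          have hmn : m.natAbs = n := by omega
          have hV : vecV hON i m ∈ wspan (wordBasis hON) {w | w.len = n} :=
            hmn ▸ gradedSpan_le_len hON (vecV_mem_gradedSpan hON hm)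
          have key := vec_mem_of_generators hON hd huv hm hroot (hA _ hV) (hB _ hV)
            (hgen _ ⟨i, m, hm, Or.inr (Or.inl rfl)⟩) (hgen _ ⟨i, m, hm, Or.inr (Or.inr rfl)⟩)
            (hZ Kind.alphaTwo n (Submodule.subset_span ⟨i, m, hm, by omega, Or.inl rfl⟩))
            (hZ Kind.alphaTwo n (Submodule.subset_span ⟨i, m, hm, by omega, Or.inr rfl⟩)) c.2
          have hw' : ∀ w', w.1 = w' → wordBasis hON w = wvec hON w' := by
            rintro _ rfl
            rw [wvec_of_reduced hON w.2]
          rcases h3 with ⟨-, h3⟩ | ⟨h4, h3⟩ | ⟨h4, h3⟩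
          · rw [hw' _ h3]; exact key.1
          · rw [hw' _ h3, eq_one_sub h4]; exact key.2.1
          · rw [hw' _ h3, eq_one_sub h4]; exact key.2.2
        · exact hdec _ (hZ Kind.beta n) (basis_mem_wspan ⟨hw, hv, h1⟩)
  rw [eq_top_iff, ← (wordBasis hON).span_eq, Submodule.span_le]
  rintro _ ⟨w, rfl⟩
  exact hind (w.len + 1) (basis_mem_wspan (Nat.lt_succ_self _))

end

end Decomposition

/-! ### Orthogonal complements in a Hilbert space -/

section Hilbert

variable {H : Type*} [NormedAddCommGroup H] [InnerProductSpace ℂ H] [CompleteSpace H]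

/-- The component of x ∈ Pᗮ outside the closure of Q is orthogonal to P and to Q, hence to a dense
subspace. -/
theorem orthogonal_eq_topologicalClosure {P Q : Submodule ℂ H} (hPQ : P ⟂ Q)
    (hdense : (P ⊔ Q).topologicalClosure = ⊤) : Pᗮ = Q.topologicalClosure := by
  apply le_antisymm
  · intro x hx
    have : CompleteSpace Q.topologicalClosure :=
      (Submodule.isClosed_topologicalClosure _).completeSpace_coe
    set y := Q.topologicalClosure.starProjection x
    have hy : y ∈ Q.topologicalClosure := Submodule.starProjection_apply_mem _ x
    have hQ : Q.topologicalClosure ≤ Pᗮ :=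
      Q.topologicalClosure_minimal hPQ.symm (Submodule.isClosed_orthogonal P)
    have h1 : x - y ∈ Pᗮ := sub_mem hx (hQ hy)
    have h2 : x - y ∈ Qᗮ := by
      rw [← Submodule.orthogonal_closure]
      exact Submodule.sub_starProjection_mem_orthogonal _
    have h3 : x - y ∈ (P ⊔ Q)ᗮ := by
      rw [← Submodule.inf_orthogonal]; exact ⟨h1, h2⟩
    rw [(Submodule.topologicalClosure_eq_top_iff).1 hdense, Submodule.mem_bot, sub_eq_zero] at h3
    rw [h3]; exact hy
  · exact Q.topologicalClosure_minimal hPQ.symm (Submodule.isClosed_orthogonal P)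

omit [CompleteSpace H] in
theorem isOrtho_topologicalClosure {P Q : Submodule ℂ H} (hPQ : P ⟂ Q) :
    P.topologicalClosure ⟂ Q.topologicalClosure := by
  rw [Submodule.isOrtho_iff_le, Submodule.orthogonal_closure]
  exact P.topologicalClosure_minimal hPQ (Submodule.isClosed_orthogonal Q)

/-- Projecting x ∈ Pᗮ onto the closed space Q leaves a remainder orthogonal to both P and Q. -/
theorem sup_orthogonal_sup {P Q : Submodule ℂ H} (hQ : IsClosed (Q : Set H)) (hPQ : P ⟂ Q) :
    Q ⊔ (P ⊔ Q)ᗮ = Pᗮ := by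
  apply le_antisymm
  · exact sup_le hPQ.symm (Submodule.orthogonal_le le_sup_left)
  · intro x hx
    have : CompleteSpace Q := hQ.completeSpace_coe
    have hy : Q.starProjection x ∈ Q := Submodule.starProjection_apply_mem _ x
    rw [← add_sub_cancel (Q.starProjection x) x]
    refine Submodule.add_mem_sup hy ?_
    rw [← Submodule.inf_orthogonal]
    exact ⟨sub_mem hx (hPQ.symm hy), Submodule.sub_starProjection_mem_orthogonal _⟩

end Hilbert

/-! ### Identification of L²A, L and their complement as closures -/

section Closures

variable {H : Type*} [NormedAddCommGroup H] [InnerProductSpace ℂ H] [CompleteSpace H]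
variable {u v : Fin 2 → unitary (H →L[ℂ] H)} {Ω : H}
variable (hON : Orthonormal ℂ fun w : RWord => wordOp u v w.1 Ω)
variable {d : ℂ} (hd : ‖d‖ = 1)
variable (huv : ∀ i, (u i : H →L[ℂ] H) * (v i : H →L[ℂ] H) =
      d • ((v i : H →L[ℂ] H) * (u i : H →L[ℂ] H)))

/-- The closure in `L²` of a space of linear combinations of words. -/
def closureL2 (T : Submodule ℂ (wordSpan u v Ω)) : Submodule ℂ H :=
  (T.map (wordSpan u v Ω).subtype).topologicalClosure

instance (T : Submodule ℂ (wordSpan u v Ω)) : CompleteSpace (closureL2 T) :=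
  (Submodule.isClosed_topologicalClosure _).completeSpace_coe

theorem mem_closureL2 {T : Submodule ℂ (wordSpan u v Ω)} {x : wordSpan u v Ω} (hx : x ∈ T) :
    (x : H) ∈ closureL2 T := Submodule.le_topologicalClosure _ ⟨x, hx, rfl⟩

theorem closureL2_le {T : Submodule ℂ (wordSpan u v Ω)} {K : Submodule ℂ H}
    (hK : IsClosed (K : Set H)) (h : ∀ x ∈ T, (x : H) ∈ K) : closureL2 T ≤ K := by
  refine Submodule.topologicalClosure_minimal _ ?_ hK
  rintro _ ⟨x, hx, rfl⟩
  exact h x hx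

/-- A bounded operator mapping `T` to `T'` maps the closure of `T` to the closure of `T'`. -/
theorem apply_mem_closureL2 {T : Submodule ℂ (wordSpan u v Ω)} {K : Submodule ℂ H}
    (hK : IsClosed (K : Set H)) (X : H →L[ℂ] H) (h : ∀ x ∈ T, X x ∈ K) {ξ : H}
    (hξ : ξ ∈ closureL2 T) : X ξ ∈ K := by
  have : closureL2 T ≤ K.comap X.toLinearMap :=
    closureL2_le (hK.preimage X.continuous) fun x hx => h x hx
  exact this hξ

theorem isOrtho_closureL2 {T T' : Submodule ℂ (wordSpan u v Ω)}
    (h : ∀ x ∈ T, ∀ y ∈ T', ⟪x, y⟫_ℂ = 0) : closureL2 T ⟂ closureL2 T' := by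
  refine isOrtho_topologicalClosure (Submodule.isOrtho_iff_inner_eq.2 ?_)
  rintro _ ⟨x, hx, rfl⟩ _ ⟨y, hy, rfl⟩
  exact h x hx y hy

theorem star_uPlus (i : Fin 2) : star (uPlus u i) = uPlus u i := by
  rw [uPlus, star_add, star_uPow, star_uPow, neg_neg, add_comm]

include hON in
theorem chi_one_mem_algA : chi u v 1 ∈ algA u := by
  rw [chi_one_eq hON]; exact subset_generatedVN rfl

theorem toOp_left_total_pow (p : ℕ) (x : wordSpan u v Ω) :
    toOp hON ((leftAction.total (wordBasis hON) ^ p) x) = chi u v 1 ^ p * toOp hON x := by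
  induction p with
  | zero => simp
  | succ p ih => rw [pow_succ', Module.End.mul_apply, toOp_left_total, ih, pow_succ', mul_assoc]

include huv in
theorem toOp_right_total_pow (q : ℕ) (x : wordSpan u v Ω) :
    toOp hON (((rightAction d hd).total (wordBasis hON) ^ q) x) = toOp hON x * chi u v 1 ^ q := by
  induction q with
  | zero => simp
  | succ q ih =>
    rw [pow_succ', Module.End.mul_apply, toOp_right_total hON hd huv, ih, pow_succ, mul_assoc]

include huv in
theorem coe_orbit (p q : ℕ) (x : wordSpan u v Ω) :
    ((leftAction.total (wordBasis hON) ^ p)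
      (((rightAction d hd).total (wordBasis hON) ^ q) x) : H) =
      (chi u v 1 ^ p * toOp hON x * chi u v 1 ^ q) Ω := by
  rw [← toOp_apply hON, toOp_left_total_pow, toOp_right_total_pow hON hd huv, mul_assoc]

/-- The generator χ₁ of A is bounded and self-adjoint, so invariance under it passes to the closure
and then to all of A. -/
theorem algA_invariant {T : Submodule ℂ (wordSpan u v Ω)}
    (hT : ∀ y ∈ T, leftAction.total (wordBasis hON) y ∈ T) {a : H →L[ℂ] H} (ha : a ∈ algA u)
    {ξ : H} (hξ : ξ ∈ closureL2 T) : a ξ ∈ closureL2 T := by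
  have h1 : ∀ ξ ∈ closureL2 T, (uPlus u 0 + uPlus u 1) ξ ∈ closureL2 T := by
    intro ξ hξ
    refine apply_mem_closureL2 (Submodule.isClosed_topologicalClosure _) _ (fun x hx => ?_) hξ
    have h2 := mem_closureL2 (hT x hx)
    rwa [← toOp_apply hON, toOp_left_total, mul_apply_eq_comp, toOp_apply, chi_one_eq hON] at h2
  refine generatedVN_invariant ?_ ?_ ha hξ
  · rintro _ rfl
    exact h1
  · rintro _ rfl
    rw [star_add, star_uPlus, star_uPlus]
    exact h1

theorem coe_nil : (wordBasis hON RWord.nil : H) = Ω := by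
  rw [coe_wordBasis]; simp [RWord.nil]

theorem algA_apply_mem {a : H →L[ℂ] H} (ha : a ∈ algA u) :
    a Ω ∈ closureL2 (orbitSpan hON hd {wordBasis hON RWord.nil}) := by
  refine algA_invariant hON (fun y hy => left_total_mem_orbitSpan hy) ha ?_
  have := mem_closureL2 (subset_orbitSpan (hON := hON) (hd := hd)
    (Set.mem_singleton (wordBasis hON RWord.nil)))
  rwa [coe_nil] at this

include huv in
/-- The space `L²A` is spanned by the vectors `χ₁^n`. -/
theorem L2A_eq : L2A u Ω = closureL2 (orbitSpan hON hd {wordBasis hON RWord.nil}) := by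
  apply le_antisymm
  · refine Submodule.topologicalClosure_minimal _ (Submodule.span_le.2 ?_)
      (Submodule.isClosed_topologicalClosure _)
    rintro _ ⟨a, ha, rfl⟩
    exact algA_apply_mem hON hd ha
  · refine Submodule.topologicalClosure_mono ?_
    rw [orbitSpan, Submodule.map_span, Submodule.span_le]
    rintro _ ⟨_, ⟨p, q, _, rfl, rfl⟩, rfl⟩
    refine Submodule.subset_span ⟨chi u v 1 ^ p * chi u v 1 ^ q,
      mul_mem (pow_mem (chi_one_mem_algA hON) p) (pow_mem (chi_one_mem_algA hON) q), ?_⟩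
    rw [Submodule.subtype_apply, coe_orbit hON hd huv, toOp_basis]
    simp [RWord.nil]

/-- The inverse of l ↦ l - sgn l is m ↦ m + sgn m, which matches the indices |l| ≥ 2 of the γ's with
m ≠ 0. -/
theorem exists_sub_sign {m : ℤ} (hm : m ≠ 0) :
    ∃ l : ℤ, l - l.sign = m ∧ |l| = ((m.natAbs + 1 : ℕ) : ℤ) := by
  rcases lt_or_gt_of_ne hm with h | h
  · refine ⟨m - 1, ?_, ?_⟩
    · rw [Int.sign_eq_neg_one_of_neg (by omega)]; ring
    · rw [Int.abs_eq_natAbs]; omega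
  · refine ⟨m + 1, ?_, ?_⟩
    · rw [Int.sign_eq_one_of_pos (by omega)]; ring
    · rw [Int.abs_eq_natAbs]; omega

theorem sub_sign_ne_zero {l : ℤ} (hl : 2 ≤ |l|) : l - l.sign ≠ 0 := by
  rw [Int.abs_eq_natAbs] at hl
  rcases Int.sign_trichotomy l with h | h | h <;> omega

include hd huv in
theorem Walpha1_le (l : ℕ) :
    Walpha1 d u v l ≤ (Submodule.span ℂ (generators hON d)).map (toOp hON) := by
  refine Submodule.span_le.2 ?_
  rintro _ ⟨hl, i, t, ht, hX⟩
  have h0 := sub_sign_ne_zero (l := t) (by omega)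
  rcases hX with rfl | rfl
  · exact ⟨_, Submodule.subset_span ⟨i, _, h0, Or.inr (Or.inl rfl)⟩, toOp_gamVec hON hd huv h0⟩
  · exact ⟨_, Submodule.subset_span ⟨i, _, h0, Or.inr (Or.inr rfl)⟩, toOp_gamBarVec hON hd huv h0⟩

include huv in
/-- The space `L` is spanned by the vectors `χ₁^p g χ₁^q` with `g` one of the generators. -/
theorem L_eq : L d u v Ω = closureL2 (orbitSpan hON hd (generators hON d)) := by
  apply le_antisymm
  · refine Submodule.topologicalClosure_minimal _ (Submodule.span_le.2 ?_)
      (Submodule.isClosed_topologicalClosure _)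
    rintro _ ⟨a, ha, b, hb, X, hX, rfl⟩
    have hX' : X ∈ (Submodule.span ℂ (generators hON d)).map (toOp hON) := by
      rcases hX with ⟨l, -, h⟩ | ⟨i, l, hl, rfl⟩
      · exact Walpha1_le hON hd huv l h
      · exact ⟨_, Submodule.subset_span ⟨i, l, hl, Or.inl rfl⟩, toOp_vecV hON hl⟩
    obtain ⟨x, hx, rfl⟩ := hX'
    have hx' : x ∈ orbitSpan hON hd (generators hON d) :=
      Submodule.span_le.2 (fun g hg => subset_orbitSpan hg) hx
    rw [mul_assoc, mul_apply_eq_comp]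
    refine algA_invariant hON (fun y hy => left_total_mem_orbitSpan hy) ha ?_
    rw [mul_apply_eq_comp]
    -- The vector bΩ is a limit of polynomials in χ₁ applied to Ω, and x acts as a bounded operator,
    -- so right multiplication of x by powers of χ₁ suffices.
    refine apply_mem_closureL2 (Submodule.isClosed_topologicalClosure _) _ (fun y hy => ?_)
      (algA_apply_mem hON hd hb)
    have : orbitSpan hON hd {wordBasis hON RWord.nil} ≤
        (closureL2 (orbitSpan hON hd (generators hON d))).comap
          ((toOp hON x).toLinearMap ∘ₗ (wordSpan u v Ω).subtype) := by
      refine Submodule.span_le.2 ?_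
      rintro _ ⟨p, q, _, rfl, rfl⟩
      change toOp hON x (_ : H) ∈ closureL2 (orbitSpan hON hd (generators hON d))
      rw [Submodule.subtype_apply, coe_orbit hON hd huv, toOp_basis]
      have h1 : ((rightAction d hd).total (wordBasis hON) ^ (p + q)) x ∈
          orbitSpan hON hd (generators hON d) := by
        generalize p + q = n
        induction n with
        | zero => exact hx'
        | succ n ih => rw [pow_succ', Module.End.mul_apply]; exact right_total_mem_orbitSpan ih
      have h2 := mem_closureL2 h1
      rw [← toOp_apply hON, toOp_right_total_pow hON hd huv, mul_apply_eq_comp, pow_add] at h2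
      simpa [RWord.nil] using h2
    exact this hy
  · refine Submodule.topologicalClosure_mono ?_
    rw [orbitSpan, Submodule.map_span, Submodule.span_le]
    rintro _ ⟨_, ⟨p, q, x, hx, rfl⟩, rfl⟩
    refine Submodule.subset_span ⟨chi u v 1 ^ p, pow_mem (chi_one_mem_algA hON) p,
      chi u v 1 ^ q, pow_mem (chi_one_mem_algA hON) q, toOp hON x, ?_,
        coe_orbit hON hd huv p q x⟩
    obtain ⟨i, m, hm, rfl | rfl | rfl⟩ := hx
    · exact Or.inr ⟨i, m, hm, toOp_vecV hON hm⟩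
    · obtain ⟨l, rfl, h2⟩ := exists_sub_sign hm
      refine Or.inl ⟨_, Nat.le_add_left 1 _, Submodule.subset_span ⟨by omega, i, l, h2,
        Or.inl (toOp_gamVec hON hd huv hm)⟩⟩
    · obtain ⟨l, rfl, h2⟩ := exists_sub_sign hm
      refine Or.inl ⟨_, Nat.le_add_left 1 _, Submodule.subset_span ⟨by omega, i, l, h2,
        Or.inr (toOp_gamBarVec hON hd huv hm)⟩⟩

theorem left_total_mem_vCount {k : ℕ} {y : wordSpan u v Ω}
    (hy : y ∈ wspan (wordBasis hON) {w : RWord | vCount w.1 = k}) :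
    leftAction.total (wordBasis hON) y ∈ wspan (wordBasis hON) {w : RWord | vCount w.1 = k} :=
  add_mem (leftAction.up_mem_wspan (fun w hw c _ => by
      simpa [vCount_left] using hw) hy)
    (leftAction.dn_mem_wspan (fun w hw c _ => by simpa [vCount_left] using hw) hy)

theorem right_total_mem_vCount {k : ℕ} {y : wordSpan u v Ω}
    (hy : y ∈ wspan (wordBasis hON) {w : RWord | vCount w.1 = k}) :
    (rightAction d hd).total (wordBasis hON) y ∈
      wspan (wordBasis hON) {w : RWord | vCount w.1 = k} :=
  add_mem ((rightAction d hd).up_mem_wspan (fun w hw c _ => by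
      simpa [vCount_right] using hw) hy)
    ((rightAction d hd).dn_mem_wspan (fun w hw c _ => by simpa [vCount_right] using hw) hy)

include hON hd huv in
-- Letters u preserve the number of v-syllables, which is 0 for the trivial word and 1 for the
-- generators of L.
theorem L2A_isOrtho_L : L2A u Ω ⟂ L d u v Ω := by
  rw [L2A_eq hON hd huv, L_eq hON hd huv]
  have h0 : orbitSpan hON hd {wordBasis hON RWord.nil} ≤
      wspan (wordBasis hON) {w : RWord | vCount w.1 = 0} := by
    refine orbitSpan_le ?_ (fun y hy => left_total_mem_vCount hON hy)
      (fun y hy => right_total_mem_vCount hON hd hy)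
    rintro _ rfl
    exact basis_mem_wspan rfl
  have h1 : orbitSpan hON hd (generators hON d) ≤
      wspan (wordBasis hON) {w : RWord | vCount w.1 = 1} :=
    orbitSpan_le (fun g hg => generators_mem_vCount hg)
      (fun y hy => left_total_mem_vCount hON hy) (fun y hy => right_total_mem_vCount hON hd hy)
  refine isOrtho_closureL2 fun x hx y hy => inner_eq_zero_of_disjoint
    (orthonormal_wordBasis hON) ?_ (h0 hx) (h1 hy)
  rw [Set.disjoint_left]
  intro w h2 h3
  have h2' : vCount w.1 = 0 := h2
  have h3' : vCount w.1 = 1 := h3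
  omega

include huv in
/-- The orthogonal complement of `L²A ⊕ L` is spanned by the shifts. -/
theorem orthogonal_L2A_sup_L (hroot : ∀ n : ℕ, n ≠ 0 → d ^ n ≠ 1)
    (hdense : (wordSpan u v Ω).topologicalClosure = ⊤) :
    (L2A u Ω ⊔ L d u v Ω)ᗮ = closureL2 (rieszSpan hON hd) := by
  rw [L2A_eq hON hd huv, L_eq hON hd huv, ← Submodule.inf_orthogonal, closureL2, closureL2,
    Submodule.orthogonal_closure, Submodule.orthogonal_closure, Submodule.inf_orthogonal]
  refine orthogonal_eq_topologicalClosure ?_ ?_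
  · rw [Submodule.isOrtho_sup_left]
    refine ⟨Submodule.isOrtho_iff_inner_eq.2 ?_, Submodule.isOrtho_iff_inner_eq.2 ?_⟩
    · rintro _ ⟨x, hx, rfl⟩ _ ⟨y, hy, rfl⟩
      refine inner_orbitSpan ?_ (fun y hy => left_total_mem_rieszSpan huv hy)
        (fun y hy => right_total_mem_rieszSpan huv hy) hx hy
      rintro _ rfl y hy
      exact inner_nil_rieszSpan hy
    · rintro _ ⟨x, hx, rfl⟩ _ ⟨y, hy, rfl⟩
      exact inner_orbitSpan (fun g hg y hy => inner_generators_rieszSpan huv hroot hg hy)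
        (fun y hy => left_total_mem_rieszSpan huv hy)
        (fun y hy => right_total_mem_rieszSpan huv hy) hx hy
  · rw [← Submodule.map_sup, ← Submodule.map_sup, sup_eq_top huv hroot, Submodule.map_top,
      Submodule.range_subtype, hdense]

end Closures

/-! ### Riesz bounds from mutually orthogonal groups -/

section Grouping

variable {E : Type*} [NormedAddCommGroup E] [InnerProductSpace ℂ E]

theorem norm_add_sq_of_inner_eq_zero {x y : E} (h : ⟪x, y⟫_ℂ = 0) :
    ‖x + y‖ ^ 2 = ‖x‖ ^ 2 + ‖y‖ ^ 2 := by
  rw [sq, sq, sq, norm_add_sq_eq_norm_sq_add_norm_sq_of_inner_eq_zero (𝕜 := ℂ) x y h]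

theorem norm_sum_sq_of_pairwise {κ : Type*} (s : Finset κ) (f : κ → E)
    (h : ∀ i ∈ s, ∀ j ∈ s, i ≠ j → ⟪f i, f j⟫_ℂ = 0) :
    ‖∑ i ∈ s, f i‖ ^ 2 = ∑ i ∈ s, ‖f i‖ ^ 2 := by
  classical
  induction s using Finset.induction_on with
  | empty => simp
  | insert a s ha ih =>
    rw [Finset.sum_insert ha, Finset.sum_insert ha, norm_add_sq_of_inner_eq_zero, ih]
    · exact fun i hi j hj => h i (Finset.mem_insert_of_mem hi) j (Finset.mem_insert_of_mem hj)
    · rw [inner_sum]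
      exact Finset.sum_eq_zero fun j hj => h a (Finset.mem_insert_self _ _) j
        (Finset.mem_insert_of_mem hj) (by rintro rfl; exact ha hj)

/-- The two inequalities of a Riesz basis, for the coefficients with support in `s`. -/
def RieszBound {ι : Type*} (f : ι → E) (c C : ℝ) (s : Finset ι) (a : ι → ℂ) : Prop :=
  c * ∑ j ∈ s, ‖a j‖ ^ 2 ≤ ‖∑ j ∈ s, a j • f j‖ ^ 2 ∧
    ‖∑ j ∈ s, a j • f j‖ ^ 2 ≤ C * ∑ j ∈ s, ‖a j‖ ^ 2

/-- It suffices to have the Riesz bounds within mutually orthogonal groups of vectors. -/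
theorem RieszBound.of_groups {ι κ : Type*} {f : ι → E} {c C : ℝ} (g : ι → κ)
    (hg : ∀ i j, g i ≠ g j → ⟪f i, f j⟫_ℂ = 0)
    (h : ∀ k, ∀ s : Finset ι, (∀ i ∈ s, g i = k) → ∀ a, RieszBound f c C s a)
    (s : Finset ι) (a : ι → ℂ) : RieszBound f c C s a := by
  classical
  have hmaps : ∀ i ∈ s, g i ∈ s.image g := fun i hi => Finset.mem_image_of_mem g hi
  have hk := fun k => h k (s.filter fun i => g i = k) (fun i hi => (Finset.mem_filter.1 hi).2) a
  have h1 : ‖∑ j ∈ s, a j • f j‖ ^ 2 =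
      ∑ k ∈ s.image g, ‖∑ j ∈ s with g j = k, a j • f j‖ ^ 2 := by
    rw [← Finset.sum_fiberwise_of_maps_to hmaps, norm_sum_sq_of_pairwise]
    intro k _ k' _ hkk
    rw [sum_inner]
    refine Finset.sum_eq_zero fun i hi => ?_
    rw [inner_sum]
    refine Finset.sum_eq_zero fun j hj => ?_
    rw [inner_smul_left, inner_smul_right, hg i j, mul_zero, mul_zero]
    rw [(Finset.mem_filter.1 hi).2, (Finset.mem_filter.1 hj).2]
    exact hkk
  have h2 : ∑ j ∈ s, ‖a j‖ ^ 2 = ∑ k ∈ s.image g, ∑ j ∈ s with g j = k, ‖a j‖ ^ 2 :=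
    (Finset.sum_fiberwise_of_maps_to hmaps _).symm
  rw [RieszBound, h1, h2, Finset.mul_sum, Finset.mul_sum]
  exact ⟨Finset.sum_le_sum fun k _ => (hk k).1, Finset.sum_le_sum fun k _ => (hk k).2⟩

end Grouping

/-! ### Two-sided bounds for shifts of single letters -/

section LetterBounds

variable {H : Type*} [NormedAddCommGroup H] [InnerProductSpace ℂ H] [CompleteSpace H]
variable {u v : Fin 2 → unitary (H →L[ℂ] H)} {Ω : H}
variable {hON : Orthonormal ℂ fun w : RWord => wordOp u v w.1 Ω}
variable {d : ℂ} {hd : ‖d‖ = 1}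
variable (huv : ∀ i, (u i : H →L[ℂ] H) * (v i : H →L[ℂ] H) =
      d • ((v i : H →L[ℂ] H) * (u i : H →L[ℂ] H)))

variable (hON hd) in
/-- The vector `x_{r,n-r}` for a combination `x` of letters. -/
def letterShift (n r : ℕ) (x : wordSpan u v Ω) : wordSpan u v Ω :=
  (leftAction.up (wordBasis hON) ^ r) (((rightAction d hd).up (wordBasis hON) ^ (n - r)) x)

theorem letterShift_add (n r : ℕ) (x y : wordSpan u v Ω) : letterShift hON hd n r (x + y) =
    letterShift hON hd n r x + letterShift hON hd n r y := by
  simp [letterShift]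

theorem letterShift_smul (n r : ℕ) (a : ℂ) (x : wordSpan u v Ω) :
    letterShift hON hd n r (a • x) = a • letterShift hON hd n r x := by
  simp [letterShift]

theorem inner_flip (x : wordSpan u v Ω) {y : wordSpan u v Ω} (hy : y ∈ letterSpan hON hd) :
    ⟪flip hON hd x, y⟫_ℂ = ⟪x, flip hON hd y⟫_ℂ := by
  have hb := orthonormal_wordBasis hON
  rw [flip_eq hy, flip_apply, ← LetterAction.inner_up_right _ hb,
    LetterAction.inner_up_left _ hb]

include huv

/-- Relative to the norms the Gram matrix decays like 3^(-(R-r)) off the diagonal, with an isometry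
as coefficient. -/
theorem inner_letterShift {n r R : ℕ} (hr : r ≤ R) (hR : R ≤ n) {x y : wordSpan u v Ω}
    (hx : x ∈ letterSpan hON hd) :
    ⟪letterShift hON hd n R y, letterShift hON hd n r x⟫_ℂ =
      3 ^ (n - (R - r)) * ⟪y, (flip hON hd ^ (R - r)) x⟫_ℂ := by
  have h := inner_shift_letterSpan huv y hx r (n - R) (R - r)
  rw [show r + (R - r) = R by omega, show n - R + (R - r) = n - r by omega,
    show r + (n - R) = n - (R - r) by omega] at h
  exact h

theorem norm_letterShift_sq {n r : ℕ} (hr : r ≤ n) {x : wordSpan u v Ω}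
    (hx : x ∈ letterSpan hON hd) : ‖letterShift hON hd n r x‖ ^ 2 = 3 ^ n * ‖x‖ ^ 2 := by
  have h := inner_letterShift huv (le_refl r) hr (y := x) hx
  simp only [Nat.sub_self, Nat.sub_zero, pow_zero, Module.End.one_apply,
    inner_self_eq_norm_sq_to_K] at h
  refine RCLike.ofReal_injective (K := ℂ) ?_
  simp only [RCLike.ofReal_mul, RCLike.ofReal_pow]
  simpa using h

/-- The vector `letterShift n (R + 1) x` is the sum of one of the previous vectors and of a vector
orthogonal to them. -/
theorem norm_sum_letterShift_succ {n R : ℕ} (hR : R + 1 ≤ n) {z x : wordSpan u v Ω}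
    (hz : z ∈ Submodule.span ℂ {y | ∃ r ≤ R, ∃ x ∈ letterSpan hON hd,
      y = letterShift hON hd n r x}) (hx : x ∈ letterSpan hON hd) :
    ‖z + letterShift hON hd n (R + 1) x‖ ^ 2 =
      ‖z + letterShift hON hd n R ((1 / 3 : ℂ) • flip hON hd x)‖ ^ 2 +
        3 ^ n * (‖x‖ ^ 2 - ‖x‖ ^ 2 / 9) := by
  set y := letterShift hON hd n R ((1 / 3 : ℂ) • flip hON hd x) with hy
  set t := letterShift hON hd n (R + 1) x with ht
  have hflip := flip_mem huv hx
  have hx3 : (1 / 3 : ℂ) • flip hON hd x ∈ letterSpan hON hd := Submodule.smul_mem _ _ hflip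
  -- Passing from R + 1 to R loses one `flip`, which moves to x by symmetry, and gains a factor 3,
  -- which the coefficient 1 / 3 compensates.
  have horth : ∀ r ≤ R, ∀ x' ∈ letterSpan hON hd,
      ⟪t - y, letterShift hON hd n r x'⟫_ℂ = 0 := by
    intro r hr x' hx'
    have hsymm : ⟪flip hON hd x, (flip hON hd ^ (R - r)) x'⟫_ℂ =
        ⟪x, (flip hON hd ^ (R + 1 - r)) x'⟫_ℂ := by
      rw [show R + 1 - r = (R - r) + 1 by omega, pow_succ', Module.End.mul_apply,
        inner_flip x (flip_pow_mem huv hx' _)]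
    rw [inner_sub_left, ht, hy, letterShift_smul, inner_smul_left,
      inner_letterShift huv (by omega) hR hx', inner_letterShift huv hr (by omega) hx', hsymm,
      show n - (R - r) = n - (R + 1 - r) + 1 by omega, pow_succ,
      show (starRingEnd ℂ) (1 / 3 : ℂ) = 1 / 3 by rw [map_div₀, map_one, map_ofNat]]
    ring
  have hzy : ⟪z + y, t - y⟫_ℂ = 0 := by
    have : Submodule.span ℂ {y | ∃ r ≤ R, ∃ x ∈ letterSpan hON hd,
        y = letterShift hON hd n r x} ≤ (Submodule.span ℂ {t - y})ᗮ := by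
      refine Submodule.span_le.2 ?_
      rintro _ ⟨r, hr, x', hx', rfl⟩
      exact Submodule.mem_orthogonal_singleton_iff_inner_right.2 (horth r hr x' hx')
    exact Submodule.mem_orthogonal_singleton_iff_inner_left.1
      (this (add_mem hz (Submodule.subset_span ⟨R, le_rfl, _, hx3, rfl⟩)))
  have h1 : z + t = (z + y) + (t - y) := by abel
  rw [h1, norm_add_sq_of_inner_eq_zero hzy]
  congr 1
  have h2 : ‖t‖ ^ 2 = ‖t - y‖ ^ 2 + ‖y‖ ^ 2 := by
    have := norm_add_sq_of_inner_eq_zero (horth R le_rfl _ hx3)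
    rwa [← hy, sub_add_cancel] at this
  have h3 : ‖y‖ ^ 2 = 3 ^ n * (‖x‖ ^ 2 / 9) := by
    rw [hy, norm_letterShift_sq huv (by omega) hx3, norm_smul, norm_flip hx]
    norm_num; ring
  rw [norm_letterShift_sq huv hR hx, h3] at h2
  linarith

/-- Induction on the number of shifts, with the last one weighted separately. The lower weights
reproduce themselves: 2/5 is half of 4/5, and 4/5 = 8/9 - (4/5)/9. For the upper ones, 4 = 2 · 2 and
8/9 + 4/9 ≤ 2. Here 8/9 is the orthogonal part of the last vector and 1/9 the squared size of the
part passed to its predecessor. -/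
theorem letter_bounds {n : ℕ} (y : ℕ → wordSpan u v Ω) (hy : ∀ r, y r ∈ letterSpan hON hd)
    (R : ℕ) (hR : R ≤ n) :
    3 ^ n * (2 / 5 * ∑ r ∈ Finset.range R, ‖y r‖ ^ 2 + 4 / 5 * ‖y R‖ ^ 2) ≤
        ‖∑ r ∈ Finset.range (R + 1), letterShift hON hd n r (y r)‖ ^ 2 ∧
      ‖∑ r ∈ Finset.range (R + 1), letterShift hON hd n r (y r)‖ ^ 2 ≤
        3 ^ n * (4 * ∑ r ∈ Finset.range R, ‖y r‖ ^ 2 + 2 * ‖y R‖ ^ 2) := by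
  have h3 : (0 : ℝ) < 3 ^ n := by positivity
  induction R generalizing y with
  | zero =>
    simp only [Finset.range_zero, Finset.sum_empty, zero_add, Finset.range_one,
      Finset.sum_singleton, norm_letterShift_sq huv hR (hy 0), mul_zero]
    have : 0 ≤ 3 ^ n * ‖y 0‖ ^ 2 := by positivity
    constructor <;> nlinarith
  | succ R ih =>
    set w := (1 / 3 : ℂ) • flip hON hd (y (R + 1)) with hw
    have hwm : w ∈ letterSpan hON hd := Submodule.smul_mem _ _ (flip_mem huv (hy _))
    have hwn : ‖w‖ ^ 2 = ‖y (R + 1)‖ ^ 2 / 9 := by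
      rw [hw, norm_smul, norm_flip (hy _)]; norm_num; ring
    -- The non-orthogonal part of the last vector is absorbed into its predecessor, so one shift
    -- fewer remains.
    set y' : ℕ → wordSpan u v Ω := fun r => if r = R then y R + w else y r with hy'
    have hym : ∀ r, y' r ∈ letterSpan hON hd := by
      intro r
      simp only [hy']
      split_ifs
      · exact add_mem (hy _) hwm
      · exact hy r
    have hlt : ∀ r ∈ Finset.range R, y' r = y r := fun r hr =>
      if_neg (Finset.mem_range.1 hr).ne
    have hih := ih y' hym (by omega)
    have hz : ∑ r ∈ Finset.range (R + 1), letterShift hON hd n r (y r) ∈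
        Submodule.span ℂ {y | ∃ r ≤ R, ∃ x ∈ letterSpan hON hd,
          y = letterShift hON hd n r x} :=
      Submodule.sum_mem _ fun r hr => Submodule.subset_span
        ⟨r, Nat.lt_succ_iff.1 (Finset.mem_range.1 hr), _, hy r, rfl⟩
    have hsum : ∑ r ∈ Finset.range (R + 1), letterShift hON hd n r (y r) +
        letterShift hON hd n R w = ∑ r ∈ Finset.range (R + 1), letterShift hON hd n r (y' r) := by
      rw [Finset.sum_range_succ, Finset.sum_range_succ, add_assoc, ← letterShift_add]
      congr 1
      · exact Finset.sum_congr rfl fun r hr => by rw [hlt r hr]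
      · simp [hy']
    rw [Finset.sum_range_succ _ (R + 1), norm_sum_letterShift_succ huv hR hz (hy _), ← hw, hsum]
    rw [Finset.sum_congr rfl fun r hr => by rw [hlt r hr], show y' R = y R + w by simp [hy']] at hih
    have hp := parallelogram_law_with_norm ℂ (y R) w
    -- From (a + b)² ≤ 2a² + 2b² applied to y R = (y R + w) - w.
    have ha : ‖y R‖ ^ 2 / 2 - ‖w‖ ^ 2 ≤ ‖y R + w‖ ^ 2 := by
      have h1 : ‖y R‖ ≤ ‖y R + w‖ + ‖w‖ := by simpa using norm_sub_le (y R + w) w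
      nlinarith [sq_nonneg (‖y R + w‖ - ‖w‖), norm_nonneg (y R), norm_nonneg w,
        norm_nonneg (y R + w)]
    have hb : ‖y R + w‖ ^ 2 ≤ 2 * ‖y R‖ ^ 2 + 2 * ‖w‖ ^ 2 := by
      nlinarith [sq_nonneg ‖y R - w‖]
    rw [Finset.sum_range_succ]
    generalize ∑ r ∈ Finset.range R, ‖y r‖ ^ 2 = σ at *
    rw [hwn] at ha hb
    have h0 : 0 ≤ ‖y (R + 1)‖ ^ 2 := sq_nonneg _
    constructor
    · refine le_trans ?_ (add_le_add_left hih.1 _)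
      rw [← mul_add]
      refine mul_le_mul_of_nonneg_left ?_ h3.le
      linarith
    · refine le_trans (add_le_add_left hih.2 _) ?_
      rw [← mul_add]
      refine mul_le_mul_of_nonneg_left ?_ h3.le
      linarith

end LetterBounds

/-! ### The effect of normalisation -/

section Riesz

variable {E : Type*} [NormedAddCommGroup E] [InnerProductSpace ℂ E]

/-- The norms N lie between 3^(n/2) and 4/3 times that value, so dividing by them costs at most the
factor 9 / 16 in squares. -/
theorem weighted_sum_bounds {ι : Type*} {x : ℕ → E} (hx : Orthonormal ℂ x) (m : ι → ℕ)
    (s : Finset ι) (hm : ∀ i ∈ s, ∀ j ∈ s, i ≠ j → m i ≠ m j) {N : ι → ℝ} {n : ℕ}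
    (hN : ∀ i ∈ s, 3 ^ n ≤ N i ^ 2 ∧ N i ^ 2 ≤ 16 / 9 * 3 ^ n) (a : ι → ℂ) :
    9 / 16 * ∑ i ∈ s, ‖a i‖ ^ 2 ≤
        3 ^ n * ‖∑ i ∈ s, (a i * ((N i)⁻¹ : ℝ)) • x (m i)‖ ^ 2 ∧
      3 ^ n * ‖∑ i ∈ s, (a i * ((N i)⁻¹ : ℝ)) • x (m i)‖ ^ 2 ≤ ∑ i ∈ s, ‖a i‖ ^ 2 := by
  have h3 : (0 : ℝ) < 3 ^ n := by positivity
  rw [norm_sum_sq_of_pairwise]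
  · rw [Finset.mul_sum, Finset.mul_sum]
    have hterm : ∀ i, 3 ^ n * ‖(a i * ((N i)⁻¹ : ℝ)) • x (m i)‖ ^ 2 =
        (3 ^ n / N i ^ 2) * ‖a i‖ ^ 2 := by
      intro i
      rw [norm_smul, hx.1, mul_one, norm_mul, Complex.norm_real, mul_pow, norm_inv,
        Real.norm_eq_abs, inv_pow, sq_abs]
      ring
    refine ⟨Finset.sum_le_sum fun i hi => ?_, Finset.sum_le_sum fun i hi => ?_⟩
    · rw [hterm]
      obtain ⟨h1, h2⟩ := hN i hi
      refine mul_le_mul_of_nonneg_right ?_ (sq_nonneg _)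
      rw [le_div_iff₀ (lt_of_lt_of_le h3 h1)]
      linarith
    · rw [hterm]
      obtain ⟨h1, h2⟩ := hN i hi
      refine mul_le_of_le_one_left (sq_nonneg _) ?_
      rw [div_le_one (lt_of_lt_of_le h3 h1)]
      exact h1
  · intro i hi j hj hij
    rw [inner_smul_left, inner_smul_right, hx.2 (hm i hi j hj hij), mul_zero, mul_zero]

end Riesz

/-! ### Riesz bounds for the normalised shifts -/

section Basis

variable {H : Type*} [NormedAddCommGroup H] [InnerProductSpace ℂ H] [CompleteSpace H]
variable {u v : Fin 2 → unitary (H →L[ℂ] H)} {Ω : H}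
variable (hON : Orthonormal ℂ fun w : RWord => wordOp u v w.1 Ω)
variable {d : ℂ} (hd : ‖d‖ = 1)

/-- The shifts of a sequence of vectors, indexed by `(m, r, s)`. -/
def shiftVec (x : ℕ → wordSpan u v Ω) (p : ℕ × ℕ × ℕ) : wordSpan u v Ω :=
  (leftAction.up (wordBasis hON) ^ p.2.1)
    (((rightAction d hd).up (wordBasis hON) ^ p.2.2) (x p.1))

/-- The normalised shifts of a sequence of vectors, indexed by `(m, r, s)`. -/
def rieszVec (x : ℕ → wordSpan u v Ω) (p : ℕ × ℕ × ℕ) : wordSpan u v Ω :=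
  ((‖shiftVec hON hd x p‖⁻¹ : ℝ) : ℂ) • shiftVec hON hd x p

/-- Each of the two sides contributes a factor 4 / 3. -/
theorem shift_norm_bounds (r s : ℕ) (x : wordSpan u v Ω) :
    3 ^ (r + s) * ‖x‖ ^ 2 ≤ ‖(leftAction.up (wordBasis hON) ^ r)
      (((rightAction d hd).up (wordBasis hON) ^ s) x)‖ ^ 2 ∧
    ‖(leftAction.up (wordBasis hON) ^ r)
      (((rightAction d hd).up (wordBasis hON) ^ s) x)‖ ^ 2 ≤ 16 / 9 * (3 ^ (r + s) * ‖x‖ ^ 2) := by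
  have hb := orthonormal_wordBasis hON
  have h1 := LetterAction.le_norm_up_pow_sq (rightAction d hd) hb s x
  have h2 := LetterAction.norm_up_pow_sq_le (rightAction d hd) hb s x
  have h3 := LetterAction.le_norm_up_pow_sq leftAction hb r
    (((rightAction d hd).up (wordBasis hON) ^ s) x)
  have h4 := LetterAction.norm_up_pow_sq_le leftAction hb r
    (((rightAction d hd).up (wordBasis hON) ^ s) x)
  have h5 : (0 : ℝ) ≤ 3 ^ r := by positivity
  constructor
  · refine le_trans ?_ h3
    rw [pow_add, mul_assoc]
    exact mul_le_mul_of_nonneg_left h1 h5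
  · refine h4.trans ?_
    have := mul_le_mul_of_nonneg_left h2 h5
    rw [pow_add]
    linarith

variable {kind : ℕ → Kind} {len : ℕ → ℕ} {x : ℕ → wordSpan u v Ω} (hlen : ∀ m, 1 ≤ len m)
  (hx : ∀ m, x m ∈ kindSpan hON hd (kind m) (len m)) (hxo : Orthonormal ℂ x)

include hxo in
theorem shiftVec_norm_bounds (p : ℕ × ℕ × ℕ) {n : ℕ} (hp : p.2.1 + p.2.2 = n) :
    3 ^ n ≤ ‖shiftVec hON hd x p‖ ^ 2 ∧ ‖shiftVec hON hd x p‖ ^ 2 ≤ 16 / 9 * 3 ^ n := by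
  have := shift_norm_bounds hON hd p.2.1 p.2.2 (x p.1)
  rw [hxo.1, one_pow, mul_one, hp] at this
  exact this

variable (kind len) in
open Classical in
/-- The group of a normalised shift. -/
def rieszGroup (p : ℕ × ℕ × ℕ) : (ℕ × ℕ) ⊕ ℕ :=
  if kind p.1 ≠ Kind.zero ∨ 2 ≤ len p.1 then Sum.inl p.2 else Sum.inr (p.2.1 + p.2.2)

include hlen hx in
-- If one of the vectors is not a combination of letters, this is `inner_shift_kindSpan`. Two
-- combinations of letters in different groups have shifts of different length.
theorem inner_rieszVec_of_group_ne (p p' : ℕ × ℕ × ℕ)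
    (h : rieszGroup kind len p ≠ rieszGroup kind len p') :
    ⟪rieszVec hON hd x p, rieszVec hON hd x p'⟫_ℂ = 0 := by
  have key : ∀ p p' : ℕ × ℕ × ℕ, rieszGroup kind len p ≠ rieszGroup kind len p' →
      (kind p.1 ≠ Kind.zero ∨ 2 ≤ len p.1) →
        ⟪shiftVec hON hd x p, shiftVec hON hd x p'⟫_ℂ = 0 := by
    intro p p' h hp
    refine inner_shift_kindSpan hON hd (hx p.1) (hx p'.1) hp (hlen _) ?_
    by_cases hp' : kind p'.1 ≠ Kind.zero ∨ 2 ≤ len p'.1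
    · rw [rieszGroup, rieszGroup, if_pos hp, if_pos hp'] at h
      exact Or.inl fun h' => h (congrArg _ h')
    · refine Or.inr fun h' => hp' ?_
      simp only [Prod.mk.injEq] at h'
      rwa [← h'.1, ← h'.2]
  rw [rieszVec, rieszVec, inner_smul_left, inner_smul_right]
  suffices ⟪shiftVec hON hd x p, shiftVec hON hd x p'⟫_ℂ = 0 by rw [this, mul_zero, mul_zero]
  by_cases hp : kind p.1 ≠ Kind.zero ∨ 2 ≤ len p.1
  · exact key p p' h hp
  by_cases hp' : kind p'.1 ≠ Kind.zero ∨ 2 ≤ len p'.1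
  · rw [← inner_conj_symm]
    change (starRingEnd ℂ) ⟪shiftVec hON hd x p', shiftVec hON hd x p⟫_ℂ = 0
    rw [key p' p h.symm hp', map_zero]
  · rw [rieszGroup, rieszGroup, if_neg hp, if_neg hp'] at h
    have h1 := (eq_zero_one_of_not_good (hlen _) hp).2
    have h2 := (eq_zero_one_of_not_good (hlen _) hp').2
    refine inner_gradedSpan hON
      (shift_mem_gradedSpan hON hd (kindSpan_le_gradedSpan hON hd _ _ (hx p.1)) p.2.1 p.2.2)
      (shift_mem_gradedSpan hON hd (kindSpan_le_gradedSpan hON hd _ _ (hx p'.1)) p'.2.1 p'.2.2)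
      (Or.inl fun h3 => h ?_)
    rw [h1, h2] at h3
    exact congrArg _ (by omega)

variable (huv : ∀ i, (u i : H →L[ℂ] H) * (v i : H →L[ℂ] H) =
      d • ((v i : H →L[ℂ] H) * (u i : H →L[ℂ] H)))

include hlen hx hxo huv in
-- On a group (r, s) the shift is one operator with two-sided bounds, which gives 9/16 and 16/9. The
-- groups of letters need `letter_bounds` and determine the constants: 9/40 = 2/5 · 9/16, and 4.
theorem rieszBound_rieszVec (s : Finset (ℕ × ℕ × ℕ)) (a : ℕ × ℕ × ℕ → ℂ) :
    RieszBound (rieszVec hON hd x) (9 / 40) 4 s a := by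
  classical
  refine RieszBound.of_groups (rieszGroup kind len)
    (inner_rieszVec_of_group_ne hON hd hlen hx) (fun k s hs a => ?_) s a
  set N : ℕ × ℕ × ℕ → ℝ := fun p => ‖shiftVec hON hd x p‖ with hN
  have hterm : ∀ p, a p • rieszVec hON hd x p = (leftAction.up (wordBasis hON) ^ p.2.1)
      (((rightAction d hd).up (wordBasis hON) ^ p.2.2)
        ((a p * ((N p)⁻¹ : ℝ)) • x p.1)) := by
    intro p
    rw [map_smul, map_smul, rieszVec, smul_smul]; rfl
  have hgood : ∀ p : ℕ × ℕ × ℕ, (kind p.1 ≠ Kind.zero ∨ 2 ≤ len p.1) ∨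
      (kind p.1 = Kind.zero ∧ len p.1 = 1) := fun p => by
    by_cases h : kind p.1 ≠ Kind.zero ∨ 2 ≤ len p.1
    · exact Or.inl h
    · exact Or.inr (eq_zero_one_of_not_good (hlen _) h)
  have hbad : ∀ p : ℕ × ℕ × ℕ, kind p.1 = Kind.zero ∧ len p.1 = 1 →
      ¬ (kind p.1 ≠ Kind.zero ∨ 2 ≤ len p.1) := fun p h h' => by
    rcases h' with h' | h'
    · exact h' h.1
    · omega
  rcases k with ⟨r, t⟩ | n
  · have hs' : ∀ p ∈ s, p.2 = (r, t) := by
      intro p hp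
      have := hs p hp
      rcases hgood p with h | h
      · rw [rieszGroup, if_pos h] at this
        exact Sum.inl_injective this
      · rw [rieszGroup, if_neg (hbad p h)] at this
        simp at this
    have hsum : ∑ p ∈ s, a p • rieszVec hON hd x p = (leftAction.up (wordBasis hON) ^ r)
        (((rightAction d hd).up (wordBasis hON) ^ t)
          (∑ p ∈ s, (a p * ((N p)⁻¹ : ℝ)) • x p.1)) := by
      rw [map_sum, map_sum]
      refine Finset.sum_congr rfl fun p hp => ?_
      rw [hterm, hs' p hp]
    obtain ⟨h1, h2⟩ := weighted_sum_bounds hxo (fun p : ℕ × ℕ × ℕ => p.1) s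
      (fun p hp p' hp' hne h => hne (Prod.ext h ((hs' p hp).trans (hs' p' hp').symm)))
      (N := N) (n := r + t)
      (fun p hp => shiftVec_norm_bounds hON hd hxo p (by rw [hs' p hp])) a
    obtain ⟨h3, h4⟩ := shift_norm_bounds hON hd r t (∑ p ∈ s, (a p * ((N p)⁻¹ : ℝ)) • x p.1)
    have h0 : 0 ≤ ∑ p ∈ s, ‖a p‖ ^ 2 := Finset.sum_nonneg fun _ _ => sq_nonneg _
    rw [RieszBound, hsum]
    constructor <;> linarith
  · have hs' : ∀ p ∈ s, p.2.1 + p.2.2 = n ∧ kind p.1 = Kind.zero ∧ len p.1 = 1 := by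
      intro p hp
      have := hs p hp
      rcases hgood p with h | h
      · rw [rieszGroup, if_pos h] at this
        simp at this
      · rw [rieszGroup, if_neg (hbad p h)] at this
        exact ⟨Sum.inr_injective this, h⟩
    -- Terms with the same left shift r have the same right shift n - r and can be added before
    -- shifting.
    set y : ℕ → wordSpan u v Ω := fun r =>
      ∑ p ∈ s with p.2.1 = r, (a p * ((N p)⁻¹ : ℝ)) • x p.1 with hy
    have hym : ∀ r, y r ∈ letterSpan hON hd := by
      intro r
      refine Submodule.sum_mem _ fun p hp => Submodule.smul_mem _ _ ?_
      obtain ⟨-, h1, h2⟩ := hs' p (Finset.mem_filter.1 hp).1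
      have := hx p.1
      rwa [h1, h2] at this
    have hmaps : ∀ p ∈ s, p.2.1 ∈ Finset.range (n + 1) := fun p hp => by
      have := (hs' p hp).1
      rw [Finset.mem_range]; omega
    have hsum : ∑ p ∈ s, a p • rieszVec hON hd x p =
        ∑ r ∈ Finset.range (n + 1), letterShift hON hd n r (y r) := by
      rw [← Finset.sum_fiberwise_of_maps_to hmaps]
      refine Finset.sum_congr rfl fun r _ => ?_
      rw [hy, letterShift, map_sum, map_sum]
      refine Finset.sum_congr rfl fun p hp => ?_
      obtain ⟨hps, rfl⟩ := Finset.mem_filter.1 hp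
      rw [hterm, show p.2.2 = n - p.2.1 by have := (hs' p hps).1; omega]
    have hsq : ∑ p ∈ s, ‖a p‖ ^ 2 =
        ∑ r ∈ Finset.range (n + 1), ∑ p ∈ s with p.2.1 = r, ‖a p‖ ^ 2 :=
      (Finset.sum_fiberwise_of_maps_to hmaps _).symm
    have hw := fun r => weighted_sum_bounds hxo (fun p : ℕ × ℕ × ℕ => p.1)
      (s.filter fun p => p.2.1 = r)
      (fun p hp p' hp' hne h => by
        obtain ⟨hp, h1⟩ := Finset.mem_filter.1 hp
        obtain ⟨hp', h2⟩ := Finset.mem_filter.1 hp'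
        have h3 := (hs' p hp).1
        have h4 := (hs' p' hp').1
        exact hne (Prod.ext h (Prod.ext (h1.trans h2.symm) (by omega))))
      (N := N) (n := n)
      (fun p hp => shiftVec_norm_bounds hON hd hxo p (hs' p (Finset.mem_filter.1 hp).1).1) a
    have h1 : 9 / 16 * ∑ p ∈ s, ‖a p‖ ^ 2 ≤
        3 ^ n * ∑ r ∈ Finset.range (n + 1), ‖y r‖ ^ 2 := by
      rw [hsq, Finset.mul_sum, Finset.mul_sum]
      exact Finset.sum_le_sum fun r _ => (hw r).1
    have h2 : 3 ^ n * ∑ r ∈ Finset.range (n + 1), ‖y r‖ ^ 2 ≤ ∑ p ∈ s, ‖a p‖ ^ 2 := by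
      rw [hsq, Finset.mul_sum]
      exact Finset.sum_le_sum fun r _ => (hw r).2
    obtain ⟨h3, h4⟩ := letter_bounds huv y hym n le_rfl
    rw [RieszBound, hsum]
    rw [Finset.sum_range_succ] at h1 h2
    have h5 : 0 ≤ 3 ^ n * ‖y n‖ ^ 2 := by positivity
    have h0 : 0 ≤ ∑ p ∈ s, ‖a p‖ ^ 2 := Finset.sum_nonneg fun _ _ => sq_nonneg _
    constructor <;> linarith

include hlen hx hxo in
/-- The span of the normalised shifts. -/
theorem span_rieszVec (hspan : ∀ l, 1 ≤ l → ∀ κ, kindSpan hON hd κ l ≤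
      Submodule.span ℂ {y | ∃ m, kind m = κ ∧ len m = l ∧ y = x m}) :
    Submodule.span ℂ (Set.range (rieszVec hON hd x)) = rieszSpan hON hd := by
  apply le_antisymm
  · refine Submodule.span_le.2 ?_
    rintro _ ⟨p, rfl⟩
    exact Submodule.smul_mem _ _ (shift_mem_rieszSpan (hlen _) (hx _) _ _)
  · refine rieszSpan_le fun κ l hl y hy r s => ?_
    have : Submodule.span ℂ {y | ∃ m, kind m = κ ∧ len m = l ∧ y = x m} ≤
        (Submodule.span ℂ (Set.range (rieszVec hON hd x))).comap
          ((leftAction.up (wordBasis hON) ^ r) ∘ₗ ((rightAction d hd).up (wordBasis hON) ^ s)) := by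
      refine Submodule.span_le.2 ?_
      rintro _ ⟨m, -, -, rfl⟩
      have h1 := (shiftVec_norm_bounds hON hd hxo (m, r, s) rfl).1
      have h2 : (((‖shiftVec hON hd x (m, r, s)‖⁻¹ : ℝ)) : ℂ) ≠ 0 := by
        have h3 : (0 : ℝ) < 3 ^ (r + s) := by positivity
        rw [Complex.ofReal_ne_zero]
        refine inv_ne_zero fun h => ?_
        rw [h] at h1
        norm_num at h1
        linarith
      change shiftVec hON hd x (m, r, s) ∈ Submodule.span ℂ (Set.range (rieszVec hON hd x))
      exact (Submodule.smul_mem_iff _ h2).1 (Submodule.subset_span ⟨(m, r, s), rfl⟩)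
    exact this (hspan l hl κ hy)

end Basis

/-! ### Basis sequences: existence and the Riesz property -/

section Sequences

variable {H : Type*} [NormedAddCommGroup H] [InnerProductSpace ℂ H] [CompleteSpace H]
variable {u v : Fin 2 → unitary (H →L[ℂ] H)} {Ω : H}
variable (hON : Orthonormal ℂ fun w : RWord => wordOp u v w.1 Ω)
variable {d : ℂ} (hd : ‖d‖ = 1)
variable (huv : ∀ i, (u i : H →L[ℂ] H) * (v i : H →L[ℂ] H) =
      d • ((v i : H →L[ℂ] H) * (u i : H →L[ℂ] H)))
include huv

/-- Basis sequences as sequences of vectors. -/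
theorem IsBasisSequence.exists_vectors {ξ : ℕ → (H →L[ℂ] H)} {len : ℕ → ℕ} {kind : ℕ → Kind}
    (h : IsBasisSequence u v Ω ξ len kind) : ∃ x : ℕ → wordSpan u v Ω,
      (∀ m, toOp hON (x m) = ξ m) ∧ (∀ m, x m ∈ kindSpan hON hd (kind m) (len m)) ∧
      Orthonormal ℂ x ∧ ∀ l, 1 ≤ l → ∀ κ, kindSpan hON hd κ l ≤
        Submodule.span ℂ {y | ∃ m, kind m = κ ∧ len m = l ∧ y = x m} := by
  have h1 : ∀ m, ∃ x ∈ kindSpan hON hd (kind m) (len m), toOp hON x = ξ m := fun m => by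
    have := h.mem m
    rwa [N_eq_map hON hd huv _ (h.len_pos m)] at this
  choose x hx hxξ using h1
  refine ⟨x, hxξ, hx, ?_, fun l hl κ y hy => ?_⟩
  · refine (LinearIsometry.orthonormal_comp_iff (wordSpan u v Ω).subtypeₗᵢ).1 ?_
    convert h.orthonormal using 1
    ext m
    rw [← hxξ, toOp_apply]; rfl
  · have h2 := h.span l hl κ
    rw [N_eq_map hON hd huv κ hl] at h2
    have h3 : Submodule.span ℂ {X | ∃ m, kind m = κ ∧ len m = l ∧ X = ξ m} =
        (Submodule.span ℂ {y | ∃ m, kind m = κ ∧ len m = l ∧ y = x m}).map (toOp hON) := by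
      rw [Submodule.map_span]
      congr 1
      ext X
      constructor
      · rintro ⟨m, h4, h5, rfl⟩
        exact ⟨_, ⟨m, h4, h5, rfl⟩, hxξ m⟩
      · rintro ⟨_, ⟨m, h4, h5, rfl⟩, rfl⟩
        exact ⟨m, h4, h5, hxξ m⟩
    rw [h3] at h2
    obtain ⟨z, hz, hzy⟩ := h2 ⟨y, hy, rfl⟩
    rwa [← toOp_injective hON hzy]

include hON hd in
theorem IsBasisSequence.isRieszBasis (hroot : ∀ n : ℕ, n ≠ 0 → d ^ n ≠ 1)
    (hdense : (wordSpan u v Ω).topologicalClosure = ⊤)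
    {ξ : ℕ → (H →L[ℂ] H)} {len : ℕ → ℕ} {kind : ℕ → Kind}
    (h : IsBasisSequence u v Ω ξ len kind) :
    IsRieszBasis (fun p : ℕ × ℕ × ℕ =>
      ((‖shift u v Ω (len p.1) (ξ p.1) p.2.1 p.2.2‖⁻¹ : ℝ) : ℂ) •
        shift u v Ω (len p.1) (ξ p.1) p.2.1 p.2.2) (L2A u Ω ⊔ L d u v Ω)ᗮ := by
  obtain ⟨x, hxξ, hx, hxo, hspan⟩ := h.exists_vectors hON hd huv
  have hf : (fun p : ℕ × ℕ × ℕ =>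
      ((‖shift u v Ω (len p.1) (ξ p.1) p.2.1 p.2.2‖⁻¹ : ℝ) : ℂ) •
        shift u v Ω (len p.1) (ξ p.1) p.2.1 p.2.2) =
      fun p => (rieszVec hON hd x p : H) := by
    funext p
    rw [← hxξ, shift_toOp hON hd huv (kindSpan_le_len hON hd _ _ (hx p.1))]
    rfl
  rw [hf]
  refine ⟨?_, 9 / 40, 4, by norm_num, fun a => ?_⟩
  · rw [orthogonal_L2A_sup_L hON hd huv hroot hdense, closureL2,
      ← span_rieszVec hON hd h.len_pos hx hxo hspan, Submodule.map_span, ← Set.range_comp]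
    rfl
  · have hb := rieszBound_rieszVec hON hd h.len_pos hx hxo huv a.support a
    have hsum : ∑ j ∈ a.support, a j • (rieszVec hON hd x j : H) =
        ((∑ j ∈ a.support, a j • rieszVec hON hd x j : wordSpan u v Ω) : H) := by
      simp
    rw [hsum]
    exact hb

include hON hd in
/-- Orthonormal bases of the spaces can be enumerated. -/
theorem exists_isBasisSequence : ∃ ξ len kind, IsBasisSequence u v Ω ξ len kind := by
  have hfin : ∀ κ l, FiniteDimensional ℂ (kindSpan hON hd κ l) := fun κ l =>
    Submodule.finiteDimensional_of_le (kindSpan_le_gradedSpan hON hd κ l)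
  let I : Type := Σ p : {p : Kind × ℕ // 1 ≤ p.2},
    Fin (Module.finrank ℂ (kindSpan hON hd p.1.1 p.1.2))
  let y : I → wordSpan u v Ω := fun i =>
    (stdOrthonormalBasis ℂ (kindSpan hON hd i.1.1.1 i.1.1.2) i.2 : wordSpan u v Ω)
  have hy : ∀ i : I, y i ∈ kindSpan hON hd i.1.1.1 i.1.1.2 := fun i => Subtype.mem _
  have hyo : Orthonormal ℂ y := by
    constructor
    · rintro ⟨p, i⟩
      exact (stdOrthonormalBasis ℂ (kindSpan hON hd p.1.1 p.1.2)).orthonormal.1 i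
    · rintro ⟨⟨⟨κ, l⟩, hl⟩, i⟩ ⟨⟨⟨κ', l'⟩, hl'⟩, i'⟩ hne
      by_cases hκ : (κ, l) = (κ', l')
      · simp only [Prod.mk.injEq] at hκ
        obtain ⟨rfl, rfl⟩ := hκ
        refine (stdOrthonormalBasis ℂ (kindSpan hON hd κ l)).orthonormal.2 (i := i) (j := i') ?_
        rintro rfl
        exact hne rfl
      · refine inner_gradedSpan hON
          (kindSpan_le_gradedSpan hON hd _ _ (hy ⟨⟨⟨κ, l⟩, hl⟩, i⟩))
          (kindSpan_le_gradedSpan hON hd _ _ (hy ⟨⟨⟨κ', l'⟩, hl'⟩, i'⟩)) ?_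
        by_cases hll : l = l'
        · subst hll
          exact Or.inr (not_kindProp (fun h => hκ (Prod.ext h rfl)) l)
        · exact Or.inl hll
  have : Countable Kind := by
    refine Function.Injective.countable (f := fun κ : Kind => (κ.rec 0 1 2 3 : ℕ)) ?_
    intro a b h
    cases a <;> cases b <;> simp at h ⊢
  have : Countable I := inferInstance
  -- The sequence is indexed by all of ℕ, so infinitely many basis vectors are needed; antisymmetric
  -- vectors exist in every length n + 2.
  have : Infinite I := by
    have hpos : ∀ n : ℕ, 0 < Module.finrank ℂ (kindSpan hON hd Kind.alphaTwo (n + 2)) := by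
      intro n
      have hm : ((n + 1 : ℕ) : ℤ) ≠ 0 := by omega
      rw [Module.finrank_pos_iff_exists_ne_zero]
      refine ⟨⟨vecL hON 0 1 (n + 1 : ℕ) - vecL hON 0 (-1) (n + 1 : ℕ),
        Submodule.subset_span ⟨0, _, hm, by omega, Or.inl rfl⟩⟩, fun h => ?_⟩
      have h1 := congrArg Subtype.val h
      change vecL hON 0 1 (n + 1 : ℕ) - vecL hON 0 (-1) (n + 1 : ℕ) = 0 at h1
      rw [sub_eq_zero, vecL, vecL, wvec_of_reduced hON (isReducedWord_vecL hm 1),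
        wvec_of_reduced hON (isReducedWord_vecL hm (-1))] at h1
      have h2 := congrArg Subtype.val ((wordBasis hON).injective h1)
      simp at h2
    exact Infinite.of_injective (fun n : ℕ => (⟨⟨(Kind.alphaTwo, n + 2), by omega⟩,
      ⟨0, hpos n⟩⟩ : I)) fun n n' h => by
        have := congrArg (fun i : I => i.1.1.2) h
        simpa using this
  obtain ⟨e⟩ : Nonempty (ℕ ≃ I) := nonempty_equiv_of_countable
  refine ⟨fun m => toOp hON (y (e m)), fun m => (e m).1.1.2, fun m => (e m).1.1.1,
    fun m => (e m).1.2, fun m => ?_, ?_, fun l hl κ => ?_⟩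
  · rw [N_eq_map hON hd huv _ (e m).1.2]
    exact ⟨_, hy (e m), rfl⟩
  · have h1 : Orthonormal ℂ fun m => y (e m) := hyo.comp e e.injective
    have := (LinearIsometry.orthonormal_comp_iff (wordSpan u v Ω).subtypeₗᵢ).2 h1
    convert this using 1
    ext m
    rw [toOp_apply]; rfl
  · rw [N_eq_map hON hd huv κ hl]
    rintro _ ⟨x, hx, rfl⟩
    have hbasis := (stdOrthonormalBasis ℂ (kindSpan hON hd κ l)).sum_repr ⟨x, hx⟩
    have hx' := congrArg Subtype.val hbasis
    simp only [Submodule.coe_sum, Submodule.coe_smul] at hx'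
    rw [← hx', map_sum]
    refine Submodule.sum_mem _ fun i _ => ?_
    rw [map_smul]
    refine Submodule.smul_mem _ _ (Submodule.subset_span ⟨e.symm ⟨⟨(κ, l), hl⟩, i⟩, ?_⟩)
    simp only [Equiv.apply_symm_apply, true_and, y]

end Sequences

/-! ### Colours of words with one v-syllable -/

section Color

/-- The data `(i, l, k, r, s)` of a word `x u_i^k v_i^l y` with words `x`, `y` of lengths `r`, `s`
in the letters `u_1^{±1}, u_2^{±1}`; `r₀` is added to `r`. -/
def colorAux : ℕ → List Syllable → Option XiIndex
  | _, [] => none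
  | r₀, (i, k, l) :: t =>
    if h : l ≠ 0 then
      if vCount t = 0 then some (i, ⟨l, h⟩, k, r₀, wordLength t) else none
    else colorAux (r₀ + k.natAbs) t

/-- The data `(i, l, k, r, s)` of a word `x u_i^k v_i^l y` with words `x`, `y` of lengths `r`, `s`
in the letters `u_1^{±1}, u_2^{±1}`. -/
def color (w : List Syllable) : Option XiIndex := colorAux 0 w

theorem color_append {x y : List Syllable} (hx : vCount x = 0) (hy : vCount y = 0) (i : Fin 2)
    (k : ℤ) {l : ℤ} (hl : l ≠ 0) : color (x ++ (i, k, l) :: y) =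
      some (i, ⟨l, hl⟩, k, wordLength x, wordLength y) := by
  have key : ∀ r₀, colorAux r₀ (x ++ (i, k, l) :: y) =
      some (i, ⟨l, hl⟩, k, r₀ + wordLength x, wordLength y) := by
    induction x with
    | nil => intro r₀; simp [colorAux, hl, hy]
    | cons s t ih =>
      intro r₀
      obtain ⟨i', k', l'⟩ := s
      have hl' : l' = 0 := by
        by_contra h; simp [h] at hx
      subst hl'
      rw [List.cons_append, colorAux, dif_neg (by simp), ih (by simpa using hx)]
      simp [add_assoc]
  rw [color, key, zero_add]

theorem color_of_vCount_ne_one {w : List Syllable} (h : vCount w ≠ 1) : color w = none := by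
  have key : ∀ r₀, colorAux r₀ w = none := by
    induction w with
    | nil => intro r₀; rfl
    | cons s t ih =>
      intro r₀
      obtain ⟨i, k, l⟩ := s
      rw [colorAux]
      by_cases hl : l = 0
      · subst hl
        rw [dif_neg (by simp)]
        exact ih (by simpa using h) _
      · rw [dif_pos hl, if_neg]
        intro h0
        simp [hl, h0] at h
  exact key 0

theorem exists_of_color {w : List Syllable} {i : Fin 2} {l : {l : ℤ // l ≠ 0}} {k : ℤ} {r s : ℕ}
    (h : color w = some (i, l, k, r, s)) : ∃ x y, w = x ++ (i, k, l.1) :: y ∧ vCount x = 0 ∧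
      vCount y = 0 ∧ wordLength x = r ∧ wordLength y = s := by
  by_cases hv : vCount w = 1
  · obtain ⟨x, i', k', l', y, rfl, hx, hy, hl⟩ := exists_eq_of_vCount_eq_one hv
    rw [color_append hx hy i' k' hl] at h
    simp only [Option.some.injEq, Prod.mk.injEq] at h
    obtain ⟨rfl, rfl, rfl, rfl, rfl⟩ := h
    exact ⟨x, y, rfl, hx, hy, rfl, rfl⟩
  · rw [color_of_vCount_ne_one hv] at h
    exact absurd h (by simp)

theorem color_eq_some_iff {w : List Syllable} {p : XiIndex} : color w = some p ↔
    ∃ x y, w = x ++ (p.1, p.2.2.1, p.2.1.1) :: y ∧ vCount x = 0 ∧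
      vCount y = 0 ∧ wordLength x = p.2.2.2.1 ∧ wordLength y = p.2.2.2.2 := by
  constructor
  · exact exists_of_color
  · rintro ⟨x, y, rfl, hx, hy, h1, h2⟩
    rw [color_append hx hy p.1 p.2.2.1 p.2.1.2, h1, h2]

/-- The exchange of `r` and `s`. -/
def swapColor (p : XiIndex) : XiIndex := (p.1, p.2.1, p.2.2.1, p.2.2.2.2, p.2.2.2.1)

/-- Right multiplication is left multiplication conjugated by reversal, so one neighbour count
serves both sides. -/
theorem color_reverse (w : List Syllable) : color w.reverse = (color w).map swapColor := by
  by_cases hv : vCount w = 1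
  · obtain ⟨x, i, k, l, y, rfl, hx, hy, hl⟩ := exists_eq_of_vCount_eq_one hv
    rw [List.reverse_append, List.reverse_cons, List.append_assoc, List.singleton_append,
      color_append (by simpa using hy) (by simpa using hx) i k hl, color_append hx hy i k hl]
    simp [swapColor]
  · rw [color_of_vCount_ne_one hv, color_of_vCount_ne_one (by simpa using hv)]; rfl

/-- The sum of the values of a function of the colors over the neighbours of a word of a given
color, with phases. -/
def colorStep (d : ℂ) (f : Option XiIndex → ℂ) : Option XiIndex → ℂ
  | none => 0
  | some (i, l, k, 0, s) =>
    starRingEnd ℂ (phaseHead d (i, 1) [(i, k, l.1)]) * f (some (i, l, k + 1, 0, s)) +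
      starRingEnd ℂ (phaseHead d (i, -1) [(i, k, l.1)]) * f (some (i, l, k - 1, 0, s)) +
        2 * f (some (i, l, k, 1, s))
  | some (i, l, k, r + 1, s) => f (some (i, l, k, r, s)) + 3 * f (some (i, l, k, r + 2, s))

theorem sum_letters_index {M : Type*} [AddCommMonoid M] (i : Fin 2) (f : Letter → M) :
    ∑ c, f c = (f (i, 1) + f (i, -1)) + (f (1 - i, 1) + f (1 - i, -1)) := by
  have h : (Finset.univ : Finset ℤˣ) = {1, -1} := rfl
  have h1 : (1 : ℤˣ) ≠ -1 := by decide
  rw [Fintype.sum_prod_type, Fin.sum_univ_two, h, Finset.sum_pair h1, Finset.sum_pair h1]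
  fin_cases i
  · rfl
  · exact add_comm _ _

theorem phaseHead_of_append {d : ℂ} {x t : List Syllable} (hx : vCount x = 0) (h : x ≠ [])
    (c : Letter) : phaseHead d c (x ++ t) = 1 := by
  rcases x with _ | ⟨⟨i, k, l⟩, x⟩
  · exact absurd rfl h
  · have hl : l = 0 := by
      by_contra hl; simp [hl] at hx
    subst hl
    simp [phaseHead]

/-- Write w = x u_i^k v_i^l y. If x is not empty, one letter shortens x and three lengthen it,
without phases. If x is empty, the letters of index i change k with phases determined by l, and the
two others begin a new x. Hence the sum depends on w only through its colour. -/
theorem sum_color_lmul (d : ℂ) {w : List Syllable} (hw : IsReducedWord w)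
    {f : Option XiIndex → ℂ} (hf : f none = 0) :
    ∑ c, starRingEnd ℂ (phaseHead d c w) * f (color (lmul c w)) = colorStep d f (color w) := by
  by_cases hv : vCount w = 1
  swap
  · rw [color_of_vCount_ne_one hv]
    refine Finset.sum_eq_zero fun c _ => ?_
    rw [color_of_vCount_ne_one (by rwa [vCount_lmul]), hf, mul_zero]
  obtain ⟨x, i, k, l, y, rfl, hx, hy, hl⟩ := exists_eq_of_vCount_eq_one hv
  rw [color_append hx hy i k hl]
  by_cases hx0 : x = []
  · subst hx0
    rw [sum_letters_index i]
    have h1 : ∀ e : ℤˣ, color (lmul (i, e) ([] ++ (i, k, l) :: y)) =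
        some (i, ⟨l, hl⟩, k + e, 0, wordLength y) := by
      intro e
      rw [List.nil_append, lmul_cons, if_pos rfl, if_neg (by simp [hl])]
      exact color_append (x := []) rfl hy i (k + e) hl
    have h2 : ∀ e : ℤˣ, color (lmul (1 - i, e) ([] ++ (i, k, l) :: y)) =
        some (i, ⟨l, hl⟩, k, 1, wordLength y) := by
      intro e
      rw [List.nil_append, lmul_cons, if_neg (one_sub_ne i).symm]
      have := color_append (x := [(1 - i, (e : ℤ), 0)]) (by simp) hy i k hl
      rw [List.singleton_append] at this
      rw [this]
      rcases unit_cases e with h | h <;> simp [h]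
    have h3 : ∀ e : ℤˣ, phaseHead d (1 - i, e) ([] ++ (i, k, l) :: y) = 1 := by
      intro e
      simp [phaseHead, (one_sub_ne i).symm]
    rw [h1, h1, h2, h2, h3, h3, map_one]
    simp only [wordLength_nil, colorStep, Units.val_one, Units.val_neg, ← sub_eq_add_neg]
    rw [show ∀ e, phaseHead d (i, e) ([] ++ (i, k, l) :: y) = phaseHead d (i, e) [(i, k, l)] from
      fun e => rfl, show ∀ e, phaseHead d (i, e) ([] ++ (i, k, l) :: y) =
        phaseHead d (i, e) [(i, k, l)] from fun e => rfl]
    ring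
  · have hxr := (isReducedWord_append.1 hw).1
    obtain ⟨c₀, hc₀⟩ := exists_descent_of_vCount_eq_zero hxr hx hx0
    have hcol : ∀ c, color (lmul c (x ++ (i, k, l) :: y)) =
        some (i, ⟨l, hl⟩, k, wordLength (lmul c x), wordLength y) := by
      intro c
      rw [lmul_append hx0, color_append (by rwa [vCount_lmul]) hy i k hl]
    have h0 : wordLength (lmul c₀ x) + 1 = wordLength x := by
      rcases wordLength_lmul hxr c₀ with h | h
      · exact h.2
      · exact absurd hc₀ h.1
    have h1 : ∀ c ∈ Finset.univ.erase c₀, wordLength (lmul c x) = wordLength x + 1 := by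
      intro c hc
      rcases wordLength_lmul hxr c with h | h
      · exact absurd (h.1.unique hc₀) (Finset.ne_of_mem_erase hc)
      · exact h.2
    obtain ⟨r, hr⟩ : ∃ r, wordLength x = r + 1 := ⟨_, h0.symm⟩
    simp only [phaseHead_of_append hx hx0, map_one, one_mul, hcol]
    rw [← Finset.sum_erase_add _ _ (Finset.mem_univ c₀),
      Finset.sum_congr rfl fun c hc => by rw [h1 c hc], Finset.sum_const,
      Finset.card_erase_of_mem (Finset.mem_univ _), hr,
      show wordLength (lmul c₀ x) = r by omega, show (Finset.univ : Finset Letter).card = 4 from rfl]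
    simp only [colorStep, nsmul_eq_mul]
    push_cast
    ring

end Color

section ColorSpan

variable {X E : Type*} [NormedAddCommGroup E] [InnerProductSpace ℂ E]

/-- A vector whose coefficients depend only on the colors is a combination of the sums over the
color classes. -/
theorem mem_span_setVec {P : Type*} {b : Module.Basis X ℂ E} (hb : Orthonormal ℂ b)
    (col : X → Option P) (hfin : ∀ p, {x | col x = some p}.Finite) {c : Option P → ℂ}
    (hc : c none = 0) {y : E} (hy : ∀ x, ⟪b x, y⟫_ℂ = c (col x)) :
    y ∈ Submodule.span ℂ (Set.range fun p => setVec b (hfin p)) := by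
  classical
  set F : Finset P := Finset.eraseNone ((b.repr y).support.image col) with hF
  have : y = ∑ p ∈ F, c (some p) • setVec b (hfin p) := by
    refine ext_inner_basis (b := b) fun x => ?_
    simp only [inner_sum, inner_smul_right, inner_setVec hb, Set.mem_ofPred_eq, mul_ite, mul_one,
      mul_zero]
    rw [hy]
    rcases hx : col x with _ | p
    · simp [hc]
    · simp only [Option.some.injEq, Finset.sum_ite_eq]
      split_ifs with h
      · rfl
      · rw [← hx, ← hy, ← repr_eq_inner hb]
        by_contra h'
        exact h (Finset.mem_eraseNone.2 (Finset.mem_image.2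
          ⟨x, Finsupp.mem_support_iff.2 h', hx⟩))
  rw [this]
  exact Submodule.sum_mem _ fun p _ => Submodule.smul_mem _ _ (Submodule.subset_span ⟨p, rfl⟩)

end ColorSpan

section ColorLists

theorem eq_one_sub_iff {i j : Fin 2} : j = 1 - i ↔ j ≠ i := by
  fin_cases i <;> fin_cases j <;> decide

theorem isReducedWord_append_cons {x y : List Syllable} {i : Fin 2} {k l : ℤ} (hl : l ≠ 0) :
    IsReducedWord (x ++ (i, k, l) :: y) ↔
      (IsReducedWord x ∧ ∀ s ∈ x.getLast?, s.1 = 1 - i) ∧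
        IsReducedWord y ∧ ∀ t ∈ y.head?, t.1 = 1 - i := by
  simp only [isReducedWord_append, isReducedWord_cons, eq_one_sub_iff, List.head?_cons,
    Option.mem_some_iff, forall_eq', ne_eq, Prod.mk.injEq, hl, and_false, not_false_eq_true,
    true_and, @eq_comm _ i]
  tauto

/-- The syllable s is the first one containing a power of v, so it marks the place of the cut. -/
theorem append_cons_inj {x x' y y' : List Syllable} {s : Syllable} (hs : s.2.2 ≠ 0)
    (hx : vCount x = 0) (hx' : vCount x' = 0) (h : x ++ s :: y = x' ++ s :: y') :
    x = x' ∧ y = y' := by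
  induction x generalizing x' with
  | nil =>
    rcases x' with _ | ⟨t, x'⟩
    · simpa using h
    · simp only [List.nil_append, List.cons_append, List.cons.injEq] at h
      obtain ⟨rfl, -⟩ := h
      simp [hs] at hx'
  | cons t x ih =>
    rcases x' with _ | ⟨t', x'⟩
    · simp only [List.nil_append, List.cons_append, List.cons.injEq] at h
      obtain ⟨rfl, -⟩ := h
      simp [hs] at hx
    · simp only [List.cons_append, List.cons.injEq] at h
      simp only [vCount_cons, Nat.add_eq_zero_iff] at hx hx'
      obtain ⟨h1, h2⟩ := ih hx.2 hx'.2 h.2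
      exact ⟨by rw [h.1, h1], h2⟩

theorem finite_color (p : XiIndex) : {z : RWord | color z.1 = some p}.Finite := by
  refine (finite_len (p.2.2.2.1 + (p.2.2.1.natAbs + p.2.1.1.natAbs + p.2.2.2.2))).subset ?_
  intro z hz
  obtain ⟨x, y, h, -, -, h1, h2⟩ := color_eq_some_iff.1 hz
  change wordLength z.1 = _
  rw [h, wordLength_append, wordLength_cons, h1, h2]

theorem isReducedWord_syl (i : Fin 2) (k l : ℤ) : IsReducedWord (syl i k l) := by
  rw [syl]
  split_ifs with h
  · exact isReducedWord_nil
  · exact isReducedWord_singleton.2 (by simpa using h)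

theorem exists_color (p : XiIndex) : ∃ z : RWord, color z.1 = some p := by
  obtain ⟨i, ⟨l, hl⟩, k, r, s⟩ := p
  have hv : ∀ n : ℕ, vCount (syl (1 - i) n 0) = 0 := by
    intro n; rw [syl]; split_ifs <;> simp
  refine ⟨⟨syl (1 - i) r 0 ++ (i, k, l) :: syl (1 - i) s 0,
    (isReducedWord_append_cons hl).2 ⟨⟨isReducedWord_syl _ _ _, ?_⟩,
      isReducedWord_syl _ _ _, ?_⟩⟩, ?_⟩
  · rw [syl]; split_ifs <;> simp
  · rw [syl]; split_ifs <;> simp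
  · rw [color_append (hv _) (hv _) i k hl, wordLength_syl, wordLength_syl]
    simp

theorem phaseHead_one (c : Letter) (w : List Syllable) : phaseHead 1 c w = 1 := by
  rcases w with _ | ⟨⟨i, k, l⟩, t⟩
  · rfl
  · simp [phaseHead]

end ColorLists

/-! ### Sums over colour classes and the vectors ξ^{i,l,k}_{r,s} -/

section ColorVec

variable {H : Type*} [NormedAddCommGroup H] [InnerProductSpace ℂ H] [CompleteSpace H]
variable {u v : Fin 2 → unitary (H →L[ℂ] H)} {Ω : H}
variable (hON : Orthonormal ℂ fun w : RWord => wordOp u v w.1 Ω)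
variable {d : ℂ} (hd : ‖d‖ = 1)
variable (huv : ∀ i, (u i : H →L[ℂ] H) * (v i : H →L[ℂ] H) =
      d • ((v i : H →L[ℂ] H) * (u i : H →L[ℂ] H)))

/-- The sum of the words of a given color. -/
def colorVec (p : XiIndex) : wordSpan u v Ω := setVec (wordBasis hON) (finite_color p)

/-- The span of the sums over the color classes. -/
def colorSpan : Submodule ℂ (wordSpan u v Ω) := Submodule.span ℂ (Set.range (colorVec hON))

variable {hON}

theorem mem_colorSpan {c : Option XiIndex → ℂ} (hc : c none = 0) {y : wordSpan u v Ω}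
    (hy : ∀ z : RWord, ⟪wordBasis hON z, y⟫_ℂ = c (color z.1)) : y ∈ colorSpan hON :=
  mem_span_setVec (orthonormal_wordBasis hON) (fun z : RWord => color z.1) finite_color hc hy

open Classical in
theorem inner_colorVec (p : XiIndex) (z : RWord) : ⟪wordBasis hON z, colorVec hON p⟫_ℂ =
    if color z.1 = some p then 1 else 0 := by
  simp [colorVec, setVec, orthonormal_iff_ite.mp (orthonormal_wordBasis hON)]

theorem left_total_mem_colorSpan {y : wordSpan u v Ω} (hy : y ∈ colorSpan hON) :
    leftAction.total (wordBasis hON) y ∈ colorSpan hON := by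
  classical
  have hb := orthonormal_wordBasis hON
  have : colorSpan hON ≤ (colorSpan hON).comap (leftAction.total (wordBasis hON)) := by
    refine Submodule.span_le.2 ?_
    rintro _ ⟨p, rfl⟩
    -- Left multiplication has no phases, which is the case d = 1 of `colorStep`.
    refine mem_colorSpan (c := colorStep 1 fun q => if q = some p then 1 else 0) rfl fun z => ?_
    rw [← LetterAction.inner_total _ hb, LetterAction.total_basis, sum_inner,
      ← sum_color_lmul 1 z.2 (by simp)]
    refine Finset.sum_congr rfl fun c _ => ?_
    rw [inner_smul_left, inner_colorVec, phaseHead_one]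
    rfl
  exact this hy

theorem right_total_mem_colorSpan {y : wordSpan u v Ω} (hy : y ∈ colorSpan hON) :
    (rightAction d hd).total (wordBasis hON) y ∈ colorSpan hON := by
  classical
  have hb := orthonormal_wordBasis hON
  have : colorSpan hON ≤ (colorSpan hON).comap ((rightAction d hd).total (wordBasis hON)) := by
    refine Submodule.span_le.2 ?_
    rintro _ ⟨p, rfl⟩
    -- Reversal exchanges r and s, so `swapColor` is applied both to the word and to its neighbours.
    refine mem_colorSpan (c := fun q => colorStep d
      (fun q' => if q'.map swapColor = some p then 1 else 0) (q.map swapColor)) rfl fun z => ?_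
    rw [← LetterAction.inner_total _ hb, LetterAction.total_basis, sum_inner,
      ← color_reverse, ← sum_color_lmul d z.2.reverse (by simp)]
    refine Finset.sum_congr rfl fun c _ => ?_
    rw [inner_smul_left, inner_colorVec, ← color_reverse]
    rfl
  exact this hy

/-- A colour class with r = s = 0 consists of a single word. -/
theorem vecUV_mem_colorSpan (i : Fin 2) (k : ℤ) {m : ℤ} (hm : m ≠ 0) :
    wvec hON [(i, k, m)] ∈ colorSpan hON := by
  classical
  have hr : IsReducedWord [(i, k, m)] := isReducedWord_singleton.2 (by simp [hm])
  have h0 : color [(i, k, m)] = some (i, ⟨m, hm⟩, k, 0, 0) :=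
    color_append (x := []) (y := []) rfl rfl i k hm
  rw [wvec_of_reduced hON hr]
  refine mem_colorSpan
    (c := fun q => if q = some (i, ⟨m, hm⟩, k, 0, 0) then 1 else 0) (by simp) fun z => ?_
  rw [orthonormal_iff_ite.1 (orthonormal_wordBasis hON)]
  refine if_congr ⟨?_, fun h => ?_⟩ rfl rfl
  · rintro rfl; exact h0
  · obtain ⟨x, y, h1, -, -, h2, h3⟩ := color_eq_some_iff.1 h
    have h4 := z.2
    rw [h1, isReducedWord_append_cons hm] at h4
    rw [eq_nil_of_wordLength h4.1.1 h2, eq_nil_of_wordLength h4.2.1 h3] at h1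
    exact RWord.ext h1

include hd huv in
-- The symmetric sum in γ is χ₁ v_i^m without the words u_i^{±1} v_i^m, all of which lie in the
-- invariant span; γ̄ is obtained in the same way from v_i^m χ₁.
theorem generators_subset_colorSpan : generators hON d ⊆ colorSpan hON := by
  rintro _ ⟨i, m, hm, h⟩
  have hV : vecV hON i m ∈ colorSpan hON := vecUV_mem_colorSpan i 0 hm
  have hU : ∀ e, vecUV hON i e m ∈ colorSpan hON := fun e => vecUV_mem_colorSpan i e hm
  rcases h with rfl | rfl | rfl
  · exact hV
  · have h1 := left_total_mem_colorSpan hV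
    rw [left_total_vecV hON hm] at h1
    exact sub_mem (Submodule.smul_mem _ _ (sub_mem (Submodule.smul_mem _ _ (hU _))
      (Submodule.smul_mem _ _ (hU _))))
      ((Submodule.add_mem_iff_right _ (add_mem (hU _) (hU _))).1 h1)
  · have h1 := right_total_mem_colorSpan hd hV
    rw [right_total_vecV hON hd huv hm] at h1
    exact sub_mem (Submodule.smul_mem _ _ (sub_mem (hU _) (hU _)))
      ((Submodule.add_mem_iff_right _ (add_mem (Submodule.smul_mem _ _ (hU _))
        (Submodule.smul_mem _ _ (hU _)))).1 h1)

include hd huv in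
theorem L_le_closureL2_colorSpan : L d u v Ω ≤ closureL2 (colorSpan hON) := by
  rw [L_eq hON hd huv]
  exact Submodule.topologicalClosure_mono (Submodule.map_mono
    (orbitSpan_le (generators_subset_colorSpan hd huv)
      (fun _ h => left_total_mem_colorSpan h) (fun _ h => right_total_mem_colorSpan hd h)))

theorem inner_colorVec_of_ne {p p' : XiIndex} (h : p ≠ p') :
    ⟪colorVec hON p, colorVec hON p'⟫_ℂ = 0 := by
  refine inner_eq_zero_of_disjoint (orthonormal_wordBasis hON) ?_ (setVec_mem _) (setVec_mem _)
  rw [Set.disjoint_left]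
  intro z hz hz'
  exact h (Option.some.inj (hz.symm.trans hz'))

theorem colorVec_ne_zero (p : XiIndex) : colorVec hON p ≠ 0 := by
  intro h
  obtain ⟨z, hz⟩ := exists_color p
  have := inner_colorVec (hON := hON) p z
  rw [if_pos hz, h, inner_zero_right] at this
  exact zero_ne_one this

/-- The two ends x and y of a word of given colour vary independently, so the sum over the class
factorises. -/
theorem toOp_colorVec (p : XiIndex) : toOp hON (colorVec hON p) =
    sumEnding u v (1 - p.1) p.2.2.2.1 * (uPow u p.1 p.2.2.1 * uPow v p.1 p.2.1.1) *
      sumBeginning u v (1 - p.1) p.2.2.2.2 := by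
  obtain ⟨i, ⟨l, hl⟩, k, r, s⟩ := p
  rw [colorVec, setVec, map_sum, sumEnding, sumBeginning, Finset.sum_mul, Finset.sum_mul_sum,
    ← Finset.sum_product']
  simp only [toOp_basis]
  have hv : ∀ n : ℕ, min n 2 = 0 ↔ n = 0 := fun n => by omega
  have hmem : ∀ q : List Syllable × List Syllable,
      q ∈ ((wordsOfType 0 r).filter fun w => ∀ s ∈ w.getLast?, s.1 = 1 - i) ×ˢ
        ((wordsOfType 0 s).filter fun w => ∀ t ∈ w.head?, t.1 = 1 - i) ↔
      IsReducedWord (q.1 ++ (i, k, l) :: q.2) ∧ vCount q.1 = 0 ∧ vCount q.2 = 0 ∧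
        wordLength q.1 = r ∧ wordLength q.2 = s := fun q => by
    rw [Finset.mem_product, Finset.mem_filter, Finset.mem_filter, mem_wordsOfType,
      mem_wordsOfType, isReducedWord_append_cons hl, hv, hv]
    tauto
  symm
  refine Finset.sum_bij (fun q hq => ⟨q.1 ++ (i, k, l) :: q.2, ((hmem q).1 hq).1⟩)
    (fun q hq => ?_) (fun q hq q' hq' h => ?_) (fun z hz => ?_) (fun q hq => ?_)
  · obtain ⟨-, h1, h2, h3, h4⟩ := (hmem q).1 hq
    rw [Set.Finite.mem_toFinset]
    exact color_eq_some_iff.2 ⟨_, _, rfl, h1, h2, h3, h4⟩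
  · obtain ⟨-, h1, -⟩ := (hmem q).1 hq
    obtain ⟨-, h2, -⟩ := (hmem q').1 hq'
    obtain ⟨h3, h4⟩ := append_cons_inj (s := (i, k, l)) hl h1 h2 (congrArg Subtype.val h)
    exact Prod.ext h3 h4
  · rw [Set.Finite.mem_toFinset] at hz
    obtain ⟨x, y, h, h1, h2, h3, h4⟩ := color_eq_some_iff.1 hz
    exact ⟨(x, y), (hmem (x, y)).2 ⟨h ▸ z.2, h1, h2, h3, h4⟩, RWord.ext h.symm⟩
  · rw [wordOp_append, wordOp_cons, mul_assoc, mul_assoc]; rfl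

include hd huv in
-- Exchanging v_i^l and u_i^k costs only a phase; the other factor is the positive normalisation.
theorem exists_xiFamily_eq (p : XiIndex) :
    ∃ a : ℂ, a ≠ 0 ∧ xiFamily u v Ω p = a • (colorVec hON p : H) := by
  have hd0 := norm_one_ne_zero hd
  refine ⟨((1 / (3 : ℝ) ^ (((p.2.2.2.1 : ℝ) + p.2.2.2.2) / 2 - 1) : ℝ) : ℂ) *
    d ^ (-(p.2.2.1 * p.2.1.1)), mul_ne_zero ?_ (zpow_ne_zero _ hd0), ?_⟩
  · exact Complex.ofReal_ne_zero.2 (by positivity)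
  · rw [xiFamily, xi, mul_smul, ← toOp_apply hON, toOp_colorVec, uPow_mul_uPow hd huv,
      mul_smul_comm, smul_mul_assoc, smul_apply, smul_smul (d ^ _),
      ← zpow_add₀ hd0, neg_add_cancel, zpow_zero, one_smul, mul_assoc (sumEnding _ _ _ _)]

variable (hON)

include hON hd huv

theorem xiFamily_ne_zero (p : XiIndex) : xiFamily u v Ω p ≠ 0 := by
  obtain ⟨a, ha, h⟩ := exists_xiFamily_eq (hON := hON) hd huv p
  rw [h]
  exact smul_ne_zero ha fun h => colorVec_ne_zero (hON := hON) p (Subtype.ext h)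

theorem inner_xiFamily_of_ne {p p' : XiIndex} (hne : p ≠ p') :
    ⟪xiFamily u v Ω p, xiFamily u v Ω p'⟫_ℂ = 0 := by
  obtain ⟨a, -, h⟩ := exists_xiFamily_eq (hON := hON) hd huv p
  obtain ⟨a', -, h'⟩ := exists_xiFamily_eq (hON := hON) hd huv p'
  rw [h, h', inner_smul_left, inner_smul_right, ← Submodule.coe_inner, inner_colorVec_of_ne hne,
    mul_zero, mul_zero]

theorem L_le_closure_xiFamily :
    L d u v Ω ≤ (Submodule.span ℂ (Set.range (xiFamily u v Ω))).topologicalClosure := by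
  refine (L_le_closureL2_colorSpan (hON := hON) hd huv).trans (Submodule.topologicalClosure_mono ?_)
  rw [colorSpan, Submodule.map_span, Submodule.span_le]
  rintro _ ⟨_, ⟨p, rfl⟩, rfl⟩
  obtain ⟨a, ha, h⟩ := exists_xiFamily_eq (hON := hON) hd huv p
  refine (Submodule.smul_mem_iff _ ha).1 ?_
  exact h ▸ Submodule.subset_span ⟨p, rfl⟩

end ColorVec

end RotFree

end

theorem corollary3p12 {H : Type*} [NormedAddCommGroup H] [InnerProductSpace ℂ H] [CompleteSpace H]
    (d : ℂ) (hd : ‖d‖ = 1) (hroot : ∀ n : ℕ, n ≠ 0 → d ^ n ≠ 1)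
    (u v : Fin 2 → unitary (H →L[ℂ] H))
    (huv : ∀ i, (u i : H →L[ℂ] H) * (v i : H →L[ℂ] H) =
      d • ((v i : H →L[ℂ] H) * (u i : H →L[ℂ] H)))
    (Ω : H) (hM : RotFree.IsFreeProduct (RotFree.factorR u v) Ω) :
    -- sequences `ξ_m` exist, and for each of them the normalised `(ξ_m)_{r,s}` are a Riesz basis
    ((∃ ξ len kind, RotFree.IsBasisSequence u v Ω ξ len kind) ∧
      ∀ ξ len kind, RotFree.IsBasisSequence u v Ω ξ len kind →
        RotFree.IsRieszBasis
          (fun p : ℕ × ℕ × ℕ =>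
            ((‖RotFree.shift u v Ω (len p.1) (ξ p.1) p.2.1 p.2.2‖⁻¹ : ℝ) : ℂ) •
              RotFree.shift u v Ω (len p.1) (ξ p.1) p.2.1 p.2.2)
          (RotFree.L2A u Ω ⊔ RotFree.L d u v Ω)ᗮ) ∧
    -- `L` is contained in the orthogonal direct sum of the lines `ℂ ξ^{i,l,k}_{r,s}`
    ((∀ p, RotFree.xiFamily u v Ω p ≠ 0) ∧
      (Pairwise fun p p' => inner ℂ (RotFree.xiFamily u v Ω p) (RotFree.xiFamily u v Ω p') = 0) ∧
      RotFree.L d u v Ω ≤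
        (Submodule.span ℂ (Set.range (RotFree.xiFamily u v Ω))).topologicalClosure) ∧
    -- `L ⊕ (L²M ⊖ (L²A ⊕ L)) = L²M ⊖ L²A`, all direct sums being orthogonal
    (RotFree.L2A u Ω ⟂ RotFree.L d u v Ω ∧
      RotFree.L d u v Ω ⟂ (RotFree.L2A u Ω ⊔ RotFree.L d u v Ω)ᗮ ∧
      RotFree.L d u v Ω ⊔ (RotFree.L2A u Ω ⊔ RotFree.L d u v Ω)ᗮ = (RotFree.L2A u Ω)ᗮ) := by
  have hON := RotFree.orthonormal_words hd hroot huv hM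
  have hdense := RotFree.dense_span_words hd huv hM
  have hAL := RotFree.L2A_isOrtho_L hON hd huv
  exact ⟨⟨RotFree.exists_isBasisSequence hON hd huv,
      fun _ _ _ h => h.isRieszBasis hON hd huv hroot hdense⟩,
    ⟨RotFree.xiFamily_ne_zero hON hd huv, fun _ _ => RotFree.inner_xiFamily_of_ne hON hd huv,
      RotFree.L_le_closure_xiFamily hON hd huv⟩,
    hAL, Submodule.isOrtho_orthogonal_right _ |>.mono_left le_sup_right,
    RotFree.sup_orthogonal_sup (Submodule.isClosed_topologicalClosure _) hAL⟩
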